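/- A simplicial complex $X$ is $d$-dimensional if its largest faces have exactly $d+1$ vertices (purity is not required). Its dual graph $\mathcal G(X)$ has the $d$-dimensional faces of $X$ as vertices, two of them being adjacent if and only if they share exactly $d$ vertices. $X$ is strongly connected if $\mathcal G(X)$ is connected, and then the diameter of $X$ is the graph diameter of $\mathcal G(X)$. A $d$-dimensional simplicial complex is a $d$-pseudomanifold if each of its $(d-1)$-dimensional faces is contained in exactly two $d$-dimensional faces. Let $H_{pm}(n,d)$ denote the maximum diameter of a strongly connected $d$-pseudomanifold on $n$ vertices. Theorem. Let $d \ge 2$ be an integer and let $\epsilon < \frac{2}{d^3+d^2-2}$ be a real number. Then there is an $N$, depending only on $d$ and $\epsilon$, such that for all $n \ge N$ the maximum $H_{pm}(n,d)$ exists (i.e. strongly connected $d$-pseudomanifolds on $n$ vertices exist) and \[ \left(\frac{2}{(d+1)(d+1)!} - (\log n)^{-\epsilon}\right) n^d \;\le\; H_{pm}(n,d) \;\le\; \frac{2n^d}{(d+1)(d+1)!}. \] -/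

import Mathlib

/-- A `d`-dimensional simplicial complex: every face has dimension at most `d` (that is, at most
`d + 1` vertices), and there is a face of dimension exactly `d`. Purity is not required. -/
def HasDimension {V : Type*} (X : AbstractSimplicialComplex V) (d : ℕ) : Prop :=
  (∀ σ ∈ X.faces, σ.card ≤ d + 1) ∧ ∃ σ ∈ X.faces, σ.card = d + 1

/-- The `d`-dimensional faces of `X`. -/
def DFace {V : Type*} (X : AbstractSimplicialComplex V) (d : ℕ) : Type _ :=
  {σ : Finset V // σ ∈ X.faces ∧ σ.card = d + 1}

/-- The dual graph of a `d`-dimensional complex: its vertices are the `d`-faces, and two of them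
are adjacent when they meet in exactly `d` vertices, i.e. in a face of codimension one. -/
def dualGraph {V : Type*} [DecidableEq V] (X : AbstractSimplicialComplex V) (d : ℕ) :
    SimpleGraph (DFace X d) where
  Adj σ τ := (σ.1 ∩ τ.1).card = d
  symm := ⟨fun σ τ h => by rw [Finset.inter_comm]; exact h⟩
  loopless := ⟨fun σ h => by
    have h1 : (σ.1 ∩ σ.1).card = d := h
    rw [Finset.inter_self, σ.2.2] at h1
    omega⟩

/-- A `d`-dimensional complex is strongly connected when its dual graph is connected. -/
def StronglyConnected {V : Type*} [DecidableEq V] (X : AbstractSimplicialComplex V) (d : ℕ) :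
    Prop :=
  (dualGraph X d).Connected

/-- A `d`-pseudomanifold: a `d`-dimensional complex in which each `(d - 1)`-face (a face with `d`
vertices) is contained in exactly two `d`-faces. -/
def IsPseudomanifold {V : Type*} (X : AbstractSimplicialComplex V) (d : ℕ) : Prop :=
  HasDimension X d ∧
    ∀ τ ∈ X.faces, τ.card = d → {σ ∈ X.faces | σ.card = d + 1 ∧ τ ⊆ σ}.ncard = 2

/-- The set of diameters of strongly connected `d`-pseudomanifolds on `n` vertices. An
`AbstractSimplicialComplex` on `Fin n` contains all singletons, so it has exactly `n` vertices. -/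
def pmDiameters (n d : ℕ) : Set ℕ :=
  {k | ∃ X : AbstractSimplicialComplex (Fin n),
    IsPseudomanifold X d ∧ StronglyConnected X d ∧ (dualGraph X d).diam = k}

/-- `Hpm n d` is the maximum diameter of a (strongly connected) `d`-pseudomanifold on `n`
vertices. -/
noncomputable def Hpm (n d : ℕ) : ℕ := sSup (pmDiameters n d)

/-!
Bounds for the diameter of strongly connected pseudomanifolds.

**Upper bound.** Arrange the facets in levels, by their distance from one end of a diametral path of
the dual graph. Let `s` be a facet with neighbours both in the previous and in the next level.
Around a codimension-two face of `s`, the facets of lower levels are entered and left an even number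
of times in total; if one of the two ridges of `s` over this face leads downwards and the other one
upwards, then another facet of the level of `s` contains the face (`exists_facet_inter_eq`). Applied
to all vertices of `s`, this shows that every interior level has at least `d + 1` facets
(`le_card_level`). Each ridge lies in two facets, so there are at most `2 * n.choose d / (d + 1)`
facets, and the diameter is at most about `2 * n.choose d / (d + 1) ^ 2`
(`IsPseudomanifold.diam_le_of_large`).

**Tubes.** For the lower bound, take a sequence of `L` vertices (with repetitions) such that any
`d + 2` consecutive entries are distinct and such that no `d`-set of vertices occurs twice among
`d` positions inside a window of length `d + 2` (`IsTube`). The boundary of the union of the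
`(d + 1)`-simplices spanned by the windows is a strongly connected `d`-pseudomanifold, whose facets
are the sets of `d + 1` positions lying in just one window (`TubeFacet`, `tubeComplex`). The sum of
the positions of a facet other than the least one grows by at most `d + 1` along an edge of the
dual graph and by `d` when the facet is translated by one position, so the diameter is about
`d * L / (d + 1)` (`IsTube.le_diam`). About `d * (d + 1) / 2` sets of `d` positions in a
window start at any given position, so `L` is at most about `n.choose d / (d * (d + 1) / 2)`, and
the upper bound for the diameter is attained asymptotically if almost all `d`-sets are used.

**An almost optimal sequence.** The vertices, except for a small reserve, carry one of `t` types and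
a label, which consists of a height modulo `m` and of a stage modulo `d` for each `d`-set of types.
A set of `d + 2` types and a label for each of them describe a closed trail of length `(d + 2) * m`
that runs through the types cyclically and raises the heights by one in every turn (`labelTrail`).
For each `d`-set `e` of its types, the trail contains `d * m` sets of `d` vertices in windows: an
initial segment of `e` may be one turn ahead, and all heights may be shifted together. A shift does
not change the stage at `e` of such a set, and the segment changes it by its size. Only labels with
vanishing stages are admitted; then the stage of a shared `d`-set tells the segment, and trails that
share one `d`-set with types `e` share all `d * m` of them
(`exists_restrictLabel_eq_of_image_eq`). Hence families of trails without common `d`-sets correspond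
to the matchings of a hypergraph whose vertices are these classes of `d * m` sets and whose edges
have `k = (d + 2).choose 2` elements. It is regular with small codegrees (`degree_labelVertex`,
`codegree_labelVertex`), so it has an almost perfect matching
(`exists_matching_of_codegree_le`), found by the random greedy process: any fixed number of vertices
are uncovered almost independently, each with a probability that decreases like the `(k - 1)`-th
root of the inverse of the time.

Finally, the trails are cut open and joined by short blocks of reserve vertices, chosen one after
another such that no `d`-set is repeated (`exists_connectors`, `isTube_concatPaths`). With
`n = exp s`, about `s ^ (1 / (d + 1))` types and `n / s` reserve vertices, the dominating loss is
`s ^ (-1 / (k - 1))`, stemming from the matching, and `1 / (k - 1) = 2 / (d ^ 2 + 3 * d)` is at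
least `2 / (d ^ 3 + d ^ 2 - 2)` (`eventually_error_le`).
-/

section Aux

open Finset

/-! ### Levels of the dual graph -/

section Layers

variable {V : Type*} [DecidableEq V] {𝓕 : Finset (Finset V)} {d : ℕ}

lemma eq_or_eq_of_card_filter_eq_two {ρ σ σ' c : Finset V}
    (h2 : (𝓕.filter fun x => ρ ⊆ x).card = 2) (hσ : σ ∈ 𝓕) (hσ' : σ' ∈ 𝓕) (hc : c ∈ 𝓕)
    (hne : σ ≠ σ') (h1 : ρ ⊆ σ) (h1' : ρ ⊆ σ') (hρc : ρ ⊆ c) : c = σ ∨ c = σ' := by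
  by_contra hcon
  push Not at hcon
  have : ({c, σ, σ'} : Finset (Finset V)) ⊆ 𝓕.filter fun x => ρ ⊆ x := by
    intro x hx
    simp only [mem_insert, mem_singleton] at hx
    rcases hx with rfl | rfl | rfl <;> simp [*]
  have h3 := card_le_card this
  rw [h2, card_insert_of_notMem (by simp [hcon.1, hcon.2]), card_pair hne] at h3
  omega

lemma exists_other_of_card_filter_eq_two {ρ : Finset V}
    (h2 : (𝓕.filter fun x => ρ ⊆ x).card = 2) (σ : Finset V) :
    ∃ σ' ∈ 𝓕, σ' ≠ σ ∧ ρ ⊆ σ' := by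
  obtain ⟨σ', hσ', hne⟩ := exists_mem_ne (by omega : 1 < (𝓕.filter fun x => ρ ⊆ x).card) σ
  rw [mem_filter] at hσ'
  exact ⟨σ', hσ'.1, hne, hσ'.2⟩

lemma card_inter_eq_of_subset {σ σ' ρ : Finset V} (hσ : σ.card = d + 1) (hσ' : σ'.card = d + 1)
    (hne : σ ≠ σ') (hρ : ρ.card = d) (h1 : ρ ⊆ σ) (h2 : ρ ⊆ σ') :
    (σ ∩ σ').card = d := by
  have h3 : d ≤ (σ ∩ σ').card := hρ ▸ card_le_card (subset_inter h1 h2)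
  have h4 : (σ ∩ σ').card ≤ d + 1 := hσ ▸ card_le_card inter_subset_left
  by_contra hcon
  have h5 : (σ ∩ σ').card = d + 1 := by omega
  have h6 := eq_of_subset_of_card_le (inter_subset_left : σ ∩ σ' ⊆ σ) (by omega)
  have h7 := eq_of_subset_of_card_le (inter_subset_right : σ ∩ σ' ⊆ σ') (by omega)
  exact hne (h6.symm.trans h7)

/-- Around a codimension-two face `τ` of a facet `s` of level `i`, the lower levels are entered an
even number of times. If one of the two ridges of `s` over `τ` leads below level `i` and the other
one leads above it, then a second facet of level `i` meets `s` exactly in `τ`. -/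
lemma exists_facet_inter_eq [Fintype V] (hcard : ∀ σ ∈ 𝓕, σ.card = d + 1)
    (htwo : ∀ σ ∈ 𝓕, ∀ ρ ⊆ σ, ρ.card = d → (𝓕.filter fun x => ρ ⊆ x).card = 2)
    {lev : Finset V → ℕ}
    (hlev : ∀ σ ∈ 𝓕, ∀ σ' ∈ 𝓕, (σ ∩ σ').card = d → lev σ ≤ lev σ' + 1) {s a b : Finset V}
    (hs : s ∈ 𝓕) (ha : a ∈ 𝓕) (hb : b ∈ 𝓕) {w w' : V} (hw : w ∈ s) (hw' : w' ∈ s)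
    (hww : w ≠ w') (hsa : s.erase w ⊆ a) (hsb : s.erase w' ⊆ b) (hla : lev a < lev s)
    (hlb : lev s < lev b) :
    ∃ s₁ ∈ 𝓕, lev s₁ = lev s ∧ s ∩ s₁ = (s.erase w).erase w' := by
  set τ := (s.erase w).erase w' with hτ
  have hcs := hcard s hs
  have hτc : τ.card + 1 = d := by
    rw [hτ, card_erase_of_mem (mem_erase.2 ⟨hww.symm, hw'⟩), card_erase_of_mem hw, hcs]
    have : 0 < ((s.erase w).card) := card_pos.2 ⟨w', mem_erase.2 ⟨hww.symm, hw'⟩⟩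
    rw [card_erase_of_mem hw, hcs] at this
    omega
  have hτs : τ ⊆ s := (erase_subset _ _).trans (erase_subset _ _)
  have hwτ : w ∉ τ := by simp [hτ]
  have hwτ' : w' ∉ τ := by simp [hτ]
  have hins : insert w' τ = s.erase w := by
    rw [hτ, insert_erase (mem_erase.2 ⟨hww.symm, hw'⟩)]
  have hins' : insert w τ = s.erase w' := by
    rw [hτ, erase_right_comm, insert_erase (mem_erase.2 ⟨hww, hw⟩)]
  -- `A` consists of the lower facets around `τ`, and `c x` of them contain the ridge `insert x τ`
  set A := 𝓕.filter fun x => τ ⊆ x ∧ lev x < lev s with hA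
  set c : V → ℕ := fun x => (A.filter fun y => insert x τ ⊆ y).card with hc
  have hinsc : ∀ x ∉ τ, (insert x τ).card = d := fun x hx => by
    rw [card_insert_of_notMem hx, hτc]
  have hsum : ∑ x ∈ univ \ τ, c x = 2 * A.card := by
    simp only [hc, card_filter]
    rw [sum_comm]
    have : ∀ y ∈ A, (∑ x ∈ univ \ τ, if insert x τ ⊆ y then 1 else 0) = 2 := by
      intro y hy
      rw [hA, mem_filter] at hy
      rw [← card_filter]
      have h1 : (univ \ τ).filter (fun x => insert x τ ⊆ y) = y \ τ := by
        ext x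
        simp only [mem_filter, mem_sdiff, mem_univ, true_and, insert_subset_iff]
        tauto
      rw [h1, card_sdiff_of_subset hy.2.1, hcard y hy.1]
      omega
    rw [sum_congr rfl this, sum_const, smul_eq_mul, mul_comm]
  -- the sum of the `c x` is even, so that an even number of ridges bound the lower facets
  have heven : Even ((univ \ τ).filter fun x => Odd (c x)).card := by
    rw [← even_sum_iff_even_card_odd, hsum]
    exact even_two_mul _
  have has : a ≠ s := fun h => by rw [h] at hla; exact lt_irrefl _ hla
  have hbs : b ≠ s := fun h => by rw [h] at hlb; exact lt_irrefl _ hlb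
  have hsw : (s.erase w).card = d := by rw [card_erase_of_mem hw, hcs]; rfl
  have hsw' : (s.erase w').card = d := by rw [card_erase_of_mem hw', hcs]; rfl
  have hside : ∀ x ∈ 𝓕, s.erase w ⊆ x → x = s ∨ x = a := fun x hx hsub =>
    eq_or_eq_of_card_filter_eq_two (htwo s hs _ (erase_subset _ _) hsw) hs ha hx has.symm
      (erase_subset _ _) hsa hsub
  have hside' : ∀ x ∈ 𝓕, s.erase w' ⊆ x → x = s ∨ x = b := fun x hx hsub =>
    eq_or_eq_of_card_filter_eq_two (htwo s hs _ (erase_subset _ _) hsw') hs hb hx hbs.symm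
      (erase_subset _ _) hsb hsub
  -- the ridge between `s` and `a` is one of them
  have hcw' : c w' = 1 := by
    rw [hc]
    simp only [hins]
    rw [card_eq_one]
    refine ⟨a, ?_⟩
    ext x
    rw [mem_filter, mem_singleton, hA, mem_filter]
    constructor
    · rintro ⟨⟨h1, -, h2⟩, h3⟩
      rcases hside x h1 h3 with rfl | rfl
      · exact absurd h2 (lt_irrefl _)
      · rfl
    · rintro rfl
      exact ⟨⟨ha, (erase_subset _ _).trans hsa, hla⟩, hsa⟩
  have hw'mem : w' ∈ (univ \ τ).filter fun x => Odd (c x) := by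
    simp [hwτ', hcw']
  have h1lt : 1 < ((univ \ τ).filter fun x => Odd (c x)).card := by
    have h0 : 0 < ((univ \ τ).filter fun x => Odd (c x)).card := card_pos.2 ⟨w', hw'mem⟩
    obtain ⟨m, hm⟩ := heven
    omega
  -- across a second one, a lower facet `y` has a neighbour `s₁` which is not lower
  obtain ⟨x, hx, hxw⟩ := exists_mem_ne h1lt w'
  simp only [mem_filter, mem_sdiff, mem_univ, true_and] at hx
  obtain ⟨hxτ, hodd⟩ := hx
  have hcpos : 0 < c x := hodd.pos
  obtain ⟨y, hy⟩ := card_pos.1 hcpos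
  rw [mem_filter, hA, mem_filter] at hy
  obtain ⟨⟨hy𝓕, hτy, hly⟩, hxy⟩ := hy
  have htwox := htwo y hy𝓕 _ hxy (hinsc x hxτ)
  obtain ⟨s₁, hs₁, hne, hxs₁⟩ := exists_other_of_card_filter_eq_two htwox y
  have hadj := card_inter_eq_of_subset (hcard _ hs₁) (hcard _ hy𝓕) hne (hinsc x hxτ) hxs₁ hxy
  have hle := hlev _ hs₁ _ hy𝓕 hadj
  have hge : ¬ lev s₁ < lev s := by
    intro hlt
    have : A.filter (fun z => insert x τ ⊆ z) = 𝓕.filter fun z => insert x τ ⊆ z := by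
      ext z
      rw [mem_filter, hA, mem_filter, mem_filter]
      constructor
      · rintro ⟨⟨h1, -⟩, h2⟩; exact ⟨h1, h2⟩
      · rintro ⟨h1, h2⟩
        refine ⟨⟨h1, (subset_insert _ _).trans h2, ?_⟩, h2⟩
        rcases eq_or_eq_of_card_filter_eq_two htwox hs₁ hy𝓕 h1 hne hxs₁ hxy h2 with rfl | rfl
        · exact hlt
        · exact hly
    have hc2 : c x = 2 := by rw [hc]; simp only; rw [this, htwox]
    rw [hc2] at hodd
    exact absurd hodd (by decide)
  have hτs₁ : τ ⊆ s₁ := (subset_insert _ _).trans hxs₁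
  -- the ridge of `s` over `τ` that does not lead to `a` leads upwards
  have hs₁s : s₁ ≠ s := by
    rintro rfl
    have hxs : x ∈ s₁ := hxs₁ (mem_insert_self _ _)
    have hxw2 : x = w := by
      by_contra h
      exact hxτ (mem_erase.2 ⟨hxw, mem_erase.2 ⟨h, hxs⟩⟩)
    rw [hxw2, hins'] at hxy
    rcases hside' y hy𝓕 hxy with rfl | rfl
    · exact lt_irrefl _ hly
    · omega
  refine ⟨s₁, hs₁, by omega, Subset.antisymm ?_ (subset_inter hτs hτs₁)⟩
  intro z hz
  rw [mem_inter] at hz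
  by_contra hzτ
  have : z = w ∨ z = w' := by
    by_contra h
    push Not at h
    exact hzτ (mem_erase.2 ⟨h.2, mem_erase.2 ⟨h.1, hz.1⟩⟩)
  rcases this with rfl | rfl
  · have : s.erase w' ⊆ s₁ := by
      rw [← hins']; exact insert_subset hz.2 hτs₁
    rcases hside' s₁ hs₁ this with h | h
    · exact hs₁s h
    · rw [h] at hle; omega
  · have : s.erase w ⊆ s₁ := by
      rw [← hins]; exact insert_subset hz.2 hτs₁
    rcases hside s₁ hs₁ this with h | h
    · exact hs₁s h
    · rw [h] at hge; omega

/-- A facet `s` with a neighbour `a` in the previous and a neighbour `b` in the next level shares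
its level with at least `d` other facets, one for every vertex `w` of `s` except the one opposite to
`a`. If the neighbour opposite to `w` has the level of `s`, this is the required facet. Otherwise it
is lower or higher, and `exists_facet_inter_eq` applies to it together with `b` or `a`. -/
lemma le_card_level [Fintype V] (hcard : ∀ σ ∈ 𝓕, σ.card = d + 1)
    (htwo : ∀ σ ∈ 𝓕, ∀ ρ ⊆ σ, ρ.card = d → (𝓕.filter fun x => ρ ⊆ x).card = 2)
    {lev : Finset V → ℕ}
    (hlev : ∀ σ ∈ 𝓕, ∀ σ' ∈ 𝓕, (σ ∩ σ').card = d → lev σ ≤ lev σ' + 1) {s a b : Finset V}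
    (hs : s ∈ 𝓕) (ha : a ∈ 𝓕) (hb : b ∈ 𝓕) (hsa : (s ∩ a).card = d) (hsb : (s ∩ b).card = d)
    (hla : lev a < lev s) (hlb : lev s < lev b) :
    d + 1 ≤ (𝓕.filter fun x => lev x = lev s).card := by
  have hcs := hcard s hs
  have hex : ∀ x, (s ∩ x).card = d → ∃ w ∈ s, s.erase w = s ∩ x := by
    intro x hx
    have h1 : (s \ (s ∩ x)).card = 1 := by
      rw [card_sdiff_of_subset inter_subset_left, hx, hcs]; omega
    obtain ⟨w, hw⟩ := card_eq_one.1 h1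
    have hwm : w ∈ s \ (s ∩ x) := by rw [hw]; exact mem_singleton_self w
    rw [mem_sdiff] at hwm
    refine ⟨w, hwm.1, ?_⟩
    rw [← sdiff_singleton_eq_erase, ← hw, Finset.sdiff_sdiff_eq_self inter_subset_left]
  obtain ⟨w₀, hw₀, hwa⟩ := hex a hsa
  obtain ⟨w₁, hw₁, hwb⟩ := hex b hsb
  have hoth : ∀ w ∈ s, ∃ x ∈ 𝓕, x ≠ s ∧ s.erase w ⊆ x := fun w hw =>
    exists_other_of_card_filter_eq_two (htwo s hs _ (erase_subset _ _)
      (by rw [card_erase_of_mem hw, hcs]; rfl)) s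
  choose! o ho hos hoe using hoth
  have hside : ∀ w ∈ s, ∀ x ∈ 𝓕, x ≠ s → s.erase w ⊆ x → x = o w := fun w hw x hx hxs hsub =>
    (eq_or_eq_of_card_filter_eq_two (htwo s hs _ (erase_subset _ _)
      (by rw [card_erase_of_mem hw, hcs]; rfl)) hs (ho w hw) hx (hos w hw).symm
      (erase_subset _ _) (hoe w hw) hsub).resolve_left hxs
  have hinter : ∀ w ∈ s, s ∩ o w = s.erase w := by
    intro w hw
    have h1 : (s.erase w).card = d := by rw [card_erase_of_mem hw, hcs]; rfl
    refine (eq_of_subset_of_card_le (subset_inter (erase_subset _ _) (hoe w hw)) ?_).symm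
    rw [h1, card_inter_eq_of_subset hcs (hcard _ (ho w hw)) (hos w hw).symm h1
      (erase_subset _ _) (hoe w hw)]
  have ha0 : a = o w₀ := hside w₀ hw₀ a ha (fun h => by rw [h] at hla; exact lt_irrefl _ hla)
    (hwa ▸ inter_subset_right)
  have hb1 : b = o w₁ := hside w₁ hw₁ b hb (fun h => by rw [h] at hlb; exact lt_irrefl _ hlb)
    (hwb ▸ inter_subset_right)
  have hw01 : w₀ ≠ w₁ := by
    rintro rfl
    rw [ha0] at hla; rw [hb1] at hlb; omega
  -- the facets found for different `w` differ, as they miss different sets of vertices of `s`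
  have key : ∀ w ∈ s, ∃ x ∈ 𝓕, lev x = lev s ∧ s \ x =
      (if lev (o w) = lev s then {w} else if lev s < lev (o w) then {w₀, w}
        else if w = w₀ then ∅ else {w, w₁}) := by
    intro w hw
    split_ifs with h1 h2 h3
    · refine ⟨o w, ho w hw, h1, ?_⟩
      rw [← sdiff_inter_self_left, hinter w hw, sdiff_erase_self hw]
    · have hww : w₀ ≠ w := by
        rintro rfl
        rw [← ha0] at h2; omega
      obtain ⟨x, hx, hlx, hix⟩ := exists_facet_inter_eq hcard htwo hlev hs ha (ho w hw) hw₀ hw hww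
        (hwa ▸ inter_subset_right) (hoe w hw) hla h2
      refine ⟨x, hx, hlx, ?_⟩
      rw [← sdiff_inter_self_left, hix]
      ext y
      simp only [mem_sdiff, mem_erase, mem_insert, mem_singleton]
      constructor
      · intro h; by_contra hc; push Not at hc; exact h.2 ⟨hc.2, hc.1, h.1⟩
      · rintro (rfl | rfl)
        · exact ⟨hw₀, fun h => h.2.1 rfl⟩
        · exact ⟨hw, fun h => h.1 rfl⟩
    · exact ⟨s, hs, rfl, Finset.sdiff_self s⟩
    · have hlo : lev (o w) < lev s := by omega
      have hww : w ≠ w₁ := by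
        rintro rfl
        rw [← hb1] at hlo; omega
      obtain ⟨x, hx, hlx, hix⟩ := exists_facet_inter_eq hcard htwo hlev hs (ho w hw) hb hw hw₁ hww
        (hoe w hw) (hwb ▸ inter_subset_right) hlo hlb
      refine ⟨x, hx, hlx, ?_⟩
      rw [← sdiff_inter_self_left, hix]
      ext y
      simp only [mem_sdiff, mem_erase, mem_insert, mem_singleton]
      constructor
      · intro h; by_contra hc; push Not at hc; exact h.2 ⟨hc.2, hc.1, h.1⟩
      · rintro (rfl | rfl)
        · exact ⟨hw, fun h => h.2.1 rfl⟩
        · exact ⟨hw₁, fun h => h.1 rfl⟩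
  choose! φ hφ hφl hφs using key
  rw [← hcs]
  refine card_le_card_of_injOn φ (fun w hw => mem_coe.2 (mem_filter.2 ⟨hφ w hw, hφl w hw⟩)) ?_
  intro w hw w' hw' heq
  have h1 := hφs w hw
  have h2 := hφs w' hw'
  rw [heq, h2] at h1
  have h01 : lev (o w₀) < lev s := ha0 ▸ hla
  have h11 : lev s < lev (o w₁) := hb1 ▸ hlb
  have e0 := Finset.ext_iff.1 h1 w
  have e1 := Finset.ext_iff.1 h1 w'
  have e2 := Finset.ext_iff.1 h1 w₀
  have e3 := Finset.ext_iff.1 h1 w₁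
  split_ifs at e0 e1 e2 e3 <;>
    simp only [mem_insert, mem_singleton, notMem_empty] at e0 e1 e2 e3 <;> grind

end Layers

/-! ### The upper bound -/

section UpperBound

lemma SimpleGraph.Connected.exists_adj_dist_eq {α : Type*} {G : SimpleGraph α} (hG : G.Connected)
    {u v : α} {m : ℕ} (h : G.dist u v = m + 1) : ∃ w, G.Adj w v ∧ G.dist u w = m := by
  obtain ⟨p, hp⟩ := hG.exists_walk_length_eq_dist v u
  rw [SimpleGraph.dist_comm, h] at hp
  cases p with
  | nil => simp at hp
  | cons hadj q =>
    rename_i w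
    refine ⟨w, hadj.symm, ?_⟩
    simp only [SimpleGraph.Walk.length_cons, Nat.add_right_cancel_iff] at hp
    have h1 : G.dist u w ≤ m := by rw [SimpleGraph.dist_comm, ← hp]; exact SimpleGraph.dist_le q
    have h2 := hG.dist_triangle (u := u) (v := w) (w := v)
    rw [h, SimpleGraph.dist_eq_one_iff_adj.2 hadj.symm] at h2
    omega

lemma SimpleGraph.Connected.exists_dist_eq_of_le {α : Type*} {G : SimpleGraph α}
    (hG : G.Connected) {u v : α} {j : ℕ} (h : j ≤ G.dist u v) : ∃ w, G.dist u w = j := by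
  induction hm : G.dist u v - j generalizing v with
  | zero => exact ⟨v, by omega⟩
  | succ m ih =>
    obtain ⟨w, -, hw⟩ := hG.exists_adj_dist_eq (show G.dist u v = (G.dist u v - 1) + 1 by omega)
    exact ih (v := w) (by omega) (by omega)

lemma AbstractSimplicialComplex.mem_faces_of_subset {V : Type*} (X : AbstractSimplicialComplex V)
    {s t : Finset V} (hs : s ∈ X.faces) (hts : t ⊆ s) (ht : t.Nonempty) : t ∈ X.faces :=
  (X.isRelLowerSet_faces hs).2 hts ht

variable {n d : ℕ} {X : AbstractSimplicialComplex (Fin n)}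

open Classical in
/-- The `d`-faces of a complex, as a finite set of vertex sets. -/
noncomputable def facetFinset (X : AbstractSimplicialComplex (Fin n)) (d : ℕ) :
    Finset (Finset (Fin n)) :=
  univ.filter fun σ => σ ∈ X.faces ∧ σ.card = d + 1

lemma mem_facetFinset {σ : Finset (Fin n)} :
    σ ∈ facetFinset X d ↔ σ ∈ X.faces ∧ σ.card = d + 1 := by
  simp [facetFinset]

lemma IsPseudomanifold.card_filter_subset (hX : IsPseudomanifold X d) (hd : 1 ≤ d)
    {σ ρ : Finset (Fin n)} (hσ : σ ∈ facetFinset X d) (hρσ : ρ ⊆ σ) (hρ : ρ.card = d) :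
    ((facetFinset X d).filter fun x => ρ ⊆ x).card = 2 := by
  have h1 := hX.2 ρ (X.mem_faces_of_subset (mem_facetFinset.1 hσ).1 hρσ
    (card_pos.1 (by omega))) hρ
  rw [← h1, ← Set.ncard_coe_finset]
  congr 1
  ext x
  simp [mem_facetFinset, and_assoc]

/-- Double counting of the ridges: a facet has `d + 1` of them, and each lies in two facets. -/
lemma IsPseudomanifold.card_facetFinset_le (hX : IsPseudomanifold X d) (hd : 1 ≤ d) :
    (d + 1) * (facetFinset X d).card ≤ 2 * n.choose d := by
  have h1 : ∑ σ ∈ facetFinset X d, ((powersetCard d univ).filter fun ρ => ρ ⊆ σ).card =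
      (d + 1) * (facetFinset X d).card := by
    have : ∀ σ ∈ facetFinset X d,
        ((powersetCard d univ).filter fun ρ => ρ ⊆ σ).card = d + 1 := by
      intro σ hσ
      have h2 : (powersetCard d univ).filter (fun ρ => ρ ⊆ σ) = powersetCard d σ := by
        ext ρ; simp [mem_powersetCard, and_comm]
      rw [h2, card_powersetCard, (mem_facetFinset.1 hσ).2, Nat.choose_succ_self_right]
    rw [sum_congr rfl this, sum_const, smul_eq_mul, mul_comm]
  rw [← h1]
  simp only [card_filter]
  rw [sum_comm]
  have h2 : ∀ ρ ∈ powersetCard d (univ : Finset (Fin n)),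
      (∑ σ ∈ facetFinset X d, if ρ ⊆ σ then 1 else 0) ≤ 2 := by
    intro ρ hρ
    rw [← card_filter]
    by_cases hex : ∃ σ ∈ facetFinset X d, ρ ⊆ σ
    · obtain ⟨σ, hσ, hρσ⟩ := hex
      exact (hX.card_filter_subset hd hσ hρσ (mem_powersetCard.1 hρ).2).le
    · push Not at hex
      rw [filter_false_of_mem hex]
      simp
  refine (sum_le_sum h2).trans ?_
  rw [sum_const, card_powersetCard, card_univ, Fintype.card_fin, smul_eq_mul, mul_comm]

/-- Every interior level of the dual graph, seen from an end of a diametral path, contains at least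
`d + 1` facets. -/
lemma IsPseudomanifold.diam_le (hX : IsPseudomanifold X d) (hc : StronglyConnected X d)
    (hd : 1 ≤ d) : (d + 1) ^ 2 * (dualGraph X d).diam ≤ 2 * n.choose d + (d + 1) ^ 2 := by
  classical
  have : Nonempty (DFace X d) := hc.nonempty
  obtain ⟨u, v, huv⟩ := (dualGraph X d).exists_dist_eq_diam
  set k := (dualGraph X d).diam with hk
  -- the level of a facet is its distance from `u`; other sets get the irrelevant level `0`
  set lev : Finset (Fin n) → ℕ := fun σ =>
    if h : σ ∈ X.faces ∧ σ.card = d + 1 then (dualGraph X d).dist u ⟨σ, h⟩ else 0 with hlev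
  have hlevx : ∀ x : DFace X d, lev x.1 = (dualGraph X d).dist u x := by
    intro x
    rw [hlev]
    simp only
    rw [dif_pos x.2]
    rfl
  have hmem : ∀ x : DFace X d, x.1 ∈ facetFinset X d := fun x => mem_facetFinset.2 x.2
  have hlip : ∀ σ ∈ facetFinset X d, ∀ σ' ∈ facetFinset X d, (σ ∩ σ').card = d →
      lev σ ≤ lev σ' + 1 := by
    intro σ hσ σ' hσ' hadj
    have h1 := hlevx ⟨σ, mem_facetFinset.1 hσ⟩
    have h2 := hlevx ⟨σ', mem_facetFinset.1 hσ'⟩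
    have h3 : (dualGraph X d).Adj ⟨σ', mem_facetFinset.1 hσ'⟩ ⟨σ, mem_facetFinset.1 hσ⟩ := by
      change (σ' ∩ σ).card = d
      rw [inter_comm]; exact hadj
    have h4 := hc.dist_triangle (u := u) (v := ⟨σ', mem_facetFinset.1 hσ'⟩)
      (w := ⟨σ, mem_facetFinset.1 hσ⟩)
    rw [SimpleGraph.dist_eq_one_iff_adj.2 h3, ← h1, ← h2] at h4
    exact h4
  have hlevel : ∀ i ∈ Finset.Ico 1 k,
      d + 1 ≤ ((facetFinset X d).filter fun x => lev x = i).card := by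
    intro i hi
    rw [mem_Ico] at hi
    obtain ⟨b, hb⟩ := hc.exists_dist_eq_of_le (u := u) (v := v) (j := i + 1) (by omega)
    obtain ⟨s, hsb, hs⟩ := hc.exists_adj_dist_eq hb
    obtain ⟨a, has, ha⟩ := hc.exists_adj_dist_eq (show (dualGraph X d).dist u s = (i - 1) + 1 by
      omega)
    have := le_card_level (fun σ hσ => (mem_facetFinset.1 hσ).2)
      (fun σ hσ ρ hρ hρc => hX.card_filter_subset hd hσ hρ hρc) hlip (hmem s) (hmem a) (hmem b)
      (by rw [inter_comm]; exact has) hsb (by rw [hlevx, hlevx]; omega)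
      (by rw [hlevx, hlevx]; omega)
    rw [hlevx, hs] at this
    exact this
  have hcount : (d + 1) * (k - 1) ≤ (facetFinset X d).card := by
    calc (d + 1) * (k - 1) = ∑ i ∈ Finset.Ico 1 k, (d + 1) := by
          rw [sum_const, Nat.card_Ico, smul_eq_mul, mul_comm]
      _ ≤ ∑ i ∈ Finset.Ico 1 k, ((facetFinset X d).filter fun x => lev x = i).card :=
          sum_le_sum hlevel
      _ = ((Finset.Ico 1 k).biUnion fun i => (facetFinset X d).filter fun x => lev x = i).card := by
          rw [card_biUnion]
          intro i _ j _ hij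
          rw [Function.onFun, disjoint_left]
          intro x hx hx'
          exact hij ((mem_filter.1 hx).2.symm.trans (mem_filter.1 hx').2)
      _ ≤ _ := card_le_card (biUnion_subset.2 fun i _ => filter_subset _ _)
  have h1 := hX.card_facetFinset_le hd
  have h2 : (d + 1) * ((d + 1) * (k - 1)) ≤ 2 * n.choose d :=
    (Nat.mul_le_mul_left _ hcount).trans h1
  have h3 : k ≤ (k - 1) + 1 := by omega
  calc (d + 1) ^ 2 * k ≤ (d + 1) ^ 2 * ((k - 1) + 1) := Nat.mul_le_mul_left _ h3
    _ = (d + 1) * ((d + 1) * (k - 1)) + (d + 1) ^ 2 := by ring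
    _ ≤ _ := by omega

/-- The gap between `n.descFactorial d` and `n ^ d`, which absorbs the two end levels. -/
lemma choose_mul_factorial_add_le {n d : ℕ} (hd : 2 ≤ d) (hn : 1 ≤ n) :
    n.choose d * d.factorial + n ^ (d - 1) ≤ n ^ d := by
  obtain ⟨e, rfl⟩ : ∃ e, d = e + 2 := ⟨d - 2, by omega⟩
  rw [mul_comm, ← Nat.descFactorial_eq_factorial_mul_choose, show e + 2 - 1 = e + 1 by omega]
  have h1 : n.descFactorial (e + 2) ≤ n ^ (e + 1) * (n - 1) := by
    induction e with
    | zero => simp [Nat.descFactorial, mul_comm]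
    | succ e ih =>
      rw [Nat.descFactorial_succ]
      calc (n - (e + 2)) * n.descFactorial (e + 2) ≤ n * (n ^ (e + 1) * (n - 1)) :=
            Nat.mul_le_mul (Nat.sub_le _ _) (ih (by omega))
        _ = _ := by ring
  calc _ ≤ n ^ (e + 1) * (n - 1) + n ^ (e + 1) := by omega
    _ = n ^ (e + 1) * ((n - 1) + 1) := by ring
    _ = n ^ (e + 2) := by rw [Nat.sub_add_cancel hn]; ring

lemma IsPseudomanifold.diam_le_of_large (hX : IsPseudomanifold X d) (hc : StronglyConnected X d)
    (hd : 2 ≤ d) (hn : (d + 1) ^ 2 * d.factorial ≤ n) :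
    ((dualGraph X d).diam : ℝ) ≤
      2 * (n : ℝ) ^ d / (((d : ℝ) + 1) * (Nat.factorial (d + 1) : ℝ)) := by
  have h1 := hX.diam_le hc (by omega)
  have hpos : 0 < (d + 1) ^ 2 * d.factorial := by positivity
  have h0 : 1 ≤ n := by omega
  have h2 := choose_mul_factorial_add_le hd h0
  have h3 : (d + 1) ^ 2 * d.factorial ≤ n ^ (d - 1) :=
    hn.trans (Nat.le_self_pow (by omega) n)
  have h4 : ((d + 1) * (d + 1).factorial) * (dualGraph X d).diam ≤ 2 * n ^ d := by
    rw [Nat.factorial_succ]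
    calc (d + 1) * ((d + 1) * d.factorial) * (dualGraph X d).diam
        = ((d + 1) ^ 2 * (dualGraph X d).diam) * d.factorial := by ring
      _ ≤ (2 * n.choose d + (d + 1) ^ 2) * d.factorial := Nat.mul_le_mul_right _ h1
      _ = 2 * (n.choose d * d.factorial) + (d + 1) ^ 2 * d.factorial := by ring
      _ ≤ 2 * n ^ d := by omega
  rw [le_div_iff₀ (by positivity)]
  have h5 : (((d + 1) * (d + 1).factorial * (dualGraph X d).diam : ℕ) : ℝ) ≤
    ((2 * n ^ d : ℕ) : ℝ) := by exact_mod_cast h4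
  push_cast at h5
  linarith

end UpperBound

/-! ### Tubes -/

section Tube

/-- The positions of the facets of a tube: the `(d + 1)`-subsets of `[0, L)` contained in exactly
one window of `d + 2` consecutive positions, that is, those of diameter `d + 1` and the two
extreme intervals. -/
structure TubeFacet (d L : ℕ) (A : Finset ℕ) : Prop where
  card : A.card = d + 1
  lt : ∀ x ∈ A, x < L
  short : ∀ x ∈ A, ∀ y ∈ A, x ≤ y + (d + 1)
  outer : (∃ x ∈ A, x + (d + 1) ∈ A) ∨ (∀ x ∈ A, x ≤ d) ∨ ∀ x ∈ A, L ≤ x + (d + 1)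

/-- The facets over a set `B` of `d` positions between `p` and `q`, in terms of the position `y`
that is added to `B`. -/
lemma tubeFacet_insert_iff {d L p q y : ℕ} {B : Finset ℕ} (hB : B.card = d) (hpB : p ∈ B)
    (hqB : q ∈ B) (hp : ∀ x ∈ B, p ≤ x) (hq : ∀ x ∈ B, x ≤ q) (hqL : q < L) (hpq : q ≤ p + (d + 1))
    (hy : y ∉ B) :
    TubeFacet d L (insert y B) ↔ y < L ∧ y ≤ p + (d + 1) ∧ q ≤ y + (d + 1) ∧
      (q = p + (d + 1) ∨ q = y + (d + 1) ∨ y = p + (d + 1) ∨ (q ≤ d ∧ y ≤ d) ∨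
        (L ≤ p + (d + 1) ∧ L ≤ y + (d + 1))) := by
  constructor
  · rintro ⟨-, h1, h2, h3⟩
    have h4 := h1 y (mem_insert_self _ _)
    have h5 := h2 y (mem_insert_self _ _) p (mem_insert_of_mem hpB)
    have h6 := h2 q (mem_insert_of_mem hqB) y (mem_insert_self _ _)
    refine ⟨h4, h5, h6, ?_⟩
    rcases h3 with ⟨x, hx, hx'⟩ | h3 | h3
    · rcases mem_insert.1 hx with rfl | hx <;> rcases mem_insert.1 hx' with hx' | hx'
      · omega
      · have := hq _ hx'; omega
      · have := hp _ hx; omega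
      · have := hp _ hx; have := hq _ hx'; omega
    · have := h3 q (mem_insert_of_mem hqB)
      have := h3 y (mem_insert_self _ _)
      omega
    · have := h3 p (mem_insert_of_mem hpB)
      have := h3 y (mem_insert_self _ _)
      omega
  · rintro ⟨h1, h2, h3, h4⟩
    refine ⟨by rw [card_insert_of_notMem hy, hB], ?_, ?_, ?_⟩
    · intro x hx
      rcases mem_insert.1 hx with rfl | hx
      · exact h1
      · have := hq x hx; omega
    · intro x hx z hz
      rcases mem_insert.1 hx with h5 | h5 <;> rcases mem_insert.1 hz with h6 | h6
      · omega
      · have := hp z h6; omega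
      · have := hq x h5; omega
      · have := hp z h6; have := hq x h5; omega
    · rcases h4 with h4 | h4 | h4 | h4 | h4
      · exact Or.inl ⟨p, mem_insert_of_mem hpB, h4 ▸ mem_insert_of_mem hqB⟩
      · exact Or.inl ⟨y, mem_insert_self _ _, h4 ▸ mem_insert_of_mem hqB⟩
      · exact Or.inl ⟨p, mem_insert_of_mem hpB, h4 ▸ mem_insert_self _ _⟩
      · refine Or.inr (Or.inl fun x hx => ?_)
        rcases mem_insert.1 hx with rfl | hx
        · omega
        · have := hq x hx; omega
      · refine Or.inr (Or.inr fun x hx => ?_)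
        rcases mem_insert.1 hx with rfl | hx
        · omega
        · have := hp x hx; omega

/-- Every ridge of a tube lies in exactly two facets. -/
lemma TubeFacet.exists_two {d L : ℕ} (hd : 1 ≤ d) (hL : d + 4 ≤ L) {A B : Finset ℕ}
    (hA : TubeFacet d L A) (hBA : B ⊆ A) (hB : B.card = d) :
    ∃ y₁ y₂, y₁ ∉ B ∧ y₂ ∉ B ∧ y₁ ≠ y₂ ∧ ∀ y ∉ B,
      (TubeFacet d L (insert y B) ↔ y = y₁ ∨ y = y₂) := by
  have hne : B.Nonempty := card_pos.1 (by omega)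
  obtain ⟨p, hpB, hp⟩ : ∃ p ∈ B, ∀ x ∈ B, p ≤ x :=
    ⟨B.min' hne, min'_mem _ _, fun x hx => min'_le _ _ hx⟩
  obtain ⟨q, hqB, hq⟩ : ∃ q ∈ B, ∀ x ∈ B, x ≤ q :=
    ⟨B.max' hne, max'_mem _ _, fun x hx => le_max' _ _ hx⟩
  have hqL := hA.lt q (hBA hqB)
  have hpq := hA.short q (hBA hqB) p (hBA hpB)
  have hple := hp q hqB
  have hiff := fun y (hy : y ∉ B) => tubeFacet_insert_iff hB hpB hqB hp hq hqL hpq hy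
  have hsub : B ⊆ Icc p q := fun x hx => mem_Icc.2 ⟨hp x hx, hq x hx⟩
  have hgap : (Icc p q \ B).card = q + 1 - p - d := by
    rw [card_sdiff_of_subset hsub, Nat.card_Icc, hB]
  have hlow : d ≤ q + 1 - p := by
    have := card_le_card hsub
    rwa [Nat.card_Icc, hB] at this
  have hgapmem : ∀ y, y ∈ Icc p q \ B ↔ (p ≤ y ∧ y ≤ q) ∧ y ∉ B := fun y => by
    rw [mem_sdiff, mem_Icc]
  have hout : ∀ y, y < p ∨ q < y → y ∉ B := fun y hy hyB => by
    have := hp y hyB; have := hq y hyB; omega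
  rcases (by omega : q + 1 = p + d ∨ q = p + d ∨ q = p + (d + 1)) with h | h | h
  -- `B` is an interval: a gap of one position is left on either side, except at an end of `[0, L)`,
  -- where the extreme interval takes the place of the missing facet
  · have h0 : Icc p q \ B = ∅ := card_eq_zero.1 (by omega)
    have hin : ∀ y, y ∉ B → y < p ∨ q < y := by
      intro y hy
      by_contra hcon
      have : y ∈ Icc p q \ B := (hgapmem y).2 ⟨by omega, hy⟩
      rw [h0] at this
      exact notMem_empty _ this
    refine ⟨if 2 ≤ p then p - 2 else if p = 1 then 0 else d,
      if q + 2 < L then q + 2 else if q + 2 = L then q + 1 else p - 1, ?_, ?_, ?_, ?_⟩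
    · apply hout; split_ifs <;> omega
    · apply hout; split_ifs <;> omega
    · split_ifs <;> omega
    · intro y hy
      rw [hiff y hy]
      have := hin y hy
      split_ifs <;> omega
  -- `B` has one gap `z`: it is extended by one position on either side; at an end of `[0, L)`,
  -- filling the gap yields the extreme interval
  · obtain ⟨z, hz⟩ := card_eq_one.1 (show (Icc p q \ B).card = 1 by omega)
    have hzm := (hgapmem z).1 (by rw [hz]; exact mem_singleton_self z)
    have hzp : z ≠ p := fun h => hzm.2 (h ▸ hpB)
    have hzq : z ≠ q := fun h => hzm.2 (h ▸ hqB)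
    have hin : ∀ y, y ∉ B → y < p ∨ q < y ∨ y = z := by
      intro y hy
      by_contra hcon
      have : y ∈ Icc p q \ B := (hgapmem y).2 ⟨by omega, hy⟩
      rw [hz, mem_singleton] at this
      omega
    refine ⟨if 1 ≤ p then p - 1 else z, if q + 1 < L then q + 1 else z, ?_, ?_, ?_, ?_⟩
    · split_ifs
      · apply hout; omega
      · exact hzm.2
    · split_ifs
      · apply hout; omega
      · exact hzm.2
    · split_ifs <;> omega
    · intro y hy
      rw [hiff y hy]
      have := hin y hy
      split_ifs <;> omega
  -- `B` has two gaps and diameter `d + 1`: one of the gaps is filled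
  · obtain ⟨z₁, z₂, hne, hz⟩ := card_eq_two.1 (show (Icc p q \ B).card = 2 by omega)
    have hz1 := (hgapmem z₁).1 (by rw [hz]; simp)
    have hz2 := (hgapmem z₂).1 (by rw [hz]; simp)
    refine ⟨z₁, z₂, hz1.2, hz2.2, hne, ?_⟩
    intro y hy
    rw [hiff y hy]
    constructor
    · intro hy'
      have : y ∈ Icc p q \ B := (hgapmem y).2 ⟨by omega, hy⟩
      rw [hz] at this
      simpa using this
    · intro hy'
      rcases hy' with rfl | rfl <;> omega

/-- The sum of the positions of a facet of a tube other than the least one. A translation by one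
position raises it by `d`, whereas it changes by at most `d + 1` between neighbouring facets. -/
noncomputable def tubePotential (A : Finset ℕ) : ℤ := (∑ x ∈ A, (x : ℤ)) - (sInf (A : Set ℕ) : ℕ)

lemma tubePotential_eq {A : Finset ℕ} {p : ℕ} (hp : p ∈ A) (hmin : ∀ x ∈ A, p ≤ x) :
    tubePotential A = (∑ x ∈ A, (x : ℤ)) - p := by
  have : sInf (A : Set ℕ) = p :=
    le_antisymm (Nat.sInf_le hp) (hmin _ (Nat.sInf_mem (s := (A : Set ℕ)) ⟨p, hp⟩))
  rw [tubePotential, this]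

lemma tubePotential_sub_le {d : ℕ} {A A' : Finset ℕ} (hA : A.card = d + 1) (hA' : A'.card = d + 1)
    (hs : ∀ x ∈ A, ∀ y ∈ A, x ≤ y + (d + 1)) (hs' : ∀ x ∈ A', ∀ y ∈ A', x ≤ y + (d + 1))
    (hAA' : (A ∩ A').card = d) : tubePotential A ≤ tubePotential A' + (d + 1) := by
  have hne : A.Nonempty := card_pos.1 (by omega)
  have hne' : A'.Nonempty := card_pos.1 (by omega)
  obtain ⟨p, hpA, hp⟩ : ∃ p ∈ A, ∀ x ∈ A, p ≤ x :=
    ⟨A.min' hne, min'_mem _ _, fun x hx => min'_le _ _ hx⟩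
  obtain ⟨p', hpA', hp'⟩ : ∃ p ∈ A', ∀ x ∈ A', p ≤ x :=
    ⟨A'.min' hne', min'_mem _ _, fun x hx => min'_le _ _ hx⟩
  rw [tubePotential_eq hpA hp, tubePotential_eq hpA' hp']
  obtain ⟨y, hy⟩ := card_eq_one.1 (show (A \ A').card = 1 by
    have := card_sdiff_add_card_inter A A'; omega)
  obtain ⟨y', hy'⟩ := card_eq_one.1 (show (A' \ A).card = 1 by
    have := card_sdiff_add_card_inter A' A; rw [inter_comm] at this; omega)
  have e1 := sum_sdiff (f := fun x : ℕ => (x : ℤ)) (inter_subset_left : A ∩ A' ⊆ A)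
  have e2 := sum_sdiff (f := fun x : ℕ => (x : ℤ)) (inter_subset_right : A ∩ A' ⊆ A')
  rw [sdiff_inter_self_left, hy, sum_singleton] at e1
  rw [sdiff_inter_self_right, hy', sum_singleton] at e2
  rw [← e1, ← e2]
  have hyA : y ∈ A ∧ y ∉ A' := by rw [← mem_sdiff, hy]; simp
  have hyA' : y' ∈ A' ∧ y' ∉ A := by rw [← mem_sdiff, hy']; simp
  have a1 := hp y hyA.1
  have a2 := hp' y' hyA'.1
  have a3 := hs y hyA.1 p hpA
  have a4 := hs' y' hyA'.1 p' hpA'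
  -- if the least positions differ, then one of them is the position that is exchanged
  rcases lt_trichotomy p p' with h | h | h
  · have : p ∈ A \ A' := mem_sdiff.2 ⟨hpA, fun hm => by have := hp' p hm; omega⟩
    rw [hy, mem_singleton] at this
    omega
  · omega
  · have : p' ∈ A' \ A := mem_sdiff.2 ⟨hpA', fun hm => by have := hp p' hm; omega⟩
    rw [hy', mem_singleton] at this
    omega

end Tube

section Tube

variable {V : Type*} [DecidableEq V]

/-- A sequence `v` of `L` vertices generates a tube: consecutive windows of `d + 2` vertices have
distinct entries, and distinct `d`-subsets of such windows of positions carry distinct sets of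
vertices. -/
structure IsTube (d L : ℕ) (v : ℕ → V) : Prop where
  ne : ∀ i j, i < j → j ≤ i + (d + 1) → j < L → v i ≠ v j
  ridge : ∀ A A' : Finset ℕ, A.card = d → A'.card = d → (∀ x ∈ A, x < L) → (∀ x ∈ A', x < L) →
    (∀ x ∈ A, ∀ y ∈ A, x ≤ y + (d + 1)) → (∀ x ∈ A', ∀ y ∈ A', x ≤ y + (d + 1)) →
    A.image v = A'.image v → A = A'

variable {d L : ℕ} {v : ℕ → V}

lemma IsTube.injOn (hv : IsTube d L v) {A : Finset ℕ} (hA : TubeFacet d L A) :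
    Set.InjOn v (A : Set ℕ) := by
  intro i hi j hj hij
  rcases lt_trichotomy i j with h | h | h
  · exact absurd hij (hv.ne i j h (hA.short j hj i hi) (hA.lt j hj))
  · exact h
  · exact absurd hij.symm (hv.ne j i h (hA.short i hi j hj) (hA.lt i hi))

lemma IsTube.card_image (hv : IsTube d L v) {A B : Finset ℕ} (hA : TubeFacet d L A)
    (hB : B ⊆ A) : (B.image v).card = B.card :=
  card_image_of_injOn ((hv.injOn hA).mono (coe_subset.2 hB))

lemma IsTube.subset_of_image_subset (hv : IsTube d L v) {A A' B : Finset ℕ} (hA : TubeFacet d L A)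
    (hA' : TubeFacet d L A') (hBA : B ⊆ A) (hB : B.card = d)
    (hsub : B.image v ⊆ A'.image v) : B ⊆ A' := by
  obtain ⟨B', hB', heq⟩ := subset_image_iff.1 hsub
  have h1 : B'.card = d := by
    rw [← hv.card_image hA' (coe_subset.1 hB'), heq, hv.card_image hA hBA, hB]
  have h2 := hv.ridge B B' hB h1 (fun x hx => hA.lt x (hBA hx))
    (fun x hx => hA'.lt x (hB' hx)) (fun x hx y hy => hA.short x (hBA hx) y (hBA hy))
    (fun x hx y hy => hA'.short x (hB' hx) y (hB' hy)) heq.symm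
  rw [h2]
  exact coe_subset.1 hB'

lemma IsTube.eq_of_image_subset (hv : IsTube d L v) (hd : 1 ≤ d) {A A' : Finset ℕ}
    (hA : TubeFacet d L A) (hA' : TubeFacet d L A') (hsub : A.image v ⊆ A'.image v) : A = A' := by
  refine eq_of_subset_of_card_le (fun x hx => ?_) (by rw [hA.card, hA'.card])
  obtain ⟨y, hy, hyx⟩ := exists_mem_ne (show 1 < A.card by rw [hA.card]; omega) x
  have h1 : A.erase y ⊆ A' := hv.subset_of_image_subset hA hA' (erase_subset _ _)
    (by rw [card_erase_of_mem hy, hA.card]; rfl)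
    ((image_subset_image (erase_subset _ _)).trans hsub)
  exact h1 (mem_erase.2 ⟨hyx.symm, hx⟩)

/-- The complex generated by the facets of a tube. An `AbstractSimplicialComplex` contains all
singletons, so vertices outside the tube occur as isolated points. -/
def tubeComplex (d L : ℕ) (v : ℕ → V) : AbstractSimplicialComplex V where
  faces := {s | s.Nonempty ∧ ((∃ A, TubeFacet d L A ∧ s ⊆ A.image v) ∨ ∃ x, s = {x})}
  isRelLowerSet_faces := by
    intro s hs
    refine ⟨hs.1, fun t hts ht => ⟨ht, ?_⟩⟩
    rcases hs.2 with ⟨A, hA, hsA⟩ | ⟨x, rfl⟩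
    · exact Or.inl ⟨A, hA, hts.trans hsA⟩
    · exact Or.inr ⟨x, (Nonempty.subset_singleton_iff ht).1 hts⟩
  singleton_mem x := ⟨singleton_nonempty x, Or.inr ⟨x, rfl⟩⟩

lemma exists_tubeFacet_of_mem_faces {s : Finset V} (hs : s ∈ (tubeComplex d L v).faces)
    (hc : 2 ≤ s.card) : ∃ A, TubeFacet d L A ∧ s ⊆ A.image v := by
  rcases hs.2 with h | ⟨x, rfl⟩
  · exact h
  · simp at hc

lemma image_mem_faces {A : Finset ℕ} (hA : TubeFacet d L A) :
    A.image v ∈ (tubeComplex d L v).faces :=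
  ⟨(card_pos.1 (by rw [hA.card]; omega)).image v, Or.inl ⟨A, hA, Subset.rfl⟩⟩

lemma tubeFacet_range {d L : ℕ} (hL : d + 4 ≤ L) : TubeFacet d L (range (d + 1)) :=
  ⟨card_range _, fun x hx => by rw [mem_range] at hx; omega,
    fun x hx y _ => by rw [mem_range] at hx; omega,
    Or.inr (Or.inl fun x hx => by rw [mem_range] at hx; omega)⟩

lemma tubeFacet_last {d L : ℕ} (hL : d + 4 ≤ L) : TubeFacet d L (Ico (L - (d + 1)) L) :=
  ⟨by rw [Nat.card_Ico]; omega, fun x hx => by rw [mem_Ico] at hx; omega,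
    fun x hx y hy => by rw [mem_Ico] at hx hy; omega,
    Or.inr (Or.inr fun x hx => by rw [mem_Ico] at hx; omega)⟩

lemma IsTube.exists_eq_image (hv : IsTube d L v) (hd : 1 ≤ d) {s : Finset V}
    (hs : s ∈ (tubeComplex d L v).faces) (hc : s.card = d + 1) :
    ∃ A, TubeFacet d L A ∧ s = A.image v := by
  obtain ⟨A, hA, hsA⟩ := exists_tubeFacet_of_mem_faces hs (by omega)
  exact ⟨A, hA, eq_of_subset_of_card_le hsA
    (by rw [hv.card_image hA Subset.rfl, hA.card, hc])⟩

lemma IsTube.isPseudomanifold (hv : IsTube d L v) (hd : 2 ≤ d) (hL : d + 4 ≤ L) :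
    IsPseudomanifold (tubeComplex d L v) d := by
  refine ⟨⟨?_, _, image_mem_faces (tubeFacet_range hL), ?_⟩, ?_⟩
  · intro σ hσ
    by_contra hcon
    obtain ⟨A, hA, hsA⟩ := exists_tubeFacet_of_mem_faces hσ (by omega)
    have := card_le_card hsA
    rw [hv.card_image hA Subset.rfl, hA.card] at this
    omega
  · rw [hv.card_image (tubeFacet_range hL) Subset.rfl, card_range]
  · intro τ hτ hτc
    obtain ⟨A, hA, hτA⟩ := exists_tubeFacet_of_mem_faces hτ (by omega)
    obtain ⟨B, hB, rfl⟩ := subset_image_iff.1 hτA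
    rw [hv.card_image hA hB] at hτc
    obtain ⟨y₁, y₂, h1, h2, hne, hiff⟩ := hA.exists_two (by omega) hL hB hτc
    have hf1 := (hiff y₁ h1).2 (Or.inl rfl)
    have hf2 := (hiff y₂ h2).2 (Or.inr rfl)
    have : {σ ∈ (tubeComplex d L v).faces | σ.card = d + 1 ∧ B.image v ⊆ σ} =
        {(insert y₁ B).image v, (insert y₂ B).image v} := by
      ext σ
      simp only [Set.mem_ofPred_eq, Set.mem_insert_iff, Set.mem_singleton_iff]
      constructor
      · rintro ⟨hσ, hσc, hsub⟩
        obtain ⟨A', hA', rfl⟩ := hv.exists_eq_image (by omega) hσ hσc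
        have hBA' := hv.subset_of_image_subset hA hA' hB hτc hsub
        obtain ⟨y, hy⟩ := card_eq_one.1 (show (A' \ B).card = 1 by
          rw [card_sdiff_of_subset hBA', hA'.card, hτc]; omega)
        have hyB : y ∉ B := (mem_sdiff.1 (show y ∈ A' \ B by rw [hy]; simp)).2
        have hA'y : A' = insert y B := by
          rw [← sdiff_union_of_subset hBA', hy, insert_eq]
        rw [hA'y] at hA' ⊢
        rcases (hiff y hyB).1 hA' with rfl | rfl
        · exact Or.inl rfl
        · exact Or.inr rfl
      · rintro (rfl | rfl)
        · exact ⟨image_mem_faces hf1, by rw [hv.card_image hf1 Subset.rfl, hf1.card],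
            image_subset_image (subset_insert _ _)⟩
        · exact ⟨image_mem_faces hf2, by rw [hv.card_image hf2 Subset.rfl, hf2.card],
            image_subset_image (subset_insert _ _)⟩
    rw [this, Set.ncard_pair]
    intro heq
    have h3 := hv.eq_of_image_subset (by omega) hf1 hf2 heq.subset
    have h4 : y₁ ∈ insert y₂ B := h3 ▸ mem_insert_self _ _
    rcases mem_insert.1 h4 with h | h
    · exact hne h
    · exact h1 h

/-- The facet of a tube with a given set of positions, as a vertex of the dual graph. -/
def IsTube.facet (hv : IsTube d L v) {A : Finset ℕ} (hA : TubeFacet d L A) :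
    DFace (tubeComplex d L v) d :=
  ⟨A.image v, image_mem_faces hA, by rw [hv.card_image hA Subset.rfl, hA.card]⟩

/-- Adjacency of facets can be read off from their positions, as distinct sets of `d` positions
carry distinct sets of vertices. -/
lemma IsTube.adj_iff (hv : IsTube d L v) (hd : 1 ≤ d) {A A' : Finset ℕ}
    (hA : TubeFacet d L A) (hA' : TubeFacet d L A') :
    (dualGraph (tubeComplex d L v) d).Adj (hv.facet hA) (hv.facet hA') ↔ (A ∩ A').card = d := by
  change ((A.image v) ∩ (A'.image v)).card = d ↔ _
  constructor
  · intro h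
    obtain ⟨B, hB, hBeq⟩ := subset_image_iff.1
      (inter_subset_left : (A.image v) ∩ (A'.image v) ⊆ A.image v)
    rw [← hBeq, hv.card_image hA hB] at h
    have hBA' := hv.subset_of_image_subset hA hA' hB h (hBeq ▸ inter_subset_right)
    refine le_antisymm ?_ (h ▸ card_le_card (subset_inter hB hBA'))
    by_contra hcon
    have h1 : (A ∩ A').card = d + 1 := by
      have := card_le_card (inter_subset_left : A ∩ A' ⊆ A)
      rw [hA.card] at this
      omega
    have h2 := eq_of_subset_of_card_le (inter_subset_left : A ∩ A' ⊆ A) (by rw [h1, hA.card])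
    have h3 := eq_of_subset_of_card_le (inter_subset_right : A ∩ A' ⊆ A') (by rw [h1, hA'.card])
    have h4 : A = A' := h2.symm.trans h3
    subst h4
    rw [inter_self] at hBeq
    have h5 := hv.card_image hA hB
    rw [hBeq, hv.card_image hA Subset.rfl, hA.card, h] at h5
    omega
  · intro h
    refine card_inter_eq_of_subset (ρ := (A ∩ A').image v)
      (by rw [hv.card_image hA Subset.rfl, hA.card])
      (by rw [hv.card_image hA' Subset.rfl, hA'.card]) ?_
      (by rw [hv.card_image hA inter_subset_left, h])
      (image_subset_image inter_subset_left) (image_subset_image inter_subset_right)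
    intro heq
    have := hv.eq_of_image_subset hd hA hA' heq.subset
    rw [this, inter_self, hA'.card] at h
    omega

end Tube

/-! ### The dual graph of a tube -/

section Tube

variable {V : Type*} [DecidableEq V] {d L : ℕ} {v : ℕ → V}

/-- Any two facets inside a set of `d + 2` positions are equal or adjacent. -/
lemma IsTube.reachable_of_subset (hv : IsTube d L v) (hd : 1 ≤ d) {A A' W : Finset ℕ}
    (hA : TubeFacet d L A) (hA' : TubeFacet d L A') (hAW : A ⊆ W) (hA'W : A' ⊆ W)
    (hW : W.card ≤ d + 2) :
    (dualGraph (tubeComplex d L v) d).Reachable (hv.facet hA) (hv.facet hA') := by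
  by_cases heq : A = A'
  · subst heq; exact SimpleGraph.Reachable.refl _
  · apply SimpleGraph.Adj.reachable
    rw [hv.adj_iff hd]
    have h1 := card_union_add_card_inter A A'
    have h2 := card_le_card (union_subset hAW hA'W)
    have h3 := card_le_card (inter_subset_left : A ∩ A' ⊆ A)
    rw [hA.card, hA'.card] at h1
    rw [hA.card] at h3
    by_contra hcon
    have h4 : (A ∩ A').card = d + 1 := by omega
    have h5 := eq_of_subset_of_card_le (inter_subset_left : A ∩ A' ⊆ A) (by rw [h4, hA.card])
    have h6 := eq_of_subset_of_card_le (inter_subset_right : A ∩ A' ⊆ A') (by rw [h4, hA'.card])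
    exact heq (h5.symm.trans h6)

lemma tubeFacet_erase {i k : ℕ} (hi : i + (d + 2) ≤ L) (h1 : i < k) (h2 : k ≤ i + d) :
    TubeFacet d L ((Icc i (i + (d + 1))).erase k) := by
  refine ⟨?_, ?_, ?_, Or.inl ⟨i, ?_, ?_⟩⟩
  · rw [card_erase_of_mem (mem_Icc.2 ⟨by omega, by omega⟩), Nat.card_Icc]; omega
  · intro x hx
    have := mem_Icc.1 (mem_of_mem_erase hx); omega
  · intro x hx y hy
    have := mem_Icc.1 (mem_of_mem_erase hx)
    have := mem_Icc.1 (mem_of_mem_erase hy); omega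
  · exact mem_erase.2 ⟨by omega, mem_Icc.2 ⟨by omega, by omega⟩⟩
  · exact mem_erase.2 ⟨by omega, mem_Icc.2 ⟨by omega, by omega⟩⟩

/-- The facets `[i, i + d + 1] \ {i + 1}` are reached one after the other from the first interval,
by way of `[i, i + d + 1] \ {i + 2}`. -/
lemma IsTube.reachable_first (hv : IsTube d L v) (hd : 2 ≤ d) (hL : d + 4 ≤ L) (i : ℕ)
    (hi : i + (d + 2) ≤ L) :
    (dualGraph (tubeComplex d L v) d).Reachable (hv.facet (tubeFacet_range hL))
      (hv.facet (tubeFacet_erase hi (by omega : i < i + 1) (by omega))) := by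
  induction i with
  | zero =>
    refine hv.reachable_of_subset (by omega) _ _ (W := range (d + 2)) ?_ ?_ (by rw [card_range])
    · intro x hx; rw [mem_range] at *; omega
    · intro x hx
      have := mem_Icc.1 (mem_of_mem_erase hx); rw [mem_range]; omega
  | succ i ih =>
    have hi' : i + (d + 2) ≤ L := by omega
    refine (ih hi').trans ((hv.reachable_of_subset (by omega) (W := Icc i (i + (d + 1))) _
      (tubeFacet_erase hi' (by omega : i < i + 2) (by omega)) (erase_subset _ _)
      (erase_subset _ _) (by rw [Nat.card_Icc]; omega)).trans
      (hv.reachable_of_subset (by omega) (W := (Icc i (i + (d + 2))).erase (i + 2)) _ _ ?_ ?_ ?_))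
    · intro x hx
      rw [mem_erase, mem_Icc] at *; omega
    · intro x hx
      rw [mem_erase, mem_Icc] at *; omega
    · rw [card_erase_of_mem (mem_Icc.2 ⟨by omega, by omega⟩), Nat.card_Icc]; omega

lemma IsTube.stronglyConnected (hv : IsTube d L v) (hd : 2 ≤ d) (hL : d + 4 ≤ L) :
    StronglyConnected (tubeComplex d L v) d := by
  have key : ∀ s : DFace (tubeComplex d L v) d,
      (dualGraph (tubeComplex d L v) d).Reachable (hv.facet (tubeFacet_range hL)) s := by
    intro s
    obtain ⟨A, hA, hs⟩ := hv.exists_eq_image (by omega) s.2.1 s.2.2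
    have hs' : s = hv.facet hA := Subtype.ext hs
    rw [hs']
    rcases hA.outer with ⟨i, hi, hi'⟩ | h | h
    · have hiL := hA.lt _ hi'
      refine (hv.reachable_first hd hL i (by omega)).trans
        (hv.reachable_of_subset (by omega) (W := Icc i (i + (d + 1))) _ _ (erase_subset _ _) ?_
          (by rw [Nat.card_Icc]; omega))
      intro x hx
      have := hA.short x hx i hi
      have := hA.short _ hi' x hx
      rw [mem_Icc]; omega
    · refine hv.reachable_of_subset (by omega) (W := range (d + 1)) _ _ Subset.rfl ?_
        (by rw [card_range]; omega)
      intro x hx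
      have := h x hx
      rw [mem_range]; omega
    · refine (hv.reachable_first hd hL (L - (d + 2)) (by omega)).trans
        (hv.reachable_of_subset (by omega) (W := Icc (L - (d + 2)) (L - (d + 2) + (d + 1))) _ _
          (erase_subset _ _) ?_ (by rw [Nat.card_Icc]; omega))
      intro x hx
      have := h x hx
      have := hA.lt x hx
      rw [mem_Icc]; omega
  exact { preconnected := fun s t => (key s).symm.trans (key t)
          nonempty := ⟨hv.facet (tubeFacet_range hL)⟩ }

lemma IsTube.potential_le_of_walk (hv : IsTube d L v) (hd : 1 ≤ d)
    {s t : DFace (tubeComplex d L v) d} (p : (dualGraph (tubeComplex d L v) d).Walk s t)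
    {A A' : Finset ℕ} (hA : TubeFacet d L A) (hA' : TubeFacet d L A') (hs : s = hv.facet hA)
    (ht : t = hv.facet hA') :
    tubePotential A' ≤ tubePotential A + (d + 1) * p.length := by
  induction p generalizing A with
  | nil =>
    have h1 : A.image v = A'.image v := congrArg Subtype.val (hs.symm.trans ht)
    have := hv.eq_of_image_subset hd hA hA' h1.subset
    simp [this]
  | cons hadj q ih =>
    rename_i a b c
    obtain ⟨A'', hA'', hb⟩ := hv.exists_eq_image hd b.2.1 b.2.2
    have hb' : b = hv.facet hA'' := Subtype.ext hb
    have h1 := ih hA'' hb' ht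
    rw [hs, hb', hv.adj_iff hd, inter_comm] at hadj
    have h2 := tubePotential_sub_le hA''.card hA.card hA''.short hA.short hadj
    rw [SimpleGraph.Walk.length_cons]
    push_cast
    linarith

/-- The diameter of a tube: each step of the dual graph advances by at most `(d + 1) / d`
positions on average. -/
lemma IsTube.le_diam [Finite V] (hv : IsTube d L v) (hd : 2 ≤ d) (hL : d + 4 ≤ L) :
    d * (L - (d + 1)) ≤ (d + 1) * (dualGraph (tubeComplex d L v) d).diam := by
  have hc := hv.stronglyConnected hd hL
  have hfin : Finite (DFace (tubeComplex d L v) d) :=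
    inferInstanceAs (Finite {σ : Finset V // σ ∈ (tubeComplex d L v).faces ∧ σ.card = d + 1})
  have hne : Nonempty (DFace (tubeComplex d L v) d) := hc.nonempty
  obtain ⟨p, hp⟩ := hc.exists_walk_length_eq_dist (hv.facet (tubeFacet_range hL))
    (hv.facet (tubeFacet_last hL))
  have h1 := hv.potential_le_of_walk (by omega) p _ _ rfl rfl
  have h2 : p.length ≤ (dualGraph (tubeComplex d L v) d).diam := by
    rw [hp]
    apply SimpleGraph.dist_le_diam
    exact (SimpleGraph.connected_iff_ediam_ne_top).1 hc
  rw [tubePotential_eq (p := 0) (mem_range.2 (by omega)) (fun x _ => Nat.zero_le x),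
    tubePotential_eq (p := L - (d + 1)) (mem_Ico.2 ⟨le_rfl, by omega⟩)
      (fun x hx => (mem_Ico.1 hx).1)] at h1
  have h3 : ∑ x ∈ Ico (L - (d + 1)) L, (x : ℤ) =
      ∑ x ∈ range (d + 1), (x : ℤ) + (d + 1) * (L - (d + 1) : ℕ) := by
    rw [sum_Ico_eq_sum_range, show L - (L - (d + 1)) = d + 1 by omega]
    push_cast
    rw [sum_add_distrib, sum_const, card_range]
    simp only [nsmul_eq_mul]
    push_cast
    ring
  rw [h3] at h1
  have h4 : (d : ℤ) * ((L - (d + 1) : ℕ) : ℤ) ≤ (d + 1) * p.length := by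
    push_cast at h1 ⊢
    linarith
  have h5 : d * (L - (d + 1)) ≤ (d + 1) * p.length := by exact_mod_cast h4
  exact h5.trans (Nat.mul_le_mul_left _ h2)

end Tube

/-! ### Bernoulli subsets and the random greedy process -/

section RandomGreedy

set_option linter.unusedSectionVars false

variable {V E : Type*} [DecidableEq V]

/-- One step of the random greedy matching process: the edge `e` is accepted, and its vertices are
removed from the set `A` of uncovered vertices, if all of them are still uncovered. -/
def greedyStep (h : E → Finset V) (e : E) (A : Finset V) : Finset V :=
  if h e ⊆ A then A \ h e else A

/-- The expectation of `F A`, where `A` is the set of uncovered vertices after `i` independent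
uniformly random edges have been offered to the greedy process. -/
noncomputable def greedyExp [Fintype V] [Fintype E] (h : E → Finset V) :
    ℕ → (Finset V → ℝ) → ℝ
  | 0, F => F univ
  | i + 1, F => greedyExp h i (fun A => (∑ e, F (greedyStep h e A)) / Fintype.card E)

/-- The expectation of `F W`, where `W` is a random subset of `U` that contains each element
independently with probability `f`. -/
noncomputable def bernoulliExp (f : ℝ) (U : Finset V) (F : Finset V → ℝ) : ℝ :=
  ∑ W ∈ U.powerset, f ^ W.card * (1 - f) ^ (U.card - W.card) * F W

lemma bernoulliExp_insert (f : ℝ) {U : Finset V} {u : V} (hu : u ∉ U) (F : Finset V → ℝ) :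
    bernoulliExp f (insert u U) F =
      f * bernoulliExp f U (fun W => F (insert u W)) + (1 - f) * bernoulliExp f U F := by
  unfold bernoulliExp
  rw [Finset.sum_powerset_insert hu, mul_sum, mul_sum, add_comm]
  congr 1
  · refine sum_congr rfl fun W hW => ?_
    have hW' : W ⊆ U := mem_powerset.1 hW
    have : u ∉ W := fun h => hu (hW' h)
    rw [card_insert_of_notMem this, card_insert_of_notMem hu, Nat.add_sub_add_right]
    ring
  · refine sum_congr rfl fun W hW => ?_
    have hW' : W ⊆ U := mem_powerset.1 hW
    have := card_le_card hW'
    rw [card_insert_of_notMem hu, Nat.succ_sub this, Nat.succ_eq_add_one, pow_succ]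
    ring

@[simp] lemma bernoulliExp_empty (f : ℝ) (F : Finset V → ℝ) :
    bernoulliExp f ∅ F = F ∅ := by
  simp [bernoulliExp]

lemma bernoulliExp_congr (f : ℝ) {U : Finset V} {F G : Finset V → ℝ}
    (h : ∀ W ⊆ U, F W = G W) : bernoulliExp f U F = bernoulliExp f U G :=
  sum_congr rfl fun W hW => by rw [h W (mem_powerset.1 hW)]

lemma bernoulliExp_linear (f a b : ℝ) (U : Finset V) (F G : Finset V → ℝ) :
    bernoulliExp f U (fun W => a * F W + b * G W) =
      a * bernoulliExp f U F + b * bernoulliExp f U G := by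
  unfold bernoulliExp
  rw [mul_sum, mul_sum, ← sum_add_distrib]
  exact sum_congr rfl fun W _ => by ring

lemma abs_bernoulliExp_le {f : ℝ} (h0 : 0 ≤ f) (h1 : f ≤ 1) (U : Finset V)
    (F : Finset V → ℝ) (hF : ∀ W, |F W| ≤ 1) : |bernoulliExp f U F| ≤ 1 := by
  induction U using Finset.induction_on generalizing F with
  | empty => simpa using hF ∅
  | insert u U hu ih =>
    rw [bernoulliExp_insert f hu]
    have a1 := abs_le.1 (ih (fun W => F (insert u W)) fun W => hF _)
    have a2 := abs_le.1 (ih F hF)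
    rw [abs_le]
    constructor <;> nlinarith [a1.1, a1.2, a2.1, a2.2]

lemma bernoulliExp_union (f : ℝ) {U U' : Finset V} (hd : Disjoint U U') (F : Finset V → ℝ) :
    bernoulliExp f (U ∪ U') F =
      bernoulliExp f U (fun W => bernoulliExp f U' (fun W' => F (W ∪ W'))) := by
  induction U using Finset.induction_on generalizing F with
  | empty => simp
  | insert u U hu ih =>
    rw [disjoint_insert_left] at hd
    have : u ∉ U ∪ U' := by simp [hu, hd.1]
    rw [insert_union, bernoulliExp_insert f this, ih hd.2, ih hd.2, bernoulliExp_insert f hu]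
    simp only [insert_union]

lemma bernoulliExp_eq_full (f : ℝ) (U : Finset V) (x y : ℝ) :
    bernoulliExp f U (fun W => if W = U then x else y) = f ^ U.card * x + (1 - f ^ U.card) * y := by
  have key : ∀ U : Finset V, bernoulliExp f U (fun W => if W = U then 1 else 0) = f ^ U.card := by
    intro U
    unfold bernoulliExp
    rw [sum_eq_single U]
    · simp
    · intro W _ h; simp [h]
    · simp
  have one : bernoulliExp f U (fun _ => 1) = 1 := by
    induction U using Finset.induction_on with
    | empty => simp
    | insert u U hu ih => rw [bernoulliExp_insert f hu, ih]; ring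
  have : (fun W => if W = U then x else y) =
      fun W => (x - y) * (if W = U then 1 else 0) + y * 1 := by
    funext W; split_ifs <;> ring
  rw [this, bernoulliExp_linear f (x - y) y U (fun W => if W = U then 1 else 0) (fun _ => 1),
    key, one]
  ring

/-- Thinning a Bernoulli subset by a small probability `κ` changes expectations only slightly. -/
lemma abs_bernoulliExp_thin_sub_le {f κ : ℝ} (hf0 : 0 ≤ f) (hf1 : f ≤ 1) (hκ0 : 0 ≤ κ)
    (hκ1 : κ ≤ 1) (U : Finset V) (F : Finset V → ℝ) (hF : ∀ W, |F W| ≤ 1) :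
    |bernoulliExp (f * (1 - κ)) U F - bernoulliExp f U F| ≤ 2 * U.card * κ := by
  have g0 : 0 ≤ f * (1 - κ) := mul_nonneg hf0 (by linarith)
  have g1 : f * (1 - κ) ≤ 1 := by nlinarith
  induction U using Finset.induction_on generalizing F with
  | empty => simp
  | insert u U hu ih =>
    rw [bernoulliExp_insert _ hu, bernoulliExp_insert _ hu, card_insert_of_notMem hu]
    have i1 := abs_le.1 (ih (fun W => F (insert u W)) fun W => hF _)
    have i2 := abs_le.1 (ih F hF)
    have t1 := abs_le.1 (abs_bernoulliExp_le g0 g1 U (fun W => F (insert u W)) fun W => hF _)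
    have t2 := abs_le.1 (abs_bernoulliExp_le g0 g1 U F hF)
    set T1 := bernoulliExp (f * (1 - κ)) U (fun W => F (insert u W))
    set T2 := bernoulliExp (f * (1 - κ)) U F
    set b1 := bernoulliExp f U (fun W => F (insert u W))
    set b2 := bernoulliExp f U F
    have e : f * (1 - κ) * T1 + (1 - f * (1 - κ)) * T2 - (f * b1 + (1 - f) * b2) =
        f * (T1 - b1) + (1 - f) * (T2 - b2) - κ * f * (T1 - T2) := by ring
    rw [e]
    have hκf : 0 ≤ κ * f := mul_nonneg hκ0 hf0
    have hκf' : κ * f ≤ κ := by nlinarith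
    push_cast
    rw [abs_le]
    constructor <;> nlinarith [mul_le_mul_of_nonneg_left i1.1 hf0,
      mul_le_mul_of_nonneg_left i1.2 hf0,
      mul_le_mul_of_nonneg_left i2.1 (sub_nonneg.2 hf1),
      mul_le_mul_of_nonneg_left i2.2 (sub_nonneg.2 hf1),
      mul_le_mul_of_nonneg_left (show T1 - T2 ≤ 2 by linarith) hκf,
      mul_le_mul_of_nonneg_left (show -2 ≤ T1 - T2 by linarith) hκf]

/-- Thinning a Bernoulli subset by a small probability `κ` agrees up to second order with the
removal of at most one element. -/
lemma abs_bernoulliExp_thin_sub_first_order_le {f κ : ℝ} (hf0 : 0 ≤ f) (hf1 : f ≤ 1)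
    (hκ0 : 0 ≤ κ) (hκ1 : κ ≤ 1) (U : Finset V) (F : Finset V → ℝ) (hF : ∀ W, |F W| ≤ 1) :
    |bernoulliExp (f * (1 - κ)) U F - (bernoulliExp f U F +
      κ * ∑ u ∈ U, (bernoulliExp f U (fun W => F (W.erase u)) - bernoulliExp f U F))| ≤
      2 * (U.card : ℝ) ^ 2 * κ ^ 2 := by
  induction U using Finset.induction_on generalizing F with
  | empty => simp
  | insert u U hu ih =>
    have hF1 : ∀ W, |(fun W => F (insert u W)) W| ≤ 1 := fun W => hF _
    have i1 := ih _ hF1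
    have i2 := ih F hF
    have j1 := abs_bernoulliExp_thin_sub_le hf0 hf1 hκ0 hκ1 U _ hF1
    have j2 := abs_bernoulliExp_thin_sub_le hf0 hf1 hκ0 hκ1 U F hF
    have hsum : ∑ v ∈ insert u U, (bernoulliExp f (insert u U) (fun W => F (W.erase v)) -
          bernoulliExp f (insert u U) F) =
        f * ∑ v ∈ U, (bernoulliExp f U (fun W => F (insert u (W.erase v))) -
            bernoulliExp f U (fun W => F (insert u W))) +
          (1 - f) * ∑ v ∈ U, (bernoulliExp f U (fun W => F (W.erase v)) - bernoulliExp f U F) +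
          f * (bernoulliExp f U F - bernoulliExp f U (fun W => F (insert u W))) := by
      rw [sum_insert hu, mul_sum, mul_sum, add_comm, ← sum_add_distrib]
      congr 1
      · refine sum_congr rfl fun v hv => ?_
        have hvu : v ≠ u := fun h => hu (h ▸ hv)
        rw [bernoulliExp_insert f hu, bernoulliExp_insert f hu]
        have : bernoulliExp f U (fun W => F ((insert u W).erase v)) =
            bernoulliExp f U (fun W => F (insert u (W.erase v))) :=
          bernoulliExp_congr f fun W _ => by rw [erase_insert_of_ne hvu.symm]
        rw [this]; ring
      · rw [bernoulliExp_insert f hu, bernoulliExp_insert f hu]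
        have h1 : bernoulliExp f U (fun W => F ((insert u W).erase u)) = bernoulliExp f U F :=
          bernoulliExp_congr f fun W hW => by rw [erase_insert (fun h => hu (hW h))]
        have h2 : bernoulliExp f U (fun W => F (W.erase u)) = bernoulliExp f U F :=
          bernoulliExp_congr f fun W hW => by rw [erase_eq_of_notMem (fun h => hu (hW h))]
        rw [h1, h2]; ring
    rw [hsum, bernoulliExp_insert _ hu, bernoulliExp_insert f hu, card_insert_of_notMem hu]
    set S1 := ∑ v ∈ U, (bernoulliExp f U (fun W => F (insert u (W.erase v))) -
            bernoulliExp f U (fun W => F (insert u W)))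
    set S2 := ∑ v ∈ U, (bernoulliExp f U (fun W => F (W.erase v)) - bernoulliExp f U F)
    set T1 := bernoulliExp (f * (1 - κ)) U (fun W => F (insert u W))
    set T2 := bernoulliExp (f * (1 - κ)) U F
    set b1 := bernoulliExp f U (fun W => F (insert u W))
    set b2 := bernoulliExp f U F
    have e : f * (1 - κ) * T1 + (1 - f * (1 - κ)) * T2 -
        (f * b1 + (1 - f) * b2 + κ * (f * S1 + (1 - f) * S2 + f * (b2 - b1))) =
        f * (T1 - (b1 + κ * S1)) + (1 - f) * (T2 - (b2 + κ * S2))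
          + -(κ * f) * (T1 - b1) + κ * f * (T2 - b2) := by ring
    rw [e]
    have hκf : 0 ≤ κ * f := mul_nonneg hκ0 hf0
    have hκf' : κ * f ≤ κ := by nlinarith
    have a1 : |f * (T1 - (b1 + κ * S1))| ≤ f * (2 * (U.card : ℝ) ^ 2 * κ ^ 2) := by
      rw [abs_mul, abs_of_nonneg hf0]; exact mul_le_mul_of_nonneg_left i1 hf0
    have a2 : |(1 - f) * (T2 - (b2 + κ * S2))| ≤ (1 - f) * (2 * (U.card : ℝ) ^ 2 * κ ^ 2) := by
      rw [abs_mul, abs_of_nonneg (sub_nonneg.2 hf1)]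
      exact mul_le_mul_of_nonneg_left i2 (sub_nonneg.2 hf1)
    have hs : 0 ≤ 2 * (U.card : ℝ) * κ := by positivity
    have a3 : |-(κ * f) * (T1 - b1)| ≤ κ * (2 * U.card * κ) := by
      rw [abs_mul, abs_neg, abs_of_nonneg hκf]
      exact mul_le_mul hκf' j1 (abs_nonneg _) hκ0
    have a4 : |κ * f * (T2 - b2)| ≤ κ * (2 * U.card * κ) := by
      rw [abs_mul, abs_of_nonneg hκf]
      exact mul_le_mul hκf' j2 (abs_nonneg _) hκ0
    have := abs_add_le (f * (T1 - (b1 + κ * S1)) + (1 - f) * (T2 - (b2 + κ * S2))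
          + -(κ * f) * (T1 - b1)) (κ * f * (T2 - b2))
    have := abs_add_le (f * (T1 - (b1 + κ * S1)) + (1 - f) * (T2 - (b2 + κ * S2)))
          (-(κ * f) * (T1 - b1))
    have := abs_add_le (f * (T1 - (b1 + κ * S1))) ((1 - f) * (T2 - (b2 + κ * S2)))
    push_cast
    nlinarith [sq_nonneg κ]

end RandomGreedy

section RandomGreedy

set_option linter.unusedSectionVars false

variable {V E : Type*} [DecidableEq V] [Fintype V] [Fintype E] (h : E → Finset V)

lemma greedyExp_linear (a b : ℝ) (i : ℕ) (F G : Finset V → ℝ) :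
    greedyExp h i (fun A => a * F A + b * G A) = a * greedyExp h i F + b * greedyExp h i G := by
  induction i generalizing F G with
  | zero => rfl
  | succ i ih =>
    simp only [greedyExp]
    rw [← ih]
    congr 1
    funext A
    rw [sum_add_distrib, ← mul_sum, ← mul_sum]
    ring

lemma greedyExp_zero (i : ℕ) : greedyExp h i (fun _ => 0) = 0 := by
  have := greedyExp_linear h 0 0 i (fun _ => 0) (fun _ => 0)
  simpa using this

lemma greedyExp_sum {ι : Type*} (s : Finset ι) (i : ℕ) (F : ι → Finset V → ℝ) :
    greedyExp h i (fun A => ∑ j ∈ s, F j A) = ∑ j ∈ s, greedyExp h i (F j) := by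
  classical
  induction s using Finset.induction_on with
  | empty => simpa using greedyExp_zero h i
  | insert j s hj ih =>
    rw [sum_insert hj, ← ih]
    have := greedyExp_linear h 1 1 i (F j) (fun A => ∑ j ∈ s, F j A)
    simp only [one_mul] at this
    rw [← this]
    congr 1
    funext A
    rw [sum_insert hj]

/-- `greedyExp` averages over the last edge first; by linearity the average may be taken outside. -/
lemma greedyExp_succ (i : ℕ) (F : Finset V → ℝ) :
    greedyExp h (i + 1) F =
      (∑ e, greedyExp h i (fun A => F (greedyStep h e A))) / Fintype.card E := by
  rw [← greedyExp_sum]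
  have := greedyExp_linear h ((Fintype.card E : ℝ)⁻¹) 0 i
    (fun A => ∑ e, F (greedyStep h e A)) (fun _ => 0)
  simp only [zero_mul, add_zero] at this
  simp only [greedyExp, div_eq_inv_mul]
  exact this

/-- Some outcome of the greedy process is at most the expectation. The predicate `P` records
properties shared by all outcomes. -/
lemma exists_le_greedyExp [Nonempty E] (P : Finset V → Prop) (h0 : P univ)
    (hstep : ∀ e A, P A → P (greedyStep h e A)) (i : ℕ) (F : Finset V → ℝ) :
    ∃ A, P A ∧ F A ≤ greedyExp h i F := by
  induction i generalizing F with
  | zero => exact ⟨univ, h0, le_rfl⟩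
  | succ i ih =>
    obtain ⟨A, hA, hle⟩ := ih (fun A => (∑ e, F (greedyStep h e A)) / Fintype.card E)
    have hc : (0 : ℝ) < Fintype.card E := by exact_mod_cast Fintype.card_pos
    obtain ⟨e, -, he⟩ : ∃ e ∈ (univ : Finset E), F (greedyStep h e A) ≤
        (∑ e, F (greedyStep h e A)) / Fintype.card E := by
      apply exists_le_of_sum_le univ_nonempty
      rw [sum_const, nsmul_eq_mul, card_univ, mul_div_cancel₀ _ hc.ne']
    exact ⟨_, hstep e A hA, he.trans hle⟩

lemma abs_greedyExp_le [Nonempty E] (i : ℕ) (F : Finset V → ℝ) (hF : ∀ W, |F W| ≤ 1) :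
    |greedyExp h i F| ≤ 1 := by
  obtain ⟨A, -, hA⟩ := exists_le_greedyExp h (fun _ => True) trivial (fun _ _ _ => trivial) i F
  obtain ⟨B, -, hB⟩ := exists_le_greedyExp h (fun _ => True) trivial (fun _ _ _ => trivial) i
    (fun A => -1 * F A + 0 * F A)
  rw [greedyExp_linear] at hB
  have h1 := abs_le.1 (hF A)
  have h2 := abs_le.1 (hF B)
  rw [abs_le]
  constructor <;> linarith

/-- The density of the uncovered vertices predicted by the heuristic that they form a Bernoulli
random set. -/
noncomputable def greedyDensity (η : ℝ) (k : ℕ) : ℕ → ℝ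
  | 0 => 1
  | i + 1 => greedyDensity η k i * (1 - η * greedyDensity η k i ^ (k - 1))

lemma greedyDensity_mem {η : ℝ} (h0 : 0 ≤ η) (h1 : η ≤ 1) (k i : ℕ) :
    0 ≤ greedyDensity η k i ∧ greedyDensity η k i ≤ 1 := by
  induction i with
  | zero => simp [greedyDensity]
  | succ i ih =>
    have hp := pow_le_one₀ (n := k - 1) ih.1 ih.2
    have hp0 := pow_nonneg ih.1 (k - 1)
    have : η * greedyDensity η k i ^ (k - 1) ≤ 1 := by nlinarith
    have h' : 0 ≤ η * greedyDensity η k i ^ (k - 1) := by positivity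
    simp only [greedyDensity]
    constructor
    · exact mul_nonneg ih.1 (by linarith)
    · nlinarith [ih.1, ih.2]

/-- For an edge meeting `U` in one vertex `u`, a step of the greedy process erases `u` from a
Bernoulli set with probability `f ^ (k - 1)`. -/
lemma bernoulliExp_greedyStep {k : ℕ} (hk : ∀ e, (h e).card = k) (f : ℝ) {U : Finset V}
    {F : Finset V → ℝ} (hU : ∀ A, F A = F (A ∩ U)) {e : E} {u : V} (he : U ∩ h e = {u}) :
    bernoulliExp f (U ∪ h e) (fun A => F (greedyStep h e A)) =
      bernoulliExp f U F +
        f ^ (k - 1) * (bernoulliExp f U (fun W => F (W.erase u)) - bernoulliExp f U F) := by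
  have hu : u ∈ U ∩ h e := by rw [he]; exact mem_singleton_self u
  rw [mem_inter] at hu
  have hmem : ∀ x, x ∈ U → x ∈ h e → x = u := fun x h1 h2 => by
    have : x ∈ U ∩ h e := mem_inter.2 ⟨h1, h2⟩
    rw [he] at this
    exact mem_singleton.1 this
  have hunion : U ∪ h e = U ∪ (h e).erase u := by
    ext x
    simp only [mem_union, mem_erase]
    constructor
    · rintro (hx | hx)
      · exact Or.inl hx
      · by_cases hxu : x = u
        · exact Or.inl (hxu ▸ hu.1)
        · exact Or.inr ⟨hxu, hx⟩
    · rintro (hx | hx)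
      · exact Or.inl hx
      · exact Or.inr hx.2
  have hdisj : Disjoint U ((h e).erase u) := by
    rw [disjoint_left]
    intro x h1 h2
    exact (mem_erase.1 h2).1 (hmem x h1 (mem_erase.1 h2).2)
  rw [hunion, bernoulliExp_union f hdisj]
  have hval : ∀ W ⊆ U, bernoulliExp f ((h e).erase u)
      (fun W' => F (greedyStep h e (W ∪ W'))) =
      f ^ (k - 1) * F (W.erase u) + (1 - f ^ (k - 1)) * F W := by
    intro W hW
    have hc : ((h e).erase u).card = k - 1 := by rw [card_erase_of_mem hu.2, hk]
    rw [← hc, ← bernoulliExp_eq_full f ((h e).erase u)]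
    refine bernoulliExp_congr f fun W' hW' => ?_
    by_cases hfull : W' = (h e).erase u
    · rw [if_pos hfull, greedyStep]
      split_ifs with hsub
      · rw [hU]
        congr 1
        ext x
        simp only [mem_inter, mem_sdiff, mem_union, mem_erase, hfull]
        constructor
        · rintro ⟨⟨h1 | h1, h2⟩, h3⟩
          · exact ⟨fun hx => h2 (hx ▸ hu.2), h1⟩
          · exact absurd h1.2 h2
        · rintro ⟨h1, h2⟩
          exact ⟨⟨Or.inl h2, fun hx => h1 (hmem x (hW h2) hx)⟩, hW h2⟩
      · have huW : u ∉ W := by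
          intro huW
          apply hsub
          intro x hx
          by_cases hxu : x = u
          · exact mem_union_left _ (hxu ▸ huW)
          · exact mem_union_right _ (hfull ▸ mem_erase.2 ⟨hxu, hx⟩)
        rw [hU, erase_eq_of_notMem huW]
        congr 1
        ext x
        simp only [mem_inter, mem_union]
        constructor
        · rintro ⟨h1 | h1, h2⟩
          · exact h1
          · exact absurd (hW' h1) (disjoint_left.1 hdisj h2)
        · exact fun hx => ⟨Or.inl hx, hW hx⟩
    · rw [if_neg hfull, greedyStep, if_neg, hU]
      · congr 1
        ext x
        simp only [mem_inter, mem_union]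
        constructor
        · rintro ⟨h1 | h1, h2⟩
          · exact h1
          · exact absurd (hW' h1) (disjoint_left.1 hdisj h2)
        · exact fun hx => ⟨Or.inl hx, hW hx⟩
      · intro hsub
        apply hfull
        refine Subset.antisymm hW' fun x hx => ?_
        rcases mem_union.1 (hsub (mem_of_mem_erase hx)) with h1 | h1
        · exact absurd hx (disjoint_left.1 hdisj (hW h1))
        · exact h1
  rw [bernoulliExp_congr f hval, bernoulliExp_linear]
  ring

/-- The error bound between the greedy process and the Bernoulli heuristic, after division by the
square of the number of vertices observed: in every step the error is multiplied by `1 + r` and a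
new error `c` is added. -/
noncomputable def greedyError (r c : ℝ) : ℕ → ℝ
  | 0 => 0
  | i + 1 => greedyError r c i * (1 + r) + c

lemma greedyError_nonneg {r c : ℝ} (hr : 0 ≤ r) (hc : 0 ≤ c) (i : ℕ) : 0 ≤ greedyError r c i := by
  induction i with
  | zero => simp [greedyError]
  | succ i ih => simp only [greedyError]; positivity

lemma sum_card_inter_eq {D : ℕ} [DecidableEq E] (hD : ∀ v, (univ.filter fun e => v ∈ h e).card = D)
    (U : Finset V) : ∑ e, ((U ∩ h e).card : ℝ) = U.card * D := by
  have : ∀ e, ((U ∩ h e).card : ℝ) = ∑ u ∈ U, if u ∈ h e then (1 : ℝ) else 0 := by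
    intro e
    rw [← filter_mem_eq_inter, card_filter]
    push_cast
    rfl
  simp_rw [this]
  rw [sum_comm]
  have : ∀ u ∈ U, (∑ e, if u ∈ h e then (1 : ℝ) else 0) = D := by
    intro u _
    rw [← hD u, card_filter]
    push_cast
    rfl
  rw [sum_congr rfl this, sum_const, nsmul_eq_mul]

/-- By the codegree condition few edges meet `U` in more than one vertex. -/
lemma sum_card_inter_mul_le {Δ : ℕ} [DecidableEq E]
    (hΔ : ∀ v w, v ≠ w → (univ.filter fun e => v ∈ h e ∧ w ∈ h e).card ≤ Δ)
    (U : Finset V) :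
    ∑ e, ((U ∩ h e).card : ℝ) * ((U ∩ h e).card - 1) ≤ (U.card : ℝ) ^ 2 * Δ := by
  have : ∀ e, ((U ∩ h e).card : ℝ) * ((U ∩ h e).card - 1) =
      ∑ p ∈ U.offDiag, if p.1 ∈ h e ∧ p.2 ∈ h e then (1 : ℝ) else 0 := by
    intro e
    have h1 : (U.offDiag.filter fun p => p.1 ∈ h e ∧ p.2 ∈ h e) = (U ∩ h e).offDiag := by
      ext ⟨x, y⟩
      simp only [mem_filter, mem_offDiag, mem_inter]
      tauto
    have h2 : (∑ p ∈ U.offDiag, if p.1 ∈ h e ∧ p.2 ∈ h e then (1 : ℝ) else 0) =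
        ((U ∩ h e).offDiag.card : ℝ) := by
      rw [← h1, card_filter]; push_cast; rfl
    rw [h2, offDiag_card, Nat.cast_sub (Nat.le_mul_self _)]
    push_cast
    ring
  simp_rw [this]
  rw [sum_comm]
  have : ∀ p ∈ U.offDiag, (∑ e, if p.1 ∈ h e ∧ p.2 ∈ h e then (1 : ℝ) else 0) ≤ Δ := by
    intro p hp
    have := hΔ p.1 p.2 (mem_offDiag.1 hp).2.2
    rw [card_filter] at this
    exact_mod_cast this
  refine (sum_le_sum this).trans ?_
  rw [sum_const, nsmul_eq_mul]
  refine mul_le_mul_of_nonneg_right ?_ (Nat.cast_nonneg _)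
  rw [offDiag_card, pow_two]
  exact_mod_cast Nat.sub_le _ _

/-- The joint law of the uncovered vertices in a set `U` is close in total variation to a product
of Bernoulli laws, with an error quadratic in the size of `U`. In the induction the last edge `e` is
fixed. If it misses `U`, nothing changes. If it meets `U` in one vertex, the induction hypothesis is
applied to `U ∪ h e`, and the result is averaged to a thinning of the Bernoulli set. More than one
common vertex is rare. -/
lemma abs_greedyExp_sub_bernoulliExp_le [Nonempty E] {k D Δ : ℕ} (hk1 : 1 ≤ k)
    (hk : ∀ e, (h e).card = k) (hD : ∀ v, (univ.filter fun e => v ∈ h e).card = D)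
    (hΔ : ∀ v w, v ≠ w → (univ.filter fun e => v ∈ h e ∧ w ∈ h e).card ≤ Δ) {η : ℝ}
    (hη : η = D / Fintype.card E) (hη1 : η ≤ 1) (i : ℕ) (U : Finset V) (F : Finset V → ℝ)
    (hF : ∀ W, |F W| ≤ 1) (hU : ∀ A, F A = F (A ∩ U)) :
    |greedyExp h i F - bernoulliExp (greedyDensity η k i) U F| ≤
      greedyError (η * k ^ 2) ((1 + k) * Δ / Fintype.card E + 2 * η ^ 2) i
        * (U.card : ℝ) ^ 2 := by
  classical
  have hc : (0 : ℝ) < Fintype.card E := by exact_mod_cast Fintype.card_pos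
  have hη0 : 0 ≤ η := by rw [hη]; positivity
  induction i generalizing U F with
  | zero =>
    have hone : bernoulliExp 1 U F = F U := by
      unfold bernoulliExp
      rw [sum_eq_single U]
      · simp
      · intro W hW hne
        have : W.card < U.card := card_lt_card (lt_of_le_of_ne (mem_powerset.1 hW) hne)
        have : U.card - W.card ≠ 0 := by omega
        simp [this]
      · simp
    simp only [greedyExp, greedyDensity, greedyError]
    rw [hone, hU univ, univ_inter]
    simp
  | succ i ih =>
    obtain ⟨hf0, hf1⟩ := greedyDensity_mem hη0 hη1 k i
    have ha := greedyError_nonneg (r := η * k ^ 2)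
      (c := (1 + k) * Δ / Fintype.card E + 2 * η ^ 2) (by positivity) (by positivity) i
    simp only [greedyDensity, greedyError]
    rw [greedyExp_succ]
    set f := greedyDensity η k i with hf
    set a := greedyError (η * k ^ 2) ((1 + k) * Δ / Fintype.card E + 2 * η ^ 2) i with haa
    obtain ⟨s, hs⟩ : ∃ s : ℝ, s = (U.card : ℝ) := ⟨_, rfl⟩
    rw [← hs]
    have hs0 : 0 ≤ s := hs ▸ Nat.cast_nonneg _
    have hss : s ≤ s ^ 2 := by
      rcases Nat.eq_zero_or_pos U.card with h0 | h0
      · simp [hs, h0]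
      · have : (1 : ℝ) ≤ s := by rw [hs]; exact_mod_cast h0
        nlinarith
    set b := bernoulliExp f U F with hb
    set bu : V → ℝ := fun u => bernoulliExp f U (fun W => F (W.erase u)) with hbu
    have hfk0 : 0 ≤ f ^ (k - 1) := pow_nonneg hf0 _
    have hfk1 : f ^ (k - 1) ≤ 1 := pow_le_one₀ hf0 hf1
    have hb1 : |b| ≤ 1 := abs_bernoulliExp_le hf0 hf1 U F hF
    have hbu1 : ∀ u, |bu u| ≤ 1 := fun u => abs_bernoulliExp_le hf0 hf1 U _ fun W => hF _
    -- the idealized and the true expectation, given that the last edge is `e`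
    set I : E → ℝ := fun e => b + ∑ u ∈ U ∩ h e, f ^ (k - 1) * (bu u - b) with hI
    set X : E → ℝ := fun e => greedyExp h i (fun A => F (greedyStep h e A)) with hX
    have hX1 : ∀ e, |X e| ≤ 1 := fun e => abs_greedyExp_le h i _ fun W => hF _
    have hedge : ∀ e, |X e - I e| ≤ a * s ^ 2 + (U ∩ h e).card * (a * s * k ^ 2) +
        (U ∩ h e).card * ((U ∩ h e).card - 1) * (1 + k) := by
      intro e
      have hk' : (1 : ℝ) ≤ k := by exact_mod_cast hk1
      rcases Nat.lt_or_ge 1 (U ∩ h e).card with hj | hj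
      -- more than one common vertex: the trivial bound suffices
      · have hj' : (2 : ℝ) ≤ (U ∩ h e).card := by exact_mod_cast hj
        have hjk : ((U ∩ h e).card : ℝ) ≤ k := by
          rw [← hk e]; exact_mod_cast card_le_card inter_subset_right
        have hIb : |I e - b| ≤ 2 * k := by
          rw [hI]
          simp only [add_sub_cancel_left]
          refine (abs_sum_le_sum_abs _ _).trans ?_
          have : ∀ u ∈ U ∩ h e, |f ^ (k - 1) * (bu u - b)| ≤ 2 := by
            intro u _
            rw [abs_mul, abs_of_nonneg hfk0]
            have h1 := abs_le.1 (hbu1 u)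
            have h2 := abs_le.1 hb1
            have h3 : |bu u - b| ≤ 2 := by rw [abs_le]; constructor <;> linarith
            nlinarith [abs_nonneg (bu u - b)]
          refine (sum_le_sum this).trans ?_
          rw [sum_const, nsmul_eq_mul]
          linarith
        have h1 := abs_le.1 hIb
        have h2 := abs_le.1 hb1
        have h3 := abs_le.1 (hX1 e)
        have h4 : |X e - I e| ≤ 2 + 2 * k := by rw [abs_le]; constructor <;> linarith
        have h5 : 2 * (1 + (k : ℝ)) ≤
            (U ∩ h e).card * ((U ∩ h e).card - 1) * (1 + (k : ℝ)) := by
          apply mul_le_mul_of_nonneg_right _ (by linarith)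
          nlinarith
        have h6 : 0 ≤ a * s ^ 2 := by positivity
        have h7 : 0 ≤ (U ∩ h e).card * (a * s * (k : ℝ) ^ 2) :=
          mul_nonneg (Nat.cast_nonneg _) (by positivity)
        linarith
      · rcases Nat.lt_or_ge (U ∩ h e).card 1 with h0 | h0
        -- no common vertex: the step does not affect `U`
        · have h0' : U ∩ h e = ∅ := card_eq_zero.1 (by omega)
          have hFe : (fun A => F (greedyStep h e A)) = F := by
            funext A
            rw [hU (greedyStep h e A), hU A]
            congr 1
            unfold greedyStep
            split_ifs
            · ext x
              simp only [mem_inter, mem_sdiff]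
              constructor
              · rintro ⟨⟨h1, -⟩, h2⟩; exact ⟨h1, h2⟩
              · rintro ⟨h1, h2⟩
                refine ⟨⟨h1, fun h3 => ?_⟩, h2⟩
                have : x ∈ U ∩ h e := mem_inter.2 ⟨h2, h3⟩
                rw [h0'] at this
                exact notMem_empty x this
            · rfl
          rw [hX, hI]
          simp only [hFe, h0', sum_empty, add_zero, card_empty, Nat.cast_zero, zero_mul]
          rw [hs]
          exact ih U F hF hU
        -- one common vertex: the outcome of the step depends on `U ∪ h e`
        · have h1 : (U ∩ h e).card = 1 := by omega
          obtain ⟨u, hu⟩ := card_eq_one.1 h1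
          have hIe : I e = bernoulliExp f (U ∪ h e) (fun A => F (greedyStep h e A)) := by
            rw [bernoulliExp_greedyStep h hk f hU hu, hI]
            simp only [hu, sum_singleton]
            rfl
          have hcard : ((U ∪ h e).card : ℝ) = s + k - 1 := by
            have := card_union_add_card_inter U (h e)
            rw [h1, hk] at this
            have h2 : ((U ∪ h e).card : ℝ) + 1 = U.card + k := by exact_mod_cast this
            linarith
          have hdep : ∀ A, F (greedyStep h e A) = F (greedyStep h e (A ∩ (U ∪ h e))) := by
            intro A
            rw [hU (greedyStep h e A), hU (greedyStep h e (A ∩ (U ∪ h e)))]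
            congr 1
            unfold greedyStep
            have : h e ⊆ A ∩ (U ∪ h e) ↔ h e ⊆ A :=
              ⟨fun hh => hh.trans inter_subset_left,
                fun hh => subset_inter hh subset_union_right⟩
            simp only [this]
            split_ifs
            · ext x; simp only [mem_inter, mem_sdiff, mem_union]; tauto
            · ext x; simp only [mem_inter, mem_union]; tauto
          have := ih (U ∪ h e) (fun A => F (greedyStep h e A)) (fun W => hF _) hdep
          rw [← hIe, hcard] at this
          refine this.trans ?_
          rw [h1]
          have hs1 : (1 : ℝ) ≤ s := by
            have : 1 ≤ U.card := by rw [← h1]; exact card_le_card inter_subset_left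
            rw [hs]; exact_mod_cast this
          have h2 : (s + k - 1) ^ 2 ≤ s ^ 2 + s * (k : ℝ) ^ 2 := by
            nlinarith [mul_nonneg (sub_nonneg.2 hs1) (sq_nonneg ((k : ℝ) - 1))]
          push_cast
          nlinarith [mul_le_mul_of_nonneg_left h2 ha]
    -- the average of the idealized expectations is the first order expansion of the thinning with
    -- probability `η * f ^ (k - 1)`, which turns the density `f` into the next density
    have hIsum : (∑ e, I e) / Fintype.card E = b + η * f ^ (k - 1) * ∑ u ∈ U, (bu u - b) := by
      have h1 : ∀ e, I e = b + ∑ u ∈ U, if u ∈ h e then f ^ (k - 1) * (bu u - b) else 0 := by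
        intro e
        rw [hI]
        simp only
        rw [← filter_mem_eq_inter, sum_filter]
      simp_rw [h1]
      rw [sum_add_distrib, sum_comm]
      have h2 : ∀ u ∈ U, (∑ e, if u ∈ h e then f ^ (k - 1) * (bu u - b) else 0) =
          D * (f ^ (k - 1) * (bu u - b)) := by
        intro u _
        rw [← sum_filter, sum_const, hD, nsmul_eq_mul]
      rw [sum_congr rfl h2, ← mul_sum, ← mul_sum, sum_const, card_univ, nsmul_eq_mul, hη]
      field_simp
    have hκ0 : 0 ≤ η * f ^ (k - 1) := by positivity
    have hκ1 : η * f ^ (k - 1) ≤ 1 := by nlinarith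
    have hκη : η * f ^ (k - 1) ≤ η := by nlinarith
    have hthin := abs_bernoulliExp_thin_sub_first_order_le hf0 hf1 hκ0 hκ1 U F hF
    rw [← hs] at hthin
    have hsumabs : |(∑ e, X e) / Fintype.card E - (∑ e, I e) / Fintype.card E| ≤
        (∑ e, (a * s ^ 2 + (U ∩ h e).card * (a * s * k ^ 2) +
        (U ∩ h e).card * ((U ∩ h e).card - 1) * (1 + k))) / Fintype.card E := by
      rw [← sub_div, ← sum_sub_distrib, abs_div, abs_of_pos hc]
      exact div_le_div_of_nonneg_right ((abs_sum_le_sum_abs _ _).trans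
        (sum_le_sum fun e _ => hedge e)) hc.le
    rw [hIsum, sum_add_distrib, sum_add_distrib, sum_const, card_univ, nsmul_eq_mul, ← sum_mul,
      ← sum_mul, sum_card_inter_eq h hD, ← hs] at hsumabs
    have hpairs := sum_card_inter_mul_le h hΔ U
    rw [← hs] at hpairs
    have hE2 : (Fintype.card E * (a * s ^ 2) + s * D * (a * s * k ^ 2) +
        (∑ e, ((U ∩ h e).card : ℝ) * ((U ∩ h e).card - 1)) * (1 + k)) / Fintype.card E ≤
        a * s ^ 2 + s ^ 2 * η * a * k ^ 2 + s ^ 2 * ((1 + k) * Δ / Fintype.card E) := by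
      rw [div_le_iff₀ hc]
      have : (a * s ^ 2 + s ^ 2 * η * a * k ^ 2 + s ^ 2 * ((1 + k) * Δ / Fintype.card E))
          * Fintype.card E =
          Fintype.card E * (a * s ^ 2) + s * D * (a * s * k ^ 2) + s ^ 2 * Δ * (1 + k) := by
        rw [hη]; field_simp
      rw [this]
      have := mul_le_mul_of_nonneg_right hpairs (show (0 : ℝ) ≤ 1 + k by positivity)
      linarith
    have hκ2 : (η * f ^ (k - 1)) ^ 2 ≤ η ^ 2 := pow_le_pow_left₀ hκ0 hκη 2
    have t1 := abs_le.1 (hsumabs.trans hE2)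
    have t2 := abs_le.1 hthin
    have t3 : 2 * s ^ 2 * (η * f ^ (k - 1)) ^ 2 ≤ 2 * s ^ 2 * η ^ 2 :=
      mul_le_mul_of_nonneg_left hκ2 (by positivity)
    rw [abs_le]
    constructor <;> linarith [t1.1, t1.2, t2.1, t2.2]

end RandomGreedy

/-! ### Almost perfect matchings -/

section RandomGreedy

set_option linter.unusedSectionVars false

variable {V E : Type*} [DecidableEq V] [Fintype V] [Fintype E] (h : E → Finset V)

lemma greedyExp_card_le [Nonempty E] {k D Δ : ℕ} (hk1 : 1 ≤ k)
    (hk : ∀ e, (h e).card = k) (hD : ∀ v, (univ.filter fun e => v ∈ h e).card = D)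
    (hΔ : ∀ v w, v ≠ w → (univ.filter fun e => v ∈ h e ∧ w ∈ h e).card ≤ Δ) {η : ℝ}
    (hη : η = D / Fintype.card E) (hη1 : η ≤ 1) (i : ℕ) :
    greedyExp h i (fun A => (A.card : ℝ)) ≤ Fintype.card V * (greedyDensity η k i +
      greedyError (η * k ^ 2) ((1 + k) * Δ / Fintype.card E + 2 * η ^ 2) i) := by
  have h1 : (fun A : Finset V => (A.card : ℝ)) = fun A => ∑ v, if v ∈ A then (1 : ℝ) else 0 := by
    funext A
    simp
  rw [h1, greedyExp_sum]
  have h2 : ∀ v ∈ (univ : Finset V), greedyExp h i (fun A => if v ∈ A then (1 : ℝ) else 0) ≤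
      greedyDensity η k i +
      greedyError (η * k ^ 2) ((1 + k) * Δ / Fintype.card E + 2 * η ^ 2) i := by
    intro v _
    have := abs_greedyExp_sub_bernoulliExp_le h hk1 hk hD hΔ hη hη1 i {v}
      (fun A => if v ∈ A then (1 : ℝ) else 0) (fun W => by split_ifs <;> simp)
      (fun A => by simp)
    have hb : bernoulliExp (greedyDensity η k i) {v} (fun A => if v ∈ A then (1 : ℝ) else 0) =
        greedyDensity η k i := by
      have := bernoulliExp_insert (greedyDensity η k i) (notMem_empty v)
        (fun A => if v ∈ A then (1 : ℝ) else 0)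
      simpa using this
    rw [hb, card_singleton] at this
    have := (abs_le.1 this).2
    simp only [Nat.cast_one, one_pow, mul_one] at this
    linarith
  refine (sum_le_sum h2).trans ?_
  rw [sum_const, card_univ, nsmul_eq_mul]

/-- A realization of the greedy process that leaves at most the expected number of vertices
uncovered yields the matching of the accepted edges. -/
lemma exists_matching_card_le [Nonempty E] {k D Δ : ℕ} (hk1 : 1 ≤ k)
    (hk : ∀ e, (h e).card = k) (hD : ∀ v, (univ.filter fun e => v ∈ h e).card = D)
    (hΔ : ∀ v w, v ≠ w → (univ.filter fun e => v ∈ h e ∧ w ∈ h e).card ≤ Δ) {η : ℝ}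
    (hη : η = D / Fintype.card E) (hη1 : η ≤ 1) (i : ℕ) :
    ∃ M : Finset E, (∀ e ∈ M, ∀ e' ∈ M, e ≠ e' → Disjoint (h e) (h e')) ∧
      (Fintype.card V : ℝ) * (1 - (greedyDensity η k i +
      greedyError (η * k ^ 2) ((1 + k) * Δ / Fintype.card E + 2 * η ^ 2) i)) ≤ k * M.card := by
  classical
  obtain ⟨A, ⟨M, hM, hAM⟩, hA⟩ := exists_le_greedyExp h
    (fun A => ∃ M : Finset E, (∀ e ∈ M, ∀ e' ∈ M, e ≠ e' → Disjoint (h e) (h e')) ∧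
      A = univ \ M.biUnion h) ⟨∅, by simp, by simp⟩
    (by
      rintro e A ⟨M, hM, rfl⟩
      unfold greedyStep
      split_ifs with hsub
      · refine ⟨insert e M, ?_, ?_⟩
        · have key : ∀ e' ∈ M, Disjoint (h e) (h e') := by
            intro e' he'
            rw [disjoint_left]
            intro x hx hx'
            have := hsub hx
            rw [mem_sdiff, mem_biUnion] at this
            exact this.2 ⟨e', he', hx'⟩
          intro e1 h1 e2 h2 hne
          rcases mem_insert.1 h1 with h1 | h1 <;> rcases mem_insert.1 h2 with h2 | h2
          · exact absurd (h1.trans h2.symm) hne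
          · exact h1 ▸ key _ h2
          · exact h2 ▸ (key _ h1).symm
          · exact hM _ h1 _ h2 hne
        · ext x
          simp only [mem_sdiff, mem_biUnion, mem_insert, mem_univ, true_and]
          constructor
          · rintro ⟨h1, h2⟩ ⟨e', rfl | h3, h4⟩
            · exact h2 h4
            · exact h1 ⟨e', h3, h4⟩
          · intro h1
            exact ⟨fun ⟨e', h2, h3⟩ => h1 ⟨e', Or.inr h2, h3⟩, fun h2 => h1 ⟨e, Or.inl rfl, h2⟩⟩
      · exact ⟨M, hM, rfl⟩)
    i (fun A => (A.card : ℝ))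
  refine ⟨M, hM, ?_⟩
  have h1 := hA.trans (greedyExp_card_le h hk1 hk hD hΔ hη hη1 i)
  have h2 : (M.biUnion h).card = M.card * k := by
    rw [card_biUnion fun e he e' he' hne => hM e he e' he' hne, sum_congr rfl fun e _ => hk e,
      sum_const, smul_eq_mul]
  have h3 : A.card + M.card * k = Fintype.card V := by
    rw [hAM, ← h2, card_sdiff_add_card_eq_card (subset_univ _), card_univ]
  have h4 : (A.card : ℝ) + M.card * k = Fintype.card V := by exact_mod_cast h3
  linarith

/-- The density decreases like the solution of `f' = -η * f ^ k`, for which `f ^ (1 - k)` grows at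
the constant rate `(k - 1) * η`. -/
lemma greedyDensity_pow_le {η : ℝ} (h0 : 0 ≤ η) (h1 : η ≤ 1) (k : ℕ) (i : ℕ) :
    greedyDensity η k i ^ (k - 1) * (1 + (k - 1 : ℕ) * (η * i)) ≤ 1 := by
  induction i with
  | zero => simp [greedyDensity]
  | succ i ih =>
    obtain ⟨hf0, hf1⟩ := greedyDensity_mem h0 h1 k i
    simp only [greedyDensity]
    set g := greedyDensity η k i ^ (k - 1) with hg
    have hg0 : 0 ≤ g := pow_nonneg hf0 _
    have hg1 : g ≤ 1 := pow_le_one₀ hf0 hf1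
    have hx0 : 0 ≤ η * g := by positivity
    have hx1 : η * g ≤ 1 := by nlinarith
    have hb := one_add_mul_le_pow (show (-2 : ℝ) ≤ η * g by linarith) (k - 1)
    have hbern : (1 - η * g) ^ (k - 1) * (1 + (k - 1 : ℕ) * (η * g)) ≤ 1 := by
      calc (1 - η * g) ^ (k - 1) * (1 + (k - 1 : ℕ) * (η * g))
          ≤ (1 - η * g) ^ (k - 1) * (1 + η * g) ^ (k - 1) :=
            mul_le_mul_of_nonneg_left hb (pow_nonneg (by linarith) _)
        _ = (1 - (η * g) ^ 2) ^ (k - 1) := by rw [← mul_pow]; ring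
        _ ≤ 1 := pow_le_one₀ (by nlinarith) (by nlinarith)
    rw [mul_pow, ← hg]
    set p := (1 - η * g) ^ (k - 1)
    have hp0 : 0 ≤ p := pow_nonneg (by linarith) _
    push_cast
    calc g * p * (1 + ((k - 1 : ℕ) : ℝ) * (η * (i + 1)))
        = p * (g * (1 + ((k - 1 : ℕ) : ℝ) * (η * i)) + ((k - 1 : ℕ) : ℝ) * (η * g)) := by ring
      _ ≤ p * (1 + ((k - 1 : ℕ) : ℝ) * (η * g)) := by gcongr
      _ ≤ 1 := hbern

lemma greedyError_le {r c : ℝ} (hr : 0 ≤ r) (hc : 0 ≤ c) (i : ℕ) :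
    greedyError r c i ≤ c * i * Real.exp (r * i) := by
  have h1 : ∀ i : ℕ, greedyError r c i ≤ c * i * (1 + r) ^ i := by
    intro i
    induction i with
    | zero => simp [greedyError]
    | succ i ih =>
      simp only [greedyError]
      have : 1 ≤ (1 + r) ^ (i + 1) := one_le_pow₀ (by linarith)
      calc _ ≤ c * i * (1 + r) ^ i * (1 + r) + c * (1 + r) ^ (i + 1) := by
            gcongr
            nlinarith
        _ = _ := by push_cast; ring
  refine (h1 i).trans ?_
  have : (1 + r) ^ i ≤ Real.exp (r * i) := by
    rw [mul_comm, Real.exp_nat_mul]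
    exact pow_le_pow_left₀ (by linarith) (by linarith [Real.add_one_le_exp r]) i
  gcongr

/-- The value of the error for `N` vertices, at the time when its growth factor has reached the
square root of the ratio `X` of the degree to the codegrees. -/
lemma greedyError_scale_le {k N X : ℝ} (hk : 2 ≤ k) (hN : 0 < N) (hX : 1 < X) :
    4 * k ^ 2 / (N * X) * (N * (Real.log X / (2 * k ^ 3))) * √X ≤ 4 * Real.log X / √X := by
  have hs : 0 < √X := Real.sqrt_pos.2 (by linarith)
  have hX' : X = √X ^ 2 := (Real.sq_sqrt (by linarith)).symm
  have hlog : 0 < Real.log X := Real.log_pos hX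
  generalize Real.log X = l at *
  generalize √X = s at *
  subst hX'
  have hk' : 0 < k := by linarith
  have : 4 * k ^ 2 / (N * s ^ 2) * (N * (l / (2 * k ^ 3))) * s = 2 * l / k / s := by
    field_simp
    norm_num
  rw [this]
  apply div_le_div_of_nonneg_right _ hs.le
  rw [div_le_iff₀ hk']
  nlinarith

/-- A regular uniform hypergraph whose codegrees are smaller than its degree by a factor `X` has a
matching that misses a proportion of order `(log X) ^ (-1 / (k - 1))` of the vertices. -/
theorem exists_matching_of_codegree_le [Nonempty E] {k D : ℕ} (hk2 : 2 ≤ k)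
    (hk : ∀ e, (h e).card = k) (hD : ∀ v, (univ.filter fun e => v ∈ h e).card = D)
    {X : ℝ} (hX : 1 < X)
    (hcod : ∀ v w, v ≠ w → ((univ.filter fun e => v ∈ h e ∧ w ∈ h e).card : ℝ) * X ≤ D) :
    ∃ M : Finset E, (∀ e ∈ M, ∀ e' ∈ M, e ≠ e' → Disjoint (h e) (h e')) ∧
      (Fintype.card V : ℝ) * (1 - ((Real.log X / (2 * k ^ 3)) ^ (-(1 / ((k : ℝ) - 1))) +
        4 * Real.log X / √X)) ≤ k * M.card := by
  classical
  have hkR : (2 : ℝ) ≤ k := by exact_mod_cast hk2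
  have hEpos : (0 : ℝ) < Fintype.card E := by exact_mod_cast Fintype.card_pos
  have hlog : 0 < Real.log X := Real.log_pos hX
  obtain ⟨e0⟩ := ‹Nonempty E›
  have : Nonempty E := ⟨e0⟩
  obtain ⟨v0, hv0⟩ : (h e0).Nonempty := card_pos.1 (by rw [hk]; omega)
  have hDpos : 0 < D := by
    rw [← hD v0]
    exact card_pos.2 ⟨e0, by simp [hv0]⟩
  have hDR : (0 : ℝ) < D := by exact_mod_cast hDpos
  set N : ℝ := (Fintype.card V : ℝ) with hN
  have hcount : (Fintype.card E : ℝ) * k = N * D := by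
    have h1 : ∑ e, (univ.filter fun v => v ∈ h e).card =
        ∑ v, (univ.filter fun e => v ∈ h e).card := by
      simp only [card_filter]
      exact sum_comm
    simp only [hD, sum_const, card_univ, smul_eq_mul, filter_mem_eq_inter, univ_inter, hk] at h1
    rw [hN]
    exact_mod_cast h1
  -- the `k - 1` other vertices of the edges at `v0` are spread over at least `X` vertices
  have hNX : X ≤ N := by
    have h1 : ∑ w ∈ univ.erase v0, (univ.filter fun e => v0 ∈ h e ∧ w ∈ h e).card =
        D * (k - 1) := by
      simp only [card_filter]
      rw [sum_comm]
      have h2 : ∀ e, (∑ w ∈ univ.erase v0, if v0 ∈ h e ∧ w ∈ h e then 1 else 0) =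
          if v0 ∈ h e then k - 1 else 0 := by
        intro e
        split_ifs with hv
        · simp only [hv, true_and]
          rw [← card_filter]
          have : (univ.erase v0).filter (fun w => w ∈ h e) = (h e).erase v0 := by
            ext x; simp
          rw [this, card_erase_of_mem hv, hk]
        · simp [hv]
      simp only [h2]
      rw [← sum_filter, sum_const, hD, smul_eq_mul]
    have h3 : (∑ w ∈ univ.erase v0, ((univ.filter fun e => v0 ∈ h e ∧ w ∈ h e).card : ℝ) * X) ≤
        ∑ w ∈ univ.erase v0, (D : ℝ) :=
      sum_le_sum fun w hw => hcod v0 w (ne_of_mem_erase hw).symm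
    rw [← sum_mul, ← Nat.cast_sum, h1, sum_const, card_erase_of_mem (mem_univ _), card_univ,
      nsmul_eq_mul] at h3
    have h4 : (1 : ℝ) ≤ ((k - 1 : ℕ) : ℝ) := by exact_mod_cast (by omega : 1 ≤ k - 1)
    have h5 : ((Fintype.card V - 1 : ℕ) : ℝ) ≤ N := by
      rw [hN]; exact_mod_cast Nat.sub_le _ _
    push_cast at h3
    have h6 : (D : ℝ) * X ≤ N * D := by
      calc (D : ℝ) * X ≤ D * ((k - 1 : ℕ) : ℝ) * X := by
            nlinarith [mul_nonneg (mul_nonneg hDR.le (by linarith : (0 : ℝ) ≤ X))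
              (sub_nonneg.2 h4)]
        _ ≤ _ := h3
        _ ≤ N * D := by gcongr
    nlinarith
  have hNpos : 0 < N := by linarith
  set Δ : ℕ := ⌊(D : ℝ) / X⌋₊ with hΔ
  have hΔle : (Δ : ℝ) ≤ D / X := Nat.floor_le (by positivity)
  have hΔ' : ∀ v w, v ≠ w → (univ.filter fun e => v ∈ h e ∧ w ∈ h e).card ≤ Δ := by
    intro v w hvw
    exact Nat.le_floor ((le_div_iff₀ (by linarith)).2 (hcod v w hvw))
  set η : ℝ := D / Fintype.card E with hη
  have hηk : η = k / N := by
    rw [hη, div_eq_div_iff hEpos.ne' hNpos.ne']; linarith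
  have hη0 : 0 ≤ η := by positivity
  have hη1 : η ≤ 1 := by
    rw [hη, div_le_one hEpos]
    have : D ≤ Fintype.card E := by rw [← hD v0]; exact card_filter_le _ _
    exact_mod_cast this
  -- the time `T` is chosen such that the error, which grows like `exp (k ^ 3 * T)`, stays small
  set T : ℝ := Real.log X / (2 * k ^ 3) with hT
  have hTpos : 0 < T := by positivity
  set i : ℕ := ⌊N * T⌋₊ with hi
  have hi1 : (i : ℝ) ≤ N * T := Nat.floor_le (by positivity)
  have hi2 : N * T < i + 1 := Nat.lt_floor_add_one _
  obtain ⟨M, hM, hMc⟩ := exists_matching_card_le h (by omega) hk hD hΔ' hη hη1 i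
  refine ⟨M, hM, le_trans ?_ hMc⟩
  obtain ⟨hf0, hf1⟩ := greedyDensity_mem hη0 hη1 k i
  have hf := greedyDensity_pow_le hη0 hη1 k i
  have hfT : greedyDensity η k i ≤ T ^ (-(1 / ((k : ℝ) - 1))) := by
    have h1 : T ≤ 1 + ((k - 1 : ℕ) : ℝ) * (η * i) := by
      have h4 : (1 : ℝ) ≤ ((k - 1 : ℕ) : ℝ) := by exact_mod_cast (by omega : 1 ≤ k - 1)
      have h5 : 0 ≤ η * i := by positivity
      have h6 : η * (N * T) ≤ η * (i + 1) := by gcongr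
      have h7 : η * (N * T) = k * T := by rw [hηk]; field_simp
      nlinarith
    have h2 : greedyDensity η k i ^ (k - 1) ≤ T⁻¹ := by
      rw [← one_div, le_div_iff₀ hTpos]
      exact (mul_le_mul_of_nonneg_left h1 (pow_nonneg hf0 _)).trans hf
    have h3 : ((k - 1 : ℕ) : ℝ) = (k : ℝ) - 1 := by
      push_cast [Nat.cast_sub (by omega : 1 ≤ k)]
      ring
    have h4 : greedyDensity η k i = (greedyDensity η k i ^ (k - 1)) ^ (1 / ((k : ℝ) - 1)) := by
      rw [← Real.rpow_natCast, ← Real.rpow_mul hf0, h3, mul_one_div_cancel (by linarith),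
        Real.rpow_one]
    rw [h4, Real.rpow_neg hTpos.le, ← Real.inv_rpow hTpos.le]
    exact Real.rpow_le_rpow (pow_nonneg hf0 _) h2 (by apply one_div_nonneg.2; linarith)
  have ha : greedyError (η * k ^ 2) ((1 + k) * Δ / Fintype.card E + 2 * η ^ 2) i ≤
      4 * Real.log X / √X := by
    refine (greedyError_le (by positivity) (by positivity) i).trans ?_
    have h1 : Real.exp (η * k ^ 2 * i) ≤ √X := by
      rw [Real.sqrt_eq_rpow, Real.rpow_def_of_pos (by linarith)]
      apply Real.exp_le_exp.2
      calc η * k ^ 2 * i ≤ η * k ^ 2 * (N * T) := by gcongr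
        _ = Real.log X * (1 / 2) := by rw [hηk, hT]; field_simp
    have h2 : (1 + k) * Δ / Fintype.card E + 2 * η ^ 2 ≤ 4 * k ^ 2 / (N * X) := by
      have h3 : (1 + k) * (Δ : ℝ) / Fintype.card E ≤ 2 * k ^ 2 / (N * X) := by
        calc (1 + k) * (Δ : ℝ) / Fintype.card E ≤ (1 + k) * (D / X) / Fintype.card E := by gcongr
          _ = (1 + k) * (η / X) := by rw [hη]; field_simp
          _ = (1 + k) * k / (N * X) := by rw [hηk]; field_simp
          _ ≤ 2 * k ^ 2 / (N * X) :=
            div_le_div_of_nonneg_right (by nlinarith) (by positivity)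
      have h4 : 2 * η ^ 2 ≤ 2 * k ^ 2 / (N * X) := by
        rw [hηk, div_pow, ← mul_div_assoc]
        exact div_le_div_of_nonneg_left (by positivity) (by positivity) (by nlinarith)
      calc _ ≤ 2 * k ^ 2 / (N * X) + 2 * k ^ 2 / (N * X) := add_le_add h3 h4
        _ = _ := by ring
    refine le_trans ?_ (greedyError_scale_le hkR hNpos hX)
    gcongr
  gcongr

end RandomGreedy

/-! ### The label hypergraph -/

section LabelHypergraph

set_option synthInstance.maxSize 2000

/-- If `f` maps the subgroup `K` onto `H`, then its fibres in `K` all have the size of its kernel in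
`K`. -/
lemma AddMonoidHom.card_filter_eq_mul {G H : Type*} [AddCommGroup G] [Fintype G] [AddCommGroup H]
    [Fintype H] [DecidableEq H] (f : G →+ H) (K : AddSubgroup G) [DecidablePred (· ∈ K)]
    (hf : ∀ b, ∃ g ∈ K, f g = b) :
    (univ.filter fun g => g ∈ K).card =
      Fintype.card H * (univ.filter fun g => g ∈ K ∧ f g = 0).card := by
  rw [card_eq_sum_card_fiberwise (f := f) (t := univ) (fun _ _ => mem_coe.2 (mem_univ _)),
    ← card_univ, ← smul_eq_mul, ← sum_const]
  refine sum_congr rfl fun b _ => ?_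
  obtain ⟨g₀, hg₀, rfl⟩ := hf b
  refine card_bij' (fun g _ => g - g₀) (fun g _ => g + g₀) ?_ ?_ ?_ ?_
  · intro g hg
    simp only [mem_filter, mem_univ, true_and] at hg ⊢
    exact ⟨K.sub_mem hg.1 hg₀, by rw [map_sub, hg.2, sub_self]⟩
  · intro g hg
    simp only [mem_filter, mem_univ, true_and] at hg ⊢
    exact ⟨K.add_mem hg.1 hg₀, by rw [map_add, hg.2, zero_add]⟩
  · simp
  · simp

/-- The `d`-subsets of the set `Fin t` of types. -/
abbrev TypeSet (d t : ℕ) : Type := {e : Finset (Fin t) // e.card = d}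

/-- Labels: a stage modulo `d` for every `d`-set of types, and a height modulo `m`. -/
abbrev Label (d t m : ℕ) : Type := (TypeSet d t → ZMod d) × ZMod m

variable {d t m : ℕ}

/-- The stage of a labelling at a `d`-set `e` of types: the sum over `e` of the `e`-th stages and
the heights modulo `d`. -/
def stage (hm : d ∣ m) (e : TypeSet d t) : (Fin t → Label d t m) →+ ZMod d where
  toFun ℓ := ∑ x ∈ e.1, ((ℓ x).1 e + ZMod.castHom hm (ZMod d) (ℓ x).2)
  map_zero' := by simp
  map_add' ℓ ℓ' := by
    rw [← sum_add_distrib]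
    refine sum_congr rfl fun x _ => ?_
    simp only [Pi.add_apply, Prod.fst_add, Prod.snd_add, map_add]
    abel

lemma stage_apply (hm : d ∣ m) (e : TypeSet d t) (ℓ : Fin t → Label d t m) :
    stage hm e ℓ = ∑ x ∈ e.1, ((ℓ x).1 e + ZMod.castHom hm (ZMod d) (ℓ x).2) := rfl

/-- The restriction of a labelling to a set `e` of types, up to a common shift of the heights: only
differences of heights are recorded. -/
def restrictLabel (e : Finset (Fin t)) :
    (Fin t → Label d t m) →+ (Fin t → Fin t → Label d t m) where
  toFun ℓ x y := if x ∈ e ∧ y ∈ e then ((ℓ x).1, (ℓ x).2 - (ℓ y).2) else 0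
  map_zero' := by
    funext x y
    simp
  map_add' ℓ ℓ' := by
    funext x y
    by_cases h : x ∈ e ∧ y ∈ e
    · simp only [Pi.add_apply, Prod.fst_add, Prod.snd_add, if_pos h, Prod.mk_add_mk]
      congr 1
      abel
    · simp [if_neg h]

lemma restrictLabel_eq_iff {e : Finset (Fin t)} {ℓ ℓ' : Fin t → Label d t m} :
    restrictLabel e ℓ = restrictLabel e ℓ' ↔
      ∀ x ∈ e, ∀ y ∈ e, (ℓ x).1 = (ℓ' x).1 ∧ (ℓ x).2 - (ℓ y).2 = (ℓ' x).2 - (ℓ' y).2 := by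
  constructor
  · intro h x hx y hy
    have := congrFun (congrFun h x) y
    simpa [restrictLabel, hx, hy] using this
  · intro h
    funext x y
    by_cases hxy : x ∈ e ∧ y ∈ e
    · have := h x hxy.1 y hxy.2
      simp [restrictLabel, hxy, this]
    · simp [restrictLabel, hxy]

lemma restrictLabel_eq_zero_iff {e : Finset (Fin t)} {ℓ : Fin t → Label d t m} :
    restrictLabel e ℓ = 0 ↔ ∀ x ∈ e, ∀ y ∈ e, (ℓ x).1 = 0 ∧ (ℓ x).2 = (ℓ y).2 := by
  rw [← map_zero (restrictLabel e), restrictLabel_eq_iff]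
  simp [sub_eq_zero]

lemma not_subset_of_ne {e e' : TypeSet d t} (h : e' ≠ e) : ¬ e'.1 ⊆ e.1 := fun hs =>
  h (Subtype.ext (eq_of_subset_of_card_le hs (by rw [e.2, e'.2])))

variable [NeZero d]

/-- A labelling that vanishes on `e` can have arbitrary stages at the `d`-sets not contained in `e`:
in each of these, the corresponding component of the label of one type outside `e` is adjusted. -/
lemma exists_stage_eq (hm : d ∣ m) (e : Finset (Fin t)) (b : TypeSet d t → ZMod d) :
    ∃ ℓ : Fin t → Label d t m, (∀ x ∈ e, ℓ x = 0) ∧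
      ∀ e' : TypeSet d t, ¬ e'.1 ⊆ e → stage hm e' ℓ = b e' := by
  have hx : ∀ e' : TypeSet d t, ∃ x, ¬ e'.1 ⊆ e → x ∈ e'.1 ∧ x ∉ e := by
    intro e'
    by_cases h : e'.1 ⊆ e
    · have : Nonempty (Fin t) := by
        have : e'.1.Nonempty := card_pos.1 (by rw [e'.2]; exact Nat.pos_of_neZero d)
        exact ⟨this.choose⟩
      exact ⟨Classical.arbitrary _, fun h' => absurd h h'⟩
    · obtain ⟨x, h1, h2⟩ := not_subset.1 h
      exact ⟨x, fun _ => ⟨h1, h2⟩⟩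
  choose f hf using hx
  refine ⟨fun x => if x ∈ e then 0 else (fun e' => if f e' = x then b e' else 0, 0), ?_, ?_⟩
  · intro x hx
    simp [hx]
  · intro e' he'
    obtain ⟨h1, h2⟩ := hf e' he'
    rw [stage_apply, sum_eq_single (f e')]
    · simp [h2]
    · intro x _ hx
      by_cases hxe : x ∈ e
      · simp [hxe]
      · simp [hxe, Ne.symm hx]
    · exact fun h => absurd h1 h

variable [NeZero m]

/-- A labelling with trivial restriction to `e` is given by the common height on `e` and by
arbitrary labels of the other types. -/
lemma card_filter_restrictLabel_eq_zero (hd : 1 ≤ d) (e : TypeSet d t) :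
    (univ.filter fun ℓ : Fin t → Label d t m => restrictLabel e.1 ℓ = 0).card =
      m * Fintype.card (Label d t m) ^ (t - d) := by
  have hne : e.1.Nonempty := card_pos.1 (by rw [e.2]; exact hd)
  obtain ⟨x₀, hx₀⟩ := hne
  have h1 : Fintype.card {x // x ∉ e.1} = t - d := by
    rw [Fintype.card_subtype_compl, Fintype.card_fin, Fintype.card_coe, e.2]
  have h2 : Fintype.card (ZMod m × ({x // x ∉ e.1} → Label d t m)) =
      m * Fintype.card (Label d t m) ^ (t - d) := by
    rw [Fintype.card_prod, ZMod.card, Fintype.card_fun, h1]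
  rw [← h2, ← card_univ]
  refine card_bij' (fun ℓ _ => ((ℓ x₀).2, fun x => ℓ x.1))
    (fun p _ => fun x => if h : x ∉ e.1 then p.2 ⟨x, h⟩ else (0, p.1)) ?_ ?_ ?_ ?_
  · simp
  · intro p _
    simp only [mem_filter, mem_univ, true_and]
    rw [restrictLabel_eq_zero_iff]
    intro x hx y hy
    simp [hx, hy]
  · intro ℓ hℓ
    simp only [mem_filter, mem_univ, true_and] at hℓ
    rw [restrictLabel_eq_zero_iff] at hℓ
    funext x
    by_cases hx : x ∈ e.1
    · have := hℓ x hx x₀ hx₀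
      simp only [hx, not_true_eq_false, dite_false]
      exact Prod.ext this.1.symm this.2.symm
    · simp [hx]
  · intro p _
    refine Prod.ext ?_ ?_
    · simp [hx₀]
    · funext x
      simp [x.2]

/-- Labellings with trivial restrictions to both `e` and `e'` are much rarer than those with trivial
restriction to `e`: the label of a type in `e' \ e` is determined by that of any other type of
`e'`. -/
lemma card_filter_restrictLabel_two (hd : 2 ≤ d) {e e' : TypeSet d t} (hne : e' ≠ e) :
    (univ.filter fun ℓ : Fin t → Label d t m =>
        restrictLabel e.1 ℓ = 0 ∧ restrictLabel e'.1 ℓ = 0).card * Fintype.card (Label d t m) ≤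
      (univ.filter fun ℓ : Fin t → Label d t m => restrictLabel e.1 ℓ = 0).card := by
  obtain ⟨x, hx', hx⟩ := not_subset.1 (not_subset_of_ne hne)
  obtain ⟨y, hy', hyx⟩ := exists_mem_ne (by rw [e'.2]; omega : 1 < e'.1.card) x
  rw [← card_univ, ← card_product]
  refine card_le_card_of_injOn (fun p => p.1 + Pi.single x p.2) ?_ ?_
  · rintro ⟨ℓ, a⟩ hp
    simp only [coe_product, coe_filter, mem_univ, true_and, Set.mem_prod, Set.mem_ofPred_eq] at hp
    simp only [coe_filter, mem_univ, true_and, Set.mem_ofPred_eq]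
    rw [map_add, hp.1.1, zero_add, restrictLabel_eq_zero_iff]
    intro y hy z hz
    have h1 : y ≠ x := fun h => hx (h ▸ hy)
    have h2 : z ≠ x := fun h => hx (h ▸ hz)
    simp [Pi.single_eq_of_ne h1, Pi.single_eq_of_ne h2]
  · rintro ⟨ℓ, a⟩ hp ⟨ℓ', a'⟩ hp' heq
    simp only [coe_product, coe_filter, mem_univ, true_and, Set.mem_prod, Set.mem_ofPred_eq]
      at hp hp'
    simp only at heq
    have h1 := restrictLabel_eq_zero_iff.1 hp.1.2
    have h2 := restrictLabel_eq_zero_iff.1 hp'.1.2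
    have h3 : ∀ z, z ≠ x → ℓ z = ℓ' z := by
      intro z hz
      have := congrFun heq z
      simpa [Pi.single_eq_of_ne hz] using this
    have h4 : ℓ x = ℓ y := Prod.ext ((h1 x hx' y hy').1.trans (h1 y hy' x hx').1.symm)
      (h1 x hx' y hy').2
    have h5 : ℓ' x = ℓ' y := Prod.ext ((h2 x hx' y hy').1.trans (h2 y hy' x hx').1.symm)
      (h2 x hx' y hy').2
    have h6 : ℓ = ℓ' := by
      funext z
      by_cases hz : z = x
      · rw [hz, h4, h5, h3 y hyx]
      · exact h3 z hz
    refine Prod.ext h6 ?_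
    have := congrFun heq x
    simpa [h6] using this

end LabelHypergraph

section LabelHypergraph

set_option synthInstance.maxSize 2000

variable {d t m : ℕ}

/-- The stage is invariant under a common shift of the heights on the `d` types of `e`, as such a
shift changes it by a multiple of `d`. -/
lemma stage_eq_of_restrictLabel_eq (hm : d ∣ m) {e : TypeSet d t} {ℓ ℓ' : Fin t → Label d t m}
    (h : restrictLabel e.1 ℓ = restrictLabel e.1 ℓ') : stage hm e ℓ = stage hm e ℓ' := by
  rw [restrictLabel_eq_iff] at h
  rcases e.1.eq_empty_or_nonempty with h0 | ⟨x₀, hx₀⟩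
  · rw [stage_apply, stage_apply, h0, sum_empty, sum_empty]
  · rw [← sub_eq_zero, stage_apply, stage_apply, ← sum_sub_distrib]
    rw [sum_congr rfl (g := fun _ => ZMod.castHom hm (ZMod d) ((ℓ x₀).2 - (ℓ' x₀).2))]
    · rw [sum_const, e.2, nsmul_eq_mul, ZMod.natCast_self, zero_mul]
    · intro x hx
      obtain ⟨h1, h2⟩ := h x hx x₀ hx₀
      have h3 : (ℓ x).2 - (ℓ' x).2 = (ℓ x₀).2 - (ℓ' x₀).2 := by
        rw [sub_eq_sub_iff_add_eq_add] at h2 ⊢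
        rw [h2, add_comm]
      rw [h1, add_sub_add_left_eq_sub, ← map_sub, h3]

lemma card_index (e : TypeSet d t) {τ : Finset (Fin t)} (hτ : τ.card = d + 2) (he : e.1 ⊆ τ) :
    Fintype.card {e' : TypeSet d t // e'.1 ⊆ τ ∧ e' ≠ e} = (d + 2).choose 2 - 1 := by
  have h1 : Fintype.card {e' : TypeSet d t // e'.1 ⊆ τ ∧ e' ≠ e} =
      ((powersetCard d τ).erase e.1).card := by
    rw [Fintype.card_subtype]
    refine card_bij (fun e' _ => e'.1) ?_ (fun _ _ _ _ h => Subtype.ext h) ?_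
    · intro e' h
      simp only [mem_filter, mem_univ, true_and] at h
      exact mem_erase.2 ⟨fun hh => h.2 (Subtype.ext hh), mem_powersetCard.2 ⟨h.1, e'.2⟩⟩
    · intro a ha
      obtain ⟨h2, h3⟩ := mem_erase.1 ha
      obtain ⟨h4, h5⟩ := mem_powersetCard.1 h3
      exact ⟨⟨a, h5⟩, by simpa using ⟨h4, fun hh => h2 (congrArg Subtype.val hh)⟩, rfl⟩
  rw [h1, card_erase_of_mem (mem_powersetCard.2 ⟨he, e.2⟩), card_powersetCard, hτ,
    Nat.choose_symm_add]

variable [NeZero d] [NeZero m]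

/-- The number of labellings with prescribed restriction to `e` for which all the stages at
`d`-subsets of `τ` vanish. -/
lemma card_filter_stage_restrictLabel (hd : 1 ≤ d) (hm : d ∣ m) (e : TypeSet d t)
    {τ : Finset (Fin t)} (hτ : τ.card = d + 2) (he : e.1 ⊆ τ) {ℓ₀ : Fin t → Label d t m}
    (hℓ₀ : stage hm e ℓ₀ = 0) :
    d ^ ((d + 2).choose 2 - 1) *
      (univ.filter fun ℓ : Fin t → Label d t m =>
        (∀ e' : TypeSet d t, e'.1 ⊆ τ → stage hm e' ℓ = 0) ∧
          restrictLabel e.1 ℓ = restrictLabel e.1 ℓ₀).card =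
      m * Fintype.card (Label d t m) ^ (t - d) := by
  rw [← card_filter_restrictLabel_eq_zero hd e, ← card_index e hτ he]
  set f : (Fin t → Label d t m) →+ ({e' : TypeSet d t // e'.1 ⊆ τ ∧ e' ≠ e} → ZMod d) :=
    AddMonoidHom.pi fun i => stage hm i.1 with hf
  have hf0 : ∀ ℓ, f ℓ = 0 ↔ ∀ e' : TypeSet d t, e'.1 ⊆ τ → e' ≠ e → stage hm e' ℓ = 0 := by
    intro ℓ
    constructor
    · intro h e' h1 h2
      exact congrFun h ⟨e', h1, h2⟩
    · intro h
      funext i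
      exact h i.1 i.2.1 i.2.2
  have h0 : ∀ ℓ : Fin t → Label d t m, (∀ x ∈ e.1, ℓ x = 0) → restrictLabel e.1 ℓ = 0 := by
    intro ℓ h
    rw [restrictLabel_eq_zero_iff]
    intro x hx y hy
    simp [h x hx, h y hy]
  have hsurj : ∀ b, ∃ ℓ ∈ (restrictLabel (d := d) (m := m) e.1).ker, f ℓ = b := by
    intro b
    obtain ⟨ℓ, h1, h2⟩ := exists_stage_eq hm e.1 fun e' =>
      if h : e'.1 ⊆ τ ∧ e' ≠ e then b ⟨e', h⟩ else 0
    refine ⟨ℓ, h0 ℓ h1, ?_⟩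
    funext i
    have := h2 i.1 (not_subset_of_ne i.2.2)
    rw [dif_pos i.2] at this
    exact this
  have h1 := AddMonoidHom.card_filter_eq_mul f (restrictLabel (d := d) (m := m) e.1).ker hsurj
  rw [Fintype.card_fun, ZMod.card] at h1
  simp only [AddMonoidHom.mem_ker] at h1
  rw [h1]
  congr 1
  -- a translation by `ℓ₀ + ℓ₁`, where all the stages vanish, reduces the claim to `ℓ₀ = 0`
  obtain ⟨ℓ₁, h2, h3⟩ := exists_stage_eq hm e.1 fun e' => - stage hm e' ℓ₀
  have h4 := h0 ℓ₁ h2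
  refine card_bij' (fun g _ => g - (ℓ₀ + ℓ₁)) (fun g _ => g + (ℓ₀ + ℓ₁)) ?_ ?_ ?_ ?_
  · intro g hg
    simp only [mem_filter, mem_univ, true_and] at hg ⊢
    refine ⟨by rw [map_sub, map_add, h4, hg.2, add_zero, sub_self], ?_⟩
    rw [hf0]
    intro e' h5 h6
    rw [map_sub, map_add, h3 e' (not_subset_of_ne h6), hg.1 e' h5]
    simp
  · intro g hg
    simp only [mem_filter, mem_univ, true_and] at hg ⊢
    rw [hf0] at hg
    have h8 : restrictLabel e.1 (g + (ℓ₀ + ℓ₁)) = restrictLabel e.1 ℓ₀ := by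
      rw [map_add, map_add, h4, hg.1, add_zero, zero_add]
    refine ⟨?_, h8⟩
    intro e' h5
    by_cases h6 : e' = e
    · rw [h6, stage_eq_of_restrictLabel_eq hm h8, hℓ₀]
    · rw [map_add, map_add, h3 e' (not_subset_of_ne h6), hg.2 e' h5 h6]
      simp
  · simp
  · simp

/-- The vertices of the label hypergraph: a `d`-set `e` of types, together with the labels on `e`
up to a shift of the heights, such that the stage at `e` vanishes. -/
abbrev LabelVertex (t : ℕ) (hm : d ∣ m) : Type :=
  {v : TypeSet d t × (Fin t → Fin t → Label d t m) //
    ∃ ℓ, stage hm v.1 ℓ = 0 ∧ restrictLabel v.1.1 ℓ = v.2}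

/-- The edges of the label hypergraph: a `(d + 2)`-set `τ` of types and labels for which all stages
at `d`-subsets of `τ` vanish. Labels of types outside `τ` are irrelevant and only give every edge
the same multiplicity. -/
abbrev LabelEdge (t : ℕ) (hm : d ∣ m) : Type :=
  {p : Finset (Fin t) × (Fin t → Label d t m) //
    p.1.card = d + 2 ∧ ∀ e : TypeSet d t, e.1 ⊆ p.1 → stage hm e p.2 = 0}

/-- The vertex set of an edge of the label hypergraph. -/
def labelEdgeSet {hm : d ∣ m} (p : LabelEdge t hm) : Finset (LabelVertex t hm) :=
  univ.filter fun v => v.1.1.1 ⊆ p.1.1 ∧ restrictLabel v.1.1.1 p.1.2 = v.1.2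

lemma mem_labelEdgeSet {hm : d ∣ m} {p : LabelEdge t hm} {v : LabelVertex t hm} :
    v ∈ labelEdgeSet p ↔ v.1.1.1 ⊆ p.1.1 ∧ restrictLabel v.1.1.1 p.1.2 = v.1.2 := by
  simp [labelEdgeSet]

lemma card_labelEdgeSet {hm : d ∣ m} (p : LabelEdge t hm) :
    (labelEdgeSet p).card = (d + 2).choose 2 := by
  rw [show (d + 2).choose 2 = (powersetCard d p.1.1).card by
    rw [card_powersetCard, p.2.1, Nat.choose_symm_add]]
  refine card_bij (fun v _ => v.1.1.1) ?_ ?_ ?_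
  · intro v hv
    exact mem_powersetCard.2 ⟨(mem_labelEdgeSet.1 hv).1, v.1.1.2⟩
  · intro v hv w hw h
    have h1 : v.1.1 = w.1.1 := Subtype.ext h
    refine Subtype.ext (Prod.ext h1 ?_)
    rw [← (mem_labelEdgeSet.1 hv).2, ← (mem_labelEdgeSet.1 hw).2, h1]
  · intro a ha
    obtain ⟨h1, h2⟩ := mem_powersetCard.1 ha
    exact ⟨⟨⟨⟨a, h2⟩, restrictLabel a p.1.2⟩, p.1.2, p.2.2 ⟨a, h2⟩ h1, rfl⟩,
      mem_labelEdgeSet.2 ⟨h1, rfl⟩, rfl⟩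

lemma card_filter_labelEdge {hm : d ∣ m} (P : Finset (Fin t) → Prop) [DecidablePred P]
    (Q : (Fin t → Label d t m) → Prop) [DecidablePred Q] :
    (univ.filter fun p : LabelEdge t hm => P p.1.1 ∧ Q p.1.2).card =
      ∑ τ ∈ (powersetCard (d + 2) univ).filter P,
        (univ.filter fun ℓ : Fin t → Label d t m =>
          (∀ e : TypeSet d t, e.1 ⊆ τ → stage hm e ℓ = 0) ∧ Q ℓ).card := by
  rw [← card_sigma]
  refine card_bij (fun p _ => ⟨p.1.1, p.1.2⟩) ?_ ?_ ?_
  · intro p hp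
    simp only [mem_filter, mem_univ, true_and] at hp
    simp only [mem_sigma, mem_filter, mem_univ, true_and, mem_powersetCard, subset_univ]
    exact ⟨⟨p.2.1, hp.1⟩, p.2.2, hp.2⟩
  · intro p _ q _ h
    simp only [Sigma.mk.injEq, heq_eq_eq] at h
    exact Subtype.ext (Prod.ext h.1 h.2)
  · rintro ⟨τ, ℓ⟩ h
    simp only [mem_sigma, mem_filter, mem_univ, true_and, mem_powersetCard, subset_univ] at h
    exact ⟨⟨⟨τ, ℓ⟩, h.1.1, h.2.1⟩, by simpa using ⟨h.1.2, h.2.2⟩, rfl⟩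

end LabelHypergraph

section LabelHypergraph

set_option synthInstance.maxSize 2000

variable {d t m : ℕ}

lemma card_filter_superset_typeSet (e : TypeSet d t) :
    ((powersetCard (d + 2) univ).filter fun τ => e.1 ⊆ τ).card = (t - d).choose 2 := by
  have h : t - d = (univ \ e.1).card := by
    rw [card_sdiff_of_subset (subset_univ _), card_univ, Fintype.card_fin, e.2]
  rw [h, ← card_powersetCard]
  refine card_bij' (fun τ _ => τ \ e.1) (fun a _ => a ∪ e.1) ?_ ?_ ?_ ?_
  · intro τ hτ
    simp only [mem_filter, mem_powersetCard, subset_univ, true_and] at hτ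
    rw [mem_powersetCard, card_sdiff_of_subset hτ.2, hτ.1, e.2]
    exact ⟨sdiff_subset_sdiff (subset_univ _) Subset.rfl, by omega⟩
  · intro a ha
    rw [mem_powersetCard] at ha
    have hd : Disjoint a e.1 := disjoint_of_subset_left ha.1 sdiff_disjoint
    simp only [mem_filter, mem_powersetCard, subset_univ, true_and]
    exact ⟨by rw [card_union_of_disjoint hd, ha.2, e.2, add_comm], subset_union_right⟩
  · intro τ hτ
    simp only [mem_filter, mem_powersetCard, subset_univ, true_and] at hτ
    exact sdiff_union_of_subset hτ.2
  · intro a ha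
    rw [mem_powersetCard] at ha
    have hd : Disjoint a e.1 := disjoint_of_subset_left ha.1 sdiff_disjoint
    exact union_sdiff_cancel_right hd

variable [NeZero d] [NeZero m]

/-- The label hypergraph is regular: there are `(t - d).choose 2` sets of `d + 2` types containing
the `d` types of `v`, and the stages at the other `d`-sets take each value equally often. -/
lemma degree_labelVertex (hd : 1 ≤ d) {hm : d ∣ m} (v : LabelVertex t hm) :
    d ^ ((d + 2).choose 2 - 1) * (univ.filter fun p : LabelEdge t hm => v ∈ labelEdgeSet p).card =
      (t - d).choose 2 * (m * Fintype.card (Label d t m) ^ (t - d)) := by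
  obtain ⟨⟨e, ρ⟩, hv⟩ := v
  obtain ⟨ℓ₀, hℓ₀, h⟩ := id hv
  obtain rfl : restrictLabel e.1 ℓ₀ = ρ := h
  simp only [mem_labelEdgeSet]
  rw [card_filter_labelEdge (fun τ => e.1 ⊆ τ)
      (fun ℓ => restrictLabel e.1 ℓ = restrictLabel e.1 ℓ₀), mul_sum,
    ← card_filter_superset_typeSet e, ← smul_eq_mul (a := card _), ← sum_const]
  refine sum_congr rfl fun τ hτ => ?_
  simp only [mem_filter, mem_powersetCard, subset_univ, true_and] at hτ
  exact card_filter_stage_restrictLabel hd hm e hτ.1 hτ.2 hℓ₀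

/-- Compared with the degrees, the codegrees of the label hypergraph are smaller by a factor of the
order of the number of labels. -/
lemma codegree_labelVertex (hd : 2 ≤ d) {hm : d ∣ m} {v w : LabelVertex t hm} (hvw : v ≠ w) :
    (univ.filter fun p : LabelEdge t hm => v ∈ labelEdgeSet p ∧ w ∈ labelEdgeSet p).card *
        Fintype.card (Label d t m) ≤
      (t - d).choose 2 * (m * Fintype.card (Label d t m) ^ (t - d)) := by
  obtain ⟨⟨e, ρ⟩, hv⟩ := v
  obtain ⟨ℓ₀, hℓ₀, h⟩ := id hv
  obtain rfl : restrictLabel e.1 ℓ₀ = ρ := h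
  obtain ⟨⟨e', ρ'⟩, hw⟩ := w
  obtain ⟨ℓ₀', hℓ₀', h'⟩ := id hw
  obtain rfl : restrictLabel e'.1 ℓ₀' = ρ' := h'
  simp only [mem_labelEdgeSet]
  by_cases hee : e' = e
  · subst hee
    have : (univ.filter fun p : LabelEdge t hm =>
        (e'.1 ⊆ p.1.1 ∧ restrictLabel e'.1 p.1.2 = restrictLabel e'.1 ℓ₀) ∧
          e'.1 ⊆ p.1.1 ∧ restrictLabel e'.1 p.1.2 = restrictLabel e'.1 ℓ₀') = ∅ := by
      rw [filter_eq_empty_iff]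
      rintro p - ⟨⟨-, h1⟩, -, h2⟩
      exact hvw (by simp only [← h1, ← h2])
    rw [this]
    simp
  have h1 : (univ.filter fun p : LabelEdge t hm =>
      (e.1 ⊆ p.1.1 ∧ restrictLabel e.1 p.1.2 = restrictLabel e.1 ℓ₀) ∧
        e'.1 ⊆ p.1.1 ∧ restrictLabel e'.1 p.1.2 = restrictLabel e'.1 ℓ₀') ⊆
      univ.filter fun p : LabelEdge t hm => e.1 ⊆ p.1.1 ∧
        (restrictLabel e.1 p.1.2 = restrictLabel e.1 ℓ₀ ∧
          restrictLabel e'.1 p.1.2 = restrictLabel e'.1 ℓ₀') := by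
    intro p
    simp only [mem_filter, mem_univ, true_and]
    tauto
  refine (Nat.mul_le_mul_right _ (card_le_card h1)).trans ?_
  rw [card_filter_labelEdge (fun τ => e.1 ⊆ τ)
      (fun ℓ => restrictLabel e.1 ℓ = restrictLabel e.1 ℓ₀ ∧
        restrictLabel e'.1 ℓ = restrictLabel e'.1 ℓ₀'),
    sum_mul, ← card_filter_superset_typeSet e, ← smul_eq_mul (a := card _), ← sum_const]
  refine sum_le_sum fun τ _ => ?_
  rw [← card_filter_restrictLabel_eq_zero (by omega) e]
  refine le_trans (Nat.mul_le_mul_right _ ?_) (card_filter_restrictLabel_two hd hee)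
  -- the differences of the labellings in question have trivial restrictions to `e` and to `e'`
  rcases (univ.filter fun ℓ : Fin t → Label d t m =>
      (∀ e : TypeSet d t, e.1 ⊆ τ → stage hm e ℓ = 0) ∧
        restrictLabel e.1 ℓ = restrictLabel e.1 ℓ₀ ∧
          restrictLabel e'.1 ℓ = restrictLabel e'.1 ℓ₀').eq_empty_or_nonempty with h | ⟨g₀, hg₀⟩
  · rw [h]
    simp
  · simp only [mem_filter, mem_univ, true_and] at hg₀
    refine card_le_card_of_injOn (fun g => g - g₀) ?_ fun _ _ _ _ h => sub_left_injective h
    intro g hg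
    simp only [coe_filter, mem_univ, true_and, Set.mem_ofPred_eq] at hg ⊢
    rw [map_sub, map_sub, hg.2.1, hg.2.2, hg₀.2.1, hg₀.2.2, sub_self, sub_self]
    exact ⟨rfl, rfl⟩

/-- Every vertex of the label hypergraph stands for `d * m` of the `d`-sets with distinct types. -/
lemma card_labelVertex (hd : 1 ≤ d) (hm : d ∣ m) :
    d * (m * Fintype.card (Label d t m) ^ (t - d)) * Fintype.card (LabelVertex t hm) =
      t.choose d * Fintype.card (Label d t m) ^ t := by
  have h1 : Fintype.card (LabelVertex t hm) = ∑ e : TypeSet d t,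
      ((univ.filter fun ℓ => stage hm e ℓ = 0).image (restrictLabel e.1)).card := by
    rw [← card_sigma, ← card_univ]
    refine card_bij (fun v _ => ⟨v.1.1, v.1.2⟩) ?_ ?_ ?_
    · rintro ⟨v, ℓ, h1, h2⟩ -
      simp only [mem_sigma, mem_univ, true_and, mem_image, mem_filter]
      exact ⟨ℓ, h1, h2⟩
    · intro v _ w _ h
      simp only [Sigma.mk.injEq, heq_eq_eq] at h
      exact Subtype.ext (Prod.ext h.1 h.2)
    · rintro ⟨e, ρ⟩ h
      simp only [mem_sigma, mem_univ, true_and, mem_image, mem_filter] at h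
      exact ⟨⟨⟨e, ρ⟩, h⟩, mem_univ _, rfl⟩
  have h2 : Fintype.card (TypeSet d t) = t.choose d := by
    rw [Fintype.card_finset_len, Fintype.card_fin]
  rw [h1, mul_sum, ← h2, ← card_univ (α := TypeSet d t), ← smul_eq_mul (a := card _), ← sum_const]
  refine sum_congr rfl fun e _ => ?_
  rw [← card_filter_restrictLabel_eq_zero hd e]
  have : DecidablePred (· ∈ (⊤ : AddSubgroup (Fin t → Label d t m))) := fun _ => .isTrue trivial
  have h3 := AddMonoidHom.card_filter_eq_mul (stage hm e) (⊤ : AddSubgroup (Fin t → Label d t m))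
    (by
      intro b
      obtain ⟨ℓ, -, h⟩ := exists_stage_eq (m := m) hm (∅ : Finset (Fin t)) fun _ => b
      refine ⟨ℓ, AddSubgroup.mem_top _, h e fun hh => ?_⟩
      have := e.2
      rw [subset_empty.1 hh, card_empty] at this
      omega)
  simp only [AddSubgroup.mem_top, true_and, filter_true, card_univ] at h3
  rw [Fintype.card_fun, Fintype.card_fin, ZMod.card] at h3
  rw [h3, mul_assoc]
  congr 1
  rw [card_eq_sum_card_image (restrictLabel e.1) (univ.filter fun ℓ => stage hm e ℓ = 0),
    mul_comm, ← smul_eq_mul (a := card _), ← sum_const]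
  refine sum_congr rfl fun ρ hρ => Eq.symm ?_
  obtain ⟨ℓ₀, h4, rfl⟩ := mem_image.1 hρ
  simp only [mem_filter, mem_univ, true_and] at h4
  refine card_bij' (fun g _ => g - ℓ₀) (fun g _ => g + ℓ₀) ?_ ?_ ?_ ?_
  · intro g hg
    simp only [mem_filter, mem_univ, true_and] at hg ⊢
    rw [map_sub, hg.2, sub_self]
  · intro g hg
    simp only [mem_filter, mem_univ, true_and] at hg ⊢
    have h5 : restrictLabel e.1 (g + ℓ₀) = restrictLabel e.1 ℓ₀ := by
      rw [map_add, hg, zero_add]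
    exact ⟨(stage_eq_of_restrictLabel_eq hm h5).trans h4, h5⟩
  · simp
  · simp

end LabelHypergraph

/-! ### Closed trails from matchings of the label hypergraph -/

section LabelMatching

set_option synthInstance.maxSize 2000

variable {d t m : ℕ} [NeZero d] [NeZero m]

/-- An almost perfect matching of the label hypergraph. -/
lemma exists_labelMatching (hd : 2 ≤ d) (hm : d ∣ m) (ht : d + 2 ≤ t) {k : ℕ}
    (hk : k = (d + 2).choose 2) {X : ℝ} (hX : 1 < X)
    (hXle : X * (d : ℝ) ^ (k - 1) ≤ Fintype.card (Label d t m)) :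
    ∃ M : Finset (LabelEdge t hm),
      (∀ p ∈ M, ∀ q ∈ M, p ≠ q → Disjoint (labelEdgeSet p) (labelEdgeSet q)) ∧
      ((t.choose d : ℝ) * (Fintype.card (Label d t m) : ℝ) ^ d / (d * m)) *
        (1 - ((Real.log X / (2 * (k : ℝ) ^ 3)) ^ (-(1 / ((k : ℝ) - 1))) +
          4 * Real.log X / √X)) ≤ k * M.card := by
  have hd0 : (0 : ℝ) < d := by exact_mod_cast Nat.pos_of_neZero d
  have hm0 : (0 : ℝ) < m := by exact_mod_cast Nat.pos_of_neZero m
  have hL0 : (0 : ℝ) < Fintype.card (Label d t m) := by exact_mod_cast Fintype.card_pos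
  have hdp : 0 < d ^ (k - 1) := Nat.pow_pos (Nat.pos_of_neZero d)
  have hne : Nonempty (LabelEdge t hm) := by
    obtain ⟨τ, -, hτ⟩ := exists_subset_card_eq (s := (univ : Finset (Fin t)))
      (by rwa [card_univ, Fintype.card_fin] : d + 2 ≤ _)
    exact ⟨⟨(τ, 0), hτ, fun e _ => map_zero _⟩⟩
  set D : ℕ := (t - d).choose 2 * (m * Fintype.card (Label d t m) ^ (t - d)) / d ^ (k - 1) with hD
  have hdeg : ∀ v : LabelVertex t hm, (univ.filter fun p => v ∈ labelEdgeSet p).card = D := by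
    intro v
    rw [hD, ← degree_labelVertex (by omega) v, ← hk, Nat.mul_div_cancel_left _ hdp]
  have hcod : ∀ v w : LabelVertex t hm, v ≠ w →
      ((univ.filter fun p => v ∈ labelEdgeSet p ∧ w ∈ labelEdgeSet p).card : ℝ) * X ≤ D := by
    intro v w hvw
    have h1 := codegree_labelVertex hd hvw
    rw [← degree_labelVertex (by omega) v, ← hk, hdeg v] at h1
    have h2 : ((univ.filter fun p => v ∈ labelEdgeSet p ∧ w ∈ labelEdgeSet p).card : ℝ) *
        Fintype.card (Label d t m) ≤ (d : ℝ) ^ (k - 1) * D := by exact_mod_cast h1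
    have h3 : (0 : ℝ) < (d : ℝ) ^ (k - 1) := by positivity
    refine le_of_mul_le_mul_left ?_ h3
    calc _ = ((univ.filter fun p => v ∈ labelEdgeSet p ∧ w ∈ labelEdgeSet p).card : ℝ) *
          (X * (d : ℝ) ^ (k - 1)) := by ring
      _ ≤ _ := (mul_le_mul_of_nonneg_left hXle (Nat.cast_nonneg _)).trans h2
  have hk2 : 2 ≤ k := by
    rw [hk]
    calc 2 ≤ (2 + 2).choose 2 := by decide
      _ ≤ _ := Nat.choose_le_choose 2 (by omega)
  obtain ⟨M, h1, h2⟩ := exists_matching_of_codegree_le (labelEdgeSet (hm := hm)) hk2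
    (fun p => by rw [card_labelEdgeSet, hk]) hdeg hX hcod
  refine ⟨M, h1, ?_⟩
  have h3 : ((t.choose d : ℝ) * (Fintype.card (Label d t m) : ℝ) ^ d / (d * m)) =
      Fintype.card (LabelVertex t hm) := by
    have h4 := card_labelVertex (t := t) (by omega : 1 ≤ d) hm
    have h5 : t = d + (t - d) := by omega
    have h6 : (d : ℝ) * (m * (Fintype.card (Label d t m) : ℝ) ^ (t - d)) *
        Fintype.card (LabelVertex t hm) =
        t.choose d * ((Fintype.card (Label d t m) : ℝ) ^ d *
          (Fintype.card (Label d t m) : ℝ) ^ (t - d)) := by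
      rw [← pow_add, ← h5]
      exact_mod_cast h4
    rw [div_eq_iff (by positivity)]
    have h7 : (0 : ℝ) < (Fintype.card (Label d t m) : ℝ) ^ (t - d) := by positivity
    refine mul_right_cancel₀ h7.ne' ?_
    linarith
  rw [h3]
  exact h2

end LabelMatching

section Trail

variable {d t m : ℕ}

/-- The closed trail with types `τ` and labels `ℓ`: it runs cyclically through the `d + 2` types,
in increasing order, and raises the heights by one in each turn. -/
def labelTrail {τ : Finset (Fin t)} (hτ : τ.card = d + 2) (ℓ : Fin t → Label d t m) (i : ℕ) :
    Fin t × Label d t m :=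
  let x := τ.orderEmbOfFin hτ (Fin.ofNat (d + 2) i)
  (x, (ℓ x).1, (ℓ x).2 + ((i / (d + 2) : ℕ) : ZMod m))

lemma labelTrail_injOn {τ : Finset (Fin t)} (hτ : τ.card = d + 2) (ℓ : Fin t → Label d t m)
    {i j : ℕ} (hi : i < (d + 2) * m) (hj : j < (d + 2) * m)
    (h : labelTrail hτ ℓ i = labelTrail hτ ℓ j) :
    i = j := by
  simp only [labelTrail, Prod.mk.injEq, EmbeddingLike.apply_eq_iff_eq] at h
  obtain ⟨h1, h2, h3⟩ := h
  have h4 : i % (d + 2) = j % (d + 2) := congrArg Fin.val h1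
  rw [h1, add_right_inj, ZMod.natCast_eq_natCast_iff] at h3
  have h5 := h3.eq_of_lt_of_lt (Nat.div_lt_of_lt_mul hi) (Nat.div_lt_of_lt_mul hj)
  rw [← Nat.div_add_mod i (d + 2), ← Nat.div_add_mod j (d + 2), h4, h5]

lemma labelTrail_period {τ : Finset (Fin t)} (hτ : τ.card = d + 2) (ℓ : Fin t → Label d t m) :
    labelTrail hτ ℓ ((d + 2) * m) = labelTrail hτ ℓ 0 := by
  have h : Fin.ofNat (d + 2) ((d + 2) * m) = Fin.ofNat (d + 2) 0 := by
    apply Fin.ext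
    simp [Fin.ofNat]
  simp only [labelTrail, h]
  simp

/-- Two turn functions on the same set of types agree up to a constant if their sums agree modulo
`d`: in a window of a trail, the types in the later turn form an initial segment, and an initial
segment of a `d`-set other than the whole set is determined by its cardinality modulo `d`. -/
lemma turn_add_eq {α : Type*} [LinearOrder α] {e : Finset α} (he : e.card = d) {f f' : α → ℕ}
    {j j' : ℕ} (hf : ∀ x ∈ e, f x = j ∨ f x = j + 1) (hf' : ∀ x ∈ e, f' x = j' ∨ f' x = j' + 1)
    (hlow : ∀ x ∈ e, ∀ y ∈ e, x < y → f y = j + 1 → f x = j + 1)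
    (hlow' : ∀ x ∈ e, ∀ y ∈ e, x < y → f' y = j' + 1 → f' x = j' + 1)
    (hj : ∃ x ∈ e, f x = j) (hj' : ∃ x ∈ e, f' x = j')
    (hsum : ((∑ x ∈ e, f x : ℕ) : ZMod d) = ((∑ x ∈ e, f' x : ℕ) : ZMod d)) :
    ∀ x ∈ e, f x + j' = f' x + j := by
  have hcount : ∀ (g : α → ℕ) (i : ℕ), (∀ x ∈ e, g x = i ∨ g x = i + 1) →
      ∑ x ∈ e, g x = d * i + (e.filter fun x => g x = i + 1).card := by
    intro g i hg
    rw [card_filter, ← he, ← smul_eq_mul, ← sum_const, ← sum_add_distrib]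
    refine sum_congr rfl fun x hx => ?_
    rcases hg x hx with h | h <;> simp [h]
  have hlt : ∀ (g : α → ℕ) (i : ℕ), (∃ x ∈ e, g x = i) →
      (e.filter fun x => g x = i + 1).card < d := by
    rintro g i ⟨x, hx, h⟩
    rw [← he]
    refine card_lt_card (filter_ssubset.2 ⟨x, hx, by omega⟩)
  have hcard : (e.filter fun x => f x = j + 1).card = (e.filter fun x => f' x = j' + 1).card := by
    rw [hcount f j hf, hcount f' j' hf'] at hsum
    push_cast at hsum
    rw [ZMod.natCast_self, zero_mul, zero_mul, zero_add, zero_add,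
      ZMod.natCast_eq_natCast_iff] at hsum
    exact hsum.eq_of_lt_of_lt (hlt f j hj) (hlt f' j' hj')
  have heq : (e.filter fun x => f x = j + 1) = (e.filter fun x => f' x = j' + 1) := by
    by_contra hne
    have h1 : ¬ (e.filter fun x => f x = j + 1) ⊆ (e.filter fun x => f' x = j' + 1) := fun h =>
      hne (eq_of_subset_of_card_le h hcard.ge)
    have h2 : ¬ (e.filter fun x => f' x = j' + 1) ⊆ (e.filter fun x => f x = j + 1) := fun h =>
      hne (eq_of_subset_of_card_le h hcard.le).symm
    obtain ⟨x, hx, hx'⟩ := not_subset.1 h1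
    obtain ⟨y, hy, hy'⟩ := not_subset.1 h2
    rw [mem_filter] at hx hx' hy hy'
    rcases lt_trichotomy x y with h | rfl | h
    · exact hx' ⟨hx.1, hlow' x hx.1 y hy.1 h hy.2⟩
    · exact hx' hy
    · exact hy' ⟨hy.1, hlow y hy.1 x hx.1 h hx.2⟩
  intro x hx
  have h1 : f x = j + 1 ↔ f' x = j' + 1 := by
    have := congrArg (x ∈ ·) heq
    simpa [mem_filter, hx] using this
  have := hf x hx
  have := hf' x hx
  omega

/-- The types in a short set of positions of a trail, and their turns. -/
lemma exists_turn {τ : Finset (Fin t)} (hτ : τ.card = d + 2) {A : Finset ℕ} (hA : A.Nonempty)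
    (hshort : ∀ x ∈ A, ∀ y ∈ A, x ≤ y + (d + 1)) :
    ∃ j, (∀ a ∈ A, a / (d + 2) = j ∨ a / (d + 2) = j + 1) ∧ (∃ a ∈ A, a / (d + 2) = j) ∧
      (∀ a ∈ A, ∀ b ∈ A, τ.orderEmbOfFin hτ (Fin.ofNat (d + 2) a) <
        τ.orderEmbOfFin hτ (Fin.ofNat (d + 2) b) → b / (d + 2) = j + 1 → a / (d + 2) = j + 1) ∧
      ∀ a ∈ A, ∀ b ∈ A, τ.orderEmbOfFin hτ (Fin.ofNat (d + 2) a) =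
        τ.orderEmbOfFin hτ (Fin.ofNat (d + 2) b) → a = b := by
  have hmin := A.min'_mem hA
  have hle : ∀ a ∈ A, A.min' hA ≤ a := fun a ha => A.min'_le a ha
  have key : ∀ a ∈ A, a / (d + 2) = A.min' hA / (d + 2) ∨
      a / (d + 2) = A.min' hA / (d + 2) + 1 := by
    intro a ha
    have h1 := hshort a ha _ hmin
    have h2 : A.min' hA / (d + 2) ≤ a / (d + 2) := Nat.div_le_div_right (hle a ha)
    have h3 : a / (d + 2) ≤ (A.min' hA + (d + 2)) / (d + 2) := Nat.div_le_div_right (by omega)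
    rw [Nat.add_div_right _ (by omega)] at h3
    omega
  refine ⟨A.min' hA / (d + 2), key, ⟨_, hmin, rfl⟩, ?_, ?_⟩
  · intro a ha b hb hab hbj
    rw [OrderEmbedding.lt_iff_lt] at hab
    have h1 : a % (d + 2) < b % (d + 2) := hab
    rcases key a ha with h | h
    · have h2 := hshort b hb a ha
      have h3 := Nat.div_add_mod a (d + 2)
      have h4 := Nat.div_add_mod b (d + 2)
      rw [h] at h3
      rw [hbj, mul_add] at h4
      omega
    · exact h
  · intro a ha b hb hab
    rw [EmbeddingLike.apply_eq_iff_eq] at hab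
    have h1 : a % (d + 2) = b % (d + 2) := congrArg Fin.val hab
    have h2 := hshort a ha b hb
    have h3 := hshort b hb a ha
    have h4 := Nat.div_add_mod a (d + 2)
    have h5 := Nat.div_add_mod b (d + 2)
    rcases key a ha with h | h <;> rcases key b hb with h' | h' <;>
      rw [h] at h4 <;> rw [h'] at h5 <;> try omega
    · rw [mul_add] at h5; omega
    · rw [mul_add] at h4; omega

end Trail

section Trail

variable {d t m : ℕ}

/-- If trails with vanishing stages share a `d`-set in windows, then the edges of the label
hypergraph they come from share a vertex. On the set `e` of the types involved, the differences of
the heights of the two labels are those of the turns. As the stages at `e` vanish, the sums of the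
turns agree modulo `d`, so that by `turn_add_eq` the turns differ by a constant. -/
lemma exists_restrictLabel_eq_of_image_eq (hd : 1 ≤ d) (hm : d ∣ m) {τ τ' : Finset (Fin t)}
    (hτ : τ.card = d + 2) (hτ' : τ'.card = d + 2) {ℓ ℓ' : Fin t → Label d t m}
    (hℓ : ∀ e : TypeSet d t, e.1 ⊆ τ → stage hm e ℓ = 0)
    (hℓ' : ∀ e : TypeSet d t, e.1 ⊆ τ' → stage hm e ℓ' = 0) {A A' : Finset ℕ} (hA : A.card = d)
    (hA' : A'.card = d) (hs : ∀ x ∈ A, ∀ y ∈ A, x ≤ y + (d + 1))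
    (hs' : ∀ x ∈ A', ∀ y ∈ A', x ≤ y + (d + 1))
    (h : A.image (labelTrail hτ ℓ) = A'.image (labelTrail hτ' ℓ')) :
    ∃ e : TypeSet d t, e.1 ⊆ τ ∧ e.1 ⊆ τ' ∧ restrictLabel e.1 ℓ = restrictLabel e.1 ℓ' := by
  obtain ⟨j, hj1, ⟨a₀, ha₀, hj2⟩, hj3, hj4⟩ := exists_turn hτ (card_pos.1 (by omega)) hs
  obtain ⟨j', hj1', ⟨a₀', ha₀', hj2'⟩, hj3', hj4'⟩ := exists_turn hτ' (card_pos.1 (by omega)) hs'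
  set x := fun a => τ.orderEmbOfFin hτ (Fin.ofNat (d + 2) a) with hx
  set x' := fun a => τ'.orderEmbOfFin hτ' (Fin.ofNat (d + 2) a) with hx'
  have he : (A.image x).card = d := by
    rw [card_image_of_injOn fun a ha b hb hab => hj4 a ha b hb hab, hA]
  have h1 : ∀ y ∈ A.image x, ∃ a ∈ A, x a = y := fun y hy => mem_image.1 hy
  have h1' : ∀ y ∈ A.image x, ∃ a' ∈ A', x' a' = y ∧ (ℓ y).1 = (ℓ' y).1 ∧
      ∀ a ∈ A, x a = y → (ℓ y).2 + ((a / (d + 2) : ℕ) : ZMod m) =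
        (ℓ' y).2 + ((a' / (d + 2) : ℕ) : ZMod m) := by
    intro y hy
    obtain ⟨a, ha, rfl⟩ := h1 y hy
    have h2 : labelTrail hτ ℓ a ∈ A'.image (labelTrail hτ' ℓ') := h ▸ mem_image_of_mem _ ha
    obtain ⟨a', ha', h3⟩ := mem_image.1 h2
    simp only [labelTrail, Prod.mk.injEq] at h3
    have h4 : x' a' = x a := h3.1
    refine ⟨a', ha', h4, ?_, ?_⟩
    · have := h3.2.1
      rw [show τ'.orderEmbOfFin hτ' (Fin.ofNat (d + 2) a') = x a from h4] at this
      exact this.symm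
    · intro b hb hba
      rw [hj4 b hb a ha hba]
      have := h3.2.2
      rw [show τ'.orderEmbOfFin hτ' (Fin.ofNat (d + 2) a') = x a from h4] at this
      exact this.symm
  -- positions `f y` and `f' y` of the vertex of type `y` in the two trails
  choose! f hf hfx using h1
  choose! f' hf' hfx' hu hz using h1'
  have hz2 : ∀ y ∈ A.image x, (ℓ y).2 + ((f y / (d + 2) : ℕ) : ZMod m) =
      (ℓ' y).2 + ((f' y / (d + 2) : ℕ) : ZMod m) := fun y hy => hz y hy _ (hf y hy) (hfx y hy)
  have hτe : A.image x ⊆ τ := by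
    intro y hy
    obtain ⟨a, -, rfl⟩ := mem_image.1 hy
    exact orderEmbOfFin_mem _ _ _
  have hτe' : A.image x ⊆ τ' := by
    intro y hy
    rw [← hfx' y hy]
    exact orderEmbOfFin_mem _ _ _
  set e : TypeSet d t := ⟨A.image x, he⟩ with hee
  have hsum : ((∑ y ∈ A.image x, f y / (d + 2) : ℕ) : ZMod d) =
      ((∑ y ∈ A.image x, f' y / (d + 2) : ℕ) : ZMod d) := by
    have h2 := hℓ e hτe
    have h3 := hℓ' e hτe'
    rw [stage_apply] at h2 h3
    have h4 : ∑ y ∈ A.image x, ((ℓ y).1 e + ZMod.castHom hm (ZMod d) ((ℓ y).2 +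
        ((f y / (d + 2) : ℕ) : ZMod m))) = ∑ y ∈ A.image x, ((ℓ' y).1 e +
          ZMod.castHom hm (ZMod d) ((ℓ' y).2 + ((f' y / (d + 2) : ℕ) : ZMod m))) := by
      refine sum_congr rfl fun y hy => ?_
      rw [hz2 y hy, hu y hy]
    simp only [map_add, map_natCast, ← add_assoc] at h4
    rw [sum_add_distrib (f := fun y => (ℓ y).1 e + ZMod.castHom hm (ZMod d) (ℓ y).2),
      sum_add_distrib (f := fun y => (ℓ' y).1 e + ZMod.castHom hm (ZMod d) (ℓ' y).2)] at h4
    push_cast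
    rw [h2, h3, zero_add, zero_add] at h4
    exact h4
  have hmem : ∀ a ∈ A, f (x a) = a := fun a ha =>
    hj4 _ (hf _ (mem_image_of_mem _ ha)) a ha (hfx _ (mem_image_of_mem _ ha))
  have key := turn_add_eq (f := fun y => f y / (d + 2)) (f' := fun y => f' y / (d + 2)) he
    (j := j) (j' := j')
    (fun y hy => hj1 _ (hf y hy)) (fun y hy => hj1' _ (hf' y hy))
    (fun y hy z hz hyz => hj3 _ (hf y hy) _ (hf z hz) (by
      change x (f y) < x (f z)
      rwa [hfx y hy, hfx z hz]))
    (fun y hy z hz hyz => hj3' _ (hf' y hy) _ (hf' z hz) (by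
      change x' (f' y) < x' (f' z)
      rwa [hfx' y hy, hfx' z hz]))
    ⟨x a₀, mem_image_of_mem _ ha₀, by rw [hmem a₀ ha₀, hj2]⟩
    (by
      have h2 : labelTrail hτ' ℓ' a₀' ∈ A.image (labelTrail hτ ℓ) := h ▸ mem_image_of_mem _ ha₀'
      obtain ⟨a, ha, h3⟩ := mem_image.1 h2
      simp only [labelTrail, Prod.mk.injEq] at h3
      have h4 : x a = x' a₀' := h3.1
      have h5 : x' a₀' ∈ A.image x := h4 ▸ mem_image_of_mem _ ha
      exact ⟨_, h5, by rw [hj4' _ (hf' _ h5) _ ha₀' (hfx' _ h5), hj2']⟩)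
    hsum
  refine ⟨e, hτe, hτe', restrictLabel_eq_iff.2 fun y hy z hz => ⟨hu y hy, ?_⟩⟩
  have hdiff : ∀ y ∈ A.image x, (ℓ y).2 - (ℓ' y).2 = (j' : ZMod m) - j := by
    intro y hy
    have h2 := hz2 y hy
    have h3 : ((f y / (d + 2) : ℕ) : ZMod m) + j' = ((f' y / (d + 2) : ℕ) : ZMod m) + j := by
      exact_mod_cast congrArg (Nat.cast : ℕ → ZMod m) (key y hy)
    linear_combination h2 - h3
  linear_combination hdiff y hy - hdiff z hz

variable [NeZero d] [NeZero m]

/-- A large family of closed trails of length `(d + 2) m` in `Fin t × Label d t m`, no two of which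
share a `d`-set contained in a window of `d + 2` positions. The trails start at height `0`. -/
theorem exists_labelTrails (hd : 2 ≤ d) (hm : d ∣ m) (ht : d + 2 ≤ t) {k : ℕ}
    (hk : k = (d + 2).choose 2) {X : ℝ} (hX : 1 < X)
    (hXle : X * (d : ℝ) ^ (k - 1) ≤ Fintype.card (Label d t m)) :
    ∃ (M : ℕ) (T : ℕ → ℕ → Fin t × Label d t m),
      (∀ i < M, ∀ a < (d + 2) * m, ∀ b < (d + 2) * m, T i a = T i b → a = b) ∧
      (∀ i < M, T i ((d + 2) * m) = T i 0) ∧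
      (∀ i < M, ∀ j < M, ∀ A A' : Finset ℕ, A.card = d → A'.card = d →
        (∀ x ∈ A, ∀ y ∈ A, x ≤ y + (d + 1)) → (∀ x ∈ A', ∀ y ∈ A', x ≤ y + (d + 1)) →
        A.image (T i) = A'.image (T j) → i = j) ∧
      (∀ i < M, (T i 0).2.2 = 0) ∧
      ((t.choose d : ℝ) * (Fintype.card (Label d t m) : ℝ) ^ d / (d * m)) *
        (1 - ((Real.log X / (2 * (k : ℝ) ^ 3)) ^ (-(1 / ((k : ℝ) - 1))) +
          4 * Real.log X / √X)) ≤ k * M := by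
  obtain ⟨S, hS, hcard⟩ := exists_labelMatching hd hm ht hk hX hXle
  have hne : Nonempty (LabelEdge t hm) := by
    obtain ⟨τ, -, hτ⟩ := exists_subset_card_eq (s := (univ : Finset (Fin t)))
      (by rwa [card_univ, Fintype.card_fin] : d + 2 ≤ _)
    exact ⟨⟨(τ, 0), hτ, fun e _ => map_zero _⟩⟩
  -- an enumeration of the matching
  let p : ℕ → LabelEdge t hm := fun i =>
    if h : i < S.card then S.equivFin.symm ⟨i, h⟩ else Classical.arbitrary _
  have hpS : ∀ i < S.card, p i ∈ S := by
    intro i hi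
    simp only [p, dif_pos hi]
    exact (S.equivFin.symm ⟨i, hi⟩).2
  have hpinj : ∀ i < S.card, ∀ j < S.card, p i = p j → i = j := by
    intro i hi j hj h
    simp only [p, dif_pos hi, dif_pos hj] at h
    have := S.equivFin.symm.injective (Subtype.ext h)
    exact congrArg Fin.val this
  -- the labels are shifted such that the first height is `0`
  let c : ℕ → ZMod m := fun i =>
    ((p i).1.2 ((p i).1.1.orderEmbOfFin (p i).2.1 (Fin.ofNat (d + 2) 0))).2
  let ℓ : ℕ → Fin t → Label d t m := fun i x => (((p i).1.2 x).1, ((p i).1.2 x).2 - c i)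
  have hℓ : ∀ i (e : Finset (Fin t)), restrictLabel e (ℓ i) = restrictLabel e (p i).1.2 := by
    intro i e
    rw [restrictLabel_eq_iff]
    intro x _ y _
    exact ⟨rfl, sub_sub_sub_cancel_right _ _ _⟩
  have hstage : ∀ i (e : TypeSet d t), e.1 ⊆ (p i).1.1 → stage hm e (ℓ i) = 0 := by
    intro i e he
    rw [stage_eq_of_restrictLabel_eq hm (hℓ i e.1)]
    exact (p i).2.2 e he
  refine ⟨S.card, fun i => labelTrail (p i).2.1 (ℓ i), ?_, ?_, ?_, ?_, hcard⟩
  · intro i _ a ha b hb h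
    exact labelTrail_injOn _ _ ha hb h
  · intro i _
    exact labelTrail_period _ _
  · intro i hi j hj A A' hA hA' hs hs' h
    obtain ⟨e, h1, h2, h3⟩ := exists_restrictLabel_eq_of_image_eq (by omega) hm (p i).2.1 (p j).2.1
      (hstage i) (hstage j) hA hA' hs hs' h
    rw [hℓ, hℓ] at h3
    by_contra hij
    have hdisj := hS _ (hpS i hi) _ (hpS j hj) fun h => hij (hpinj i hi j hj h)
    let v : LabelVertex t hm := ⟨(e, restrictLabel e.1 (p i).1.2), (p i).1.2, (p i).2.2 e h1, rfl⟩
    have hv : v ∈ labelEdgeSet (p i) := mem_labelEdgeSet.2 ⟨h1, rfl⟩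
    exact disjoint_left.1 hdisj hv (mem_labelEdgeSet.2 ⟨h2, h3.symm⟩)
  · intro i _
    simp [labelTrail, ℓ, c]

end Trail

/-! ### Choice of the connecting blocks -/

section Connectors

variable {V : Type*} [DecidableEq V]

lemma card_filter_superset_powersetCard {W T : Finset V} (hT : T ⊆ W) (ℓ : ℕ) :
    ((powersetCard ℓ W).filter fun S => T ⊆ S).card ≤ (W.card - T.card).choose (ℓ - T.card) := by
  rw [← card_sdiff_of_subset hT, ← card_powersetCard]
  refine card_le_card_of_injOn (fun S => S \ T) ?_ ?_
  · intro S hS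
    rw [mem_coe, mem_filter, mem_powersetCard] at hS
    rw [mem_coe, mem_powersetCard]
    exact ⟨sdiff_subset_sdiff hS.1.1 Subset.rfl, by rw [card_sdiff_of_subset hS.2, hS.1.2]⟩
  · intro S hS S' hS' heq
    rw [mem_coe, mem_filter] at hS hS'
    simp only at heq
    rw [← sdiff_union_of_subset hS.2, heq, sdiff_union_of_subset hS'.2]

/-- Blocks `S i` of `ℓ` vertices of `W` can be chosen such that no `d`-set which meets a block is
shared by two indices, where a `d`-set belongs to the index `i` if it lies in `S i ∪ E i` or in
`S i ∪ F i`. The numbers `K g` bound how often a given `(d - g)`-set occurs in the sets `E i` or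
`F i`. The blocks are chosen one after another: those with `g` elements in common with an earlier
block at an index that shares `d - g` vertices with the new one have to be avoided. -/
lemma exists_connectors {d ℓ M : ℕ} (hd : 1 ≤ d) (hdℓ : d ≤ ℓ) {W : Finset V}
    (hℓ : ℓ ≤ W.card) (E F : ℕ → Finset V) (hE : ∀ i < M, (E i).card ≤ d + 1)
    (hF : ∀ i < M, (F i).card ≤ d + 1)
    (K : ℕ → ℕ)
    (hKE : ∀ g, 1 ≤ g → g ≤ d → ∀ Q : Finset V, Q.card = d - g →
      ((range M).filter fun i => Q ⊆ E i).card ≤ K g)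
    (hKF : ∀ g, 1 ≤ g → g ≤ d → ∀ Q : Finset V, Q.card = d - g →
      ((range M).filter fun i => Q ⊆ F i).card ≤ K g)
    (hK : ∀ g, 1 ≤ g → g ≤ d → d * (2 ^ (d + 3) * K g) * (ℓ.choose g) ^ 2 < W.card.choose g) :
    ∃ S : ℕ → Finset V, (∀ i < M, S i ⊆ W ∧ (S i).card = ℓ) ∧
      ∀ i < M, ∀ j < M, i ≠ j → ∀ C, C = E i ∨ C = F i → ∀ C', C' = E j ∨ C' = F j →
        (S i ∩ S j).Nonempty → (S i ∩ S j).card + (C ∩ C').card < d := by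
  have main : ∀ m ≤ M, ∃ S : ℕ → Finset V, (∀ i < m, S i ⊆ W ∧ (S i).card = ℓ) ∧
      ∀ i < m, ∀ j < i, ∀ C, C = E i ∨ C = F i → ∀ C', C' = E j ∨ C' = F j →
        (S i ∩ S j).Nonempty → (S i ∩ S j).card + (C ∩ C').card < d := by
    intro m
    induction m with
    | zero => exact fun _ => ⟨fun _ => ∅, by simp, by simp⟩
    | succ m ih =>
      intro hm
      obtain ⟨S, hS, hS'⟩ := ih (by omega)
      -- the earlier indices that share `d - g` old vertices with the index `m`
      set Qs : ℕ → Finset (Finset V) := fun g =>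
        powersetCard (d - g) (E m) ∪ powersetCard (d - g) (F m) with hQs
      set I : ℕ → Finset ℕ := fun g => (Qs g).biUnion fun Q =>
        ((range M).filter fun i => Q ⊆ E i) ∪ ((range M).filter fun i => Q ⊆ F i) with hI
      set bad : Finset (Finset V) := (Icc 1 d).biUnion fun g =>
        ((I g).filter fun i => i < m).biUnion fun i => (powersetCard g (S i)).biUnion fun T =>
          (powersetCard ℓ W).filter fun S => T ⊆ S with hbad
      have hQc : ∀ g, (Qs g).card ≤ 2 ^ (d + 2) := by
        intro g
        refine (card_union_le _ _).trans ?_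
        have h1 : ∀ C : Finset V, C.card ≤ d + 1 → (powersetCard (d - g) C).card ≤ 2 ^ (d + 1) := by
          intro C hC
          rw [card_powersetCard]
          exact (Nat.choose_le_two_pow _ _).trans (Nat.pow_le_pow_right (by norm_num) hC)
        have := h1 _ (hE m (by omega))
        have := h1 _ (hF m (by omega))
        rw [pow_succ 2 (d + 1)]
        omega
      have hIc : ∀ g ∈ Icc 1 d, (I g).card ≤ 2 ^ (d + 3) * K g := by
        intro g hg
        rw [mem_Icc] at hg
        refine (card_biUnion_le_card_mul _ _ (2 * K g) ?_).trans ?_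
        · intro Q hQ
          have hQ' : Q.card = d - g := by
            rcases mem_union.1 hQ with h | h <;> exact (mem_powersetCard.1 h).2
          refine (card_union_le _ _).trans ?_
          have := hKE g hg.1 hg.2 Q hQ'
          have := hKF g hg.1 hg.2 Q hQ'
          omega
        · calc (Qs g).card * (2 * K g) ≤ 2 ^ (d + 2) * (2 * K g) :=
                Nat.mul_le_mul_right _ (hQc g)
            _ = 2 ^ (d + 3) * K g := by ring
      have hsmall : bad.card < (powersetCard ℓ W).card := by
        have hone : ∀ g ∈ Icc 1 d, d * (((I g).filter fun i => i < m).biUnion fun i =>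
            (powersetCard g (S i)).biUnion fun T =>
              (powersetCard ℓ W).filter fun S => T ⊆ S).card < (powersetCard ℓ W).card := by
          intro g hg
          have hg' := mem_Icc.1 hg
          have h1 : (((I g).filter fun i => i < m).biUnion fun i =>
              (powersetCard g (S i)).biUnion fun T =>
                (powersetCard ℓ W).filter fun S => T ⊆ S).card ≤
              (2 ^ (d + 3) * K g) * (ℓ.choose g * (W.card - g).choose (ℓ - g)) := by
            refine (card_biUnion_le_card_mul _ _
              (ℓ.choose g * (W.card - g).choose (ℓ - g)) ?_).trans
                (Nat.mul_le_mul_right _ ((card_filter_le _ _).trans (hIc g hg)))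
            intro i hi
            have him := (mem_filter.1 hi).2
            refine (card_biUnion_le_card_mul _ _ ((W.card - g).choose (ℓ - g)) ?_).trans ?_
            · intro T hT
              rw [mem_powersetCard] at hT
              have := card_filter_superset_powersetCard (hT.1.trans (hS i him).1) ℓ
              rwa [hT.2] at this
            · rw [card_powersetCard, (hS i him).2]
          have h2 := hK g hg'.1 hg'.2
          have h3 : W.card.choose ℓ * ℓ.choose g = W.card.choose g * (W.card - g).choose (ℓ - g) :=
            Nat.choose_mul (by omega)
          have h4 : 0 < ℓ.choose g := Nat.choose_pos (by omega)
          have h5 : 0 < (W.card - g).choose (ℓ - g) := Nat.choose_pos (by omega)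
          rw [card_powersetCard]
          refine lt_of_mul_lt_mul_right (a := ℓ.choose g) ?_ (Nat.zero_le _)
          rw [h3]
          calc _ ≤ d * ((2 ^ (d + 3) * K g) * (ℓ.choose g * (W.card - g).choose (ℓ - g))) *
                ℓ.choose g := Nat.mul_le_mul_right _ (Nat.mul_le_mul_left _ h1)
            _ = (d * (2 ^ (d + 3) * K g) * (ℓ.choose g) ^ 2) * (W.card - g).choose (ℓ - g) := by
              ring
            _ < _ := Nat.mul_lt_mul_of_pos_right h2 h5
        have h6 : d * bad.card ≤ ∑ g ∈ Icc 1 d, d * (((I g).filter fun i => i < m).biUnion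
            fun i => (powersetCard g (S i)).biUnion fun T =>
              (powersetCard ℓ W).filter fun S => T ⊆ S).card := by
          rw [← mul_sum]
          exact Nat.mul_le_mul_left _ card_biUnion_le
        have h7 := h6.trans_lt (sum_lt_sum_of_nonempty ⟨1, mem_Icc.2 ⟨le_rfl, hd⟩⟩ hone)
        rw [sum_const, Nat.card_Icc, smul_eq_mul, Nat.add_sub_cancel] at h7
        exact lt_of_mul_lt_mul_left h7 (Nat.zero_le _)
      obtain ⟨T, hT, hTbad⟩ := exists_mem_notMem_of_card_lt_card hsmall
      rw [mem_powersetCard] at hT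
      refine ⟨Function.update S m T, ?_, ?_⟩
      · intro i hi
        by_cases him : i = m
        · subst him; rw [Function.update_self]; exact hT
        · rw [Function.update_of_ne him]; exact hS i (by omega)
      · intro i hi j hj C hC C' hC' hne
        have hjm : j ≠ m := by omega
        rw [Function.update_of_ne hjm] at hne ⊢
        by_cases him : i = m
        · subst him
          rw [Function.update_self] at hne ⊢
          by_contra hcon
          apply hTbad
          have hpos : 1 ≤ (T ∩ S j).card := card_pos.2 hne
          -- `g` of the shared vertices are new
          obtain ⟨g, hg1, hgd, hgT, hgC⟩ : ∃ g, 1 ≤ g ∧ g ≤ d ∧ g ≤ (T ∩ S j).card ∧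
              d - g ≤ (C ∩ C').card := by
            rcases Nat.lt_or_ge d (T ∩ S j).card with h | h
            · exact ⟨d, hd, le_rfl, h.le, by omega⟩
            · exact ⟨(T ∩ S j).card, hpos, h, le_rfl, by omega⟩
          obtain ⟨R, hR, hRc⟩ := exists_subset_card_eq hgT
          obtain ⟨Q, hQ, hQc'⟩ := exists_subset_card_eq hgC
          rw [hbad, mem_biUnion]
          refine ⟨g, mem_Icc.2 ⟨hg1, hgd⟩, ?_⟩
          rw [mem_biUnion]
          refine ⟨j, ?_, ?_⟩
          · rw [mem_filter, hI, mem_biUnion]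
            refine ⟨⟨Q, ?_, ?_⟩, hj⟩
            · rw [hQs, mem_union, mem_powersetCard, mem_powersetCard]
              have := hQ.trans inter_subset_left
              rcases hC with rfl | rfl
              · exact Or.inl ⟨this, hQc'⟩
              · exact Or.inr ⟨this, hQc'⟩
            · rw [mem_union, mem_filter, mem_filter, mem_range]
              have := hQ.trans inter_subset_right
              rcases hC' with rfl | rfl
              · exact Or.inl ⟨by omega, this⟩
              · exact Or.inr ⟨by omega, this⟩
          · rw [mem_biUnion]
            refine ⟨R, mem_powersetCard.2 ⟨hR.trans inter_subset_right, hRc⟩, ?_⟩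
            rw [mem_filter, mem_powersetCard]
            exact ⟨hT, hR.trans inter_subset_left⟩
        · rw [Function.update_of_ne him] at hne ⊢
          exact hS' i (by omega) j hj C hC C' hC' hne
  obtain ⟨S, hS, hS'⟩ := main M le_rfl
  refine ⟨S, hS, ?_⟩
  intro i hi j hj hij C hC C' hC' hne
  rcases Nat.lt_or_gt_of_ne hij with h | h
  · rw [inter_comm, inter_comm C]
    rw [inter_comm] at hne
    exact hS' j hj i h C' hC' C hC hne
  · exact hS' i hi j h C hC C' hC' hne

end Connectors

/-! ### Joining closed trails to a tube -/

section Concatenation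

variable {V : Type*} [DecidableEq V]

lemma Nat.div_mod_cases {r c q q' : ℕ} (hc : c < r) (h1 : q ≤ q') (h2 : q' ≤ q + c) :
    (q' / r = q / r ∧ q % r ≤ q' % r ∧ q' % r ≤ q % r + c) ∨
      (q' / r = q / r + 1 ∧ q' % r + r ≤ q % r + c) := by
  have h3 : q / r ≤ q' / r := Nat.div_le_div_right h1
  have h4 : q' / r ≤ (q + r) / r := Nat.div_le_div_right (by omega)
  rw [Nat.add_div_right _ (by omega)] at h4
  have h5 := Nat.div_add_mod q r
  have h6 := Nat.div_add_mod q' r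
  rcases Nat.eq_or_lt_of_le h3 with h | h
  · left
    rw [← h] at h6
    omega
  · right
    have h7 : q' / r = q / r + 1 := by omega
    rw [h7, mul_add] at h6
    omega

/-- The concatenation of paths and blocks: the `i`-th path consists of `T i 1, …, T i Λ` and is
followed by the `i`-th block `σ i 0, …, σ i (ℓ - 1)`. -/
def concatPaths (Λ ℓ : ℕ) (T σ : ℕ → ℕ → V) (q : ℕ) : V :=
  if q % (Λ + ℓ) < Λ then T (q / (Λ + ℓ)) (q % (Λ + ℓ) + 1)
  else σ (q / (Λ + ℓ)) (q % (Λ + ℓ) - Λ)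

/-- A concatenation of paths is a tube if the paths are injective and do not share `d`-sets, and if
no `d`-set formed by vertices of a block and by vertices of one of its two neighbouring path ends
occurs at two different blocks. As a block is longer than twice the diameter of a window, a window
meets at most one of these path ends together with the block. -/
lemma isTube_concatPaths {d Λ M : ℕ} (hd : 1 ≤ d) (hΛ : d + 1 ≤ Λ) {T σ : ℕ → ℕ → V} {W : Finset V}
    {S : ℕ → Finset V}
    (hT : ∀ i < M, ∀ a ≤ Λ, ∀ b ≤ Λ, T i a = T i b → a = b)
    (hTW : ∀ i < M, ∀ a, T i a ∉ W)
    (hshare : ∀ i < M, ∀ j < M, ∀ A A' : Finset ℕ, A.card = d → A'.card = d →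
      (∀ x ∈ A, ∀ y ∈ A, x ≤ y + (d + 1)) → (∀ x ∈ A', ∀ y ∈ A', x ≤ y + (d + 1)) →
      A.image (T i) = A'.image (T j) → i = j)
    (hS : ∀ i < M, S i ⊆ W)
    (hσ : ∀ i < M, ∀ a < 2 * d + 2, σ i a ∈ S i)
    (hσinj : ∀ i < M, ∀ a < 2 * d + 2, ∀ b < 2 * d + 2, σ i a = σ i b → a = b)
    {E F : ℕ → Finset V}
    (hE : ∀ i < M, ∀ a, Λ ≤ a + d → a ≤ Λ → T i a ∈ E i)
    (hF : ∀ i, i + 1 < M → ∀ a, 1 ≤ a → a ≤ d + 1 → T (i + 1) a ∈ F i)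
    (hconn : ∀ i < M, ∀ j < M, i ≠ j → ∀ C, C = E i ∨ C = F i → ∀ C', C' = E j ∨ C' = F j →
      (S i ∩ S j).Nonempty → (S i ∩ S j).card + (C ∩ C').card < d) :
    IsTube d (M * (Λ + (2 * d + 2))) (concatPaths Λ (2 * d + 2) T σ) := by
  set r := Λ + (2 * d + 2) with hr
  have hr0 : 0 < r := by omega
  have hidx : ∀ q, q < M * r → q / r < M := fun q hq => (Nat.div_lt_iff_lt_mul hr0).2 hq
  have hmod : ∀ q, q % r < r := fun q => Nat.mod_lt _ hr0
  have hvp : ∀ q, q % r < Λ → concatPaths Λ (2 * d + 2) T σ q = T (q / r) (q % r + 1) :=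
    fun q h => if_pos h
  have hvb : ∀ q, ¬ q % r < Λ → concatPaths Λ (2 * d + 2) T σ q = σ (q / r) (q % r - Λ) :=
    fun q h => if_neg h
  set v := concatPaths Λ (2 * d + 2) T σ with hv
  have hvW : ∀ q, q < M * r → (v q ∈ W ↔ ¬ q % r < Λ) := by
    intro q hq
    by_cases h : q % r < Λ
    · simp only [h, not_true_eq_false, iff_false]
      rw [hvp q h]
      exact hTW _ (hidx q hq) _
    · simp only [h, not_false_eq_true, iff_true]
      rw [hvb q h]
      have := hmod q
      exact hS _ (hidx q hq) (hσ _ (hidx q hq) _ (by omega))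
  -- positions with the same index are determined by their vertices
  have hsame : ∀ q q', q < M * r → q' < M * r → q / r = q' / r → v q = v q' → q = q' := by
    intro q q' hq hq' hi h
    have h1 : q % r = q' % r := by
      have h3 := hvW q hq
      rw [h, hvW q' hq'] at h3
      have := hmod q
      have := hmod q'
      by_cases hp : q % r < Λ
      · have hp' : q' % r < Λ := by tauto
        rw [hvp q hp, hvp q' hp', ← hi] at h
        have := hT _ (hidx q hq) _ (by omega) _ (by omega) h
        omega
      · have hp' : ¬ q' % r < Λ := by tauto
        rw [hvb q hp, hvb q' hp', ← hi] at h
        have := hσinj _ (hidx q hq) _ (by omega) _ (by omega) h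
        omega
    rw [← Nat.div_add_mod q r, ← Nat.div_add_mod q' r, hi, h1]
  have hnear : ∀ q q', q ≤ q' → q' ≤ q + (d + 1) →
      (q' / r = q / r ∧ q % r ≤ q' % r ∧ q' % r ≤ q % r + (d + 1)) ∨
      (q' / r = q / r + 1 ∧ q' % r + r ≤ q % r + (d + 1)) := fun q q' h h' =>
    Nat.div_mod_cases (by omega) h h'
  have hne : ∀ i j, i < j → j ≤ i + (d + 1) → j < M * r → v i ≠ v j := by
    intro i j hij hj hjL h
    have hiL : i < M * r := by omega
    have := hmod i
    have := hmod j
    rcases hnear i j hij.le hj with h1 | h1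
    · have := hsame i j hiL hjL h1.1.symm h
      omega
    · -- here `i` lies in a block and `j` at the beginning of the next path
      have h3 := hvW i hiL
      rw [h, hvW j hjL] at h3
      omega
  -- a window meeting the `i`-th block meets, apart from it, only one of the adjacent path ends
  have hlocal : ∀ A : Finset ℕ, (∀ x ∈ A, x < M * r) → (∀ x ∈ A, ∀ y ∈ A, x ≤ y + (d + 1)) →
      ∀ q₀ ∈ A, ¬ q₀ % r < Λ → ∃ C, (C = E (q₀ / r) ∨ C = F (q₀ / r)) ∧ ∀ q ∈ A,
        (¬ q % r < Λ ∧ q / r = q₀ / r) ∨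
        (q % r < Λ ∧ v q ∈ C ∧ (q / r = q₀ / r ∨ q / r = q₀ / r + 1)) := by
    intro A hAL hA q₀ hq₀ hb₀
    have hcase : ∀ q ∈ A, (¬ q % r < Λ ∧ q / r = q₀ / r) ∨
        (q % r < Λ ∧ q / r = q₀ / r ∧ Λ ≤ q % r + (d + 1)) ∨
        (q % r < Λ ∧ q / r = q₀ / r + 1 ∧ q % r ≤ d) := by
      intro q hq
      have h1 := hA q hq q₀ hq₀
      have h2 := hA q₀ hq₀ q hq
      have h3 := hmod q
      have h4 := hmod q₀
      rcases le_total q q₀ with h | h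
      · have := hnear q q₀ h h2
        omega
      · have := hnear q₀ q h h1
        omega
    by_cases hex : ∃ q ∈ A, q % r < Λ ∧ q / r = q₀ / r
    · refine ⟨_, Or.inl rfl, fun q hq => ?_⟩
      obtain ⟨q₁, hq₁, h1, h2⟩ := hex
      rcases hcase q hq with h | h | h
      · exact Or.inl h
      · refine Or.inr ⟨h.1, ?_, Or.inl h.2.1⟩
        rw [hvp q h.1, h.2.1]
        exact hE _ (hidx q₀ (hAL _ hq₀)) _ (by omega) (by omega)
      · exfalso
        have h3 := hA q hq q₁ hq₁
        have h4 := Nat.div_add_mod q r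
        have h5 := Nat.div_add_mod q₁ r
        rw [h2] at h5
        rw [h.2.1, mul_add] at h4
        omega
    · refine ⟨_, Or.inr rfl, fun q hq => ?_⟩
      rcases hcase q hq with h | h | h
      · exact Or.inl h
      · exact absurd ⟨q, hq, h.1, h.2.1⟩ hex
      · refine Or.inr ⟨h.1, ?_, Or.inr h.2.1⟩
        have h3 := hidx q (hAL _ hq)
        rw [hvp q h.1, h.2.1]
        exact hF _ (by omega) _ (by omega) (by omega)
  refine ⟨hne, ?_⟩
  intro A A' hA hA' hAL hAL' hs hs' himg
  have hpart : ∀ q ∈ A, ∃ q' ∈ A', v q' = v q := fun q hq =>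
    mem_image.1 (himg ▸ mem_image_of_mem v hq)
  have hpart' : ∀ q ∈ A', ∃ q' ∈ A, v q' = v q := fun q hq =>
    mem_image.1 (himg ▸ mem_image_of_mem v hq)
  suffices hsub : ∀ q ∈ A, ∀ q' ∈ A', v q' = v q → q' = q by
    refine eq_of_subset_of_card_le (fun q hq => ?_) (by rw [hA, hA'])
    obtain ⟨q', hq', h⟩ := hpart q hq
    exact hsub q hq q' hq' h ▸ hq'
  by_cases hex : ∃ q₀ ∈ A, ¬ q₀ % r < Λ
  · obtain ⟨q₀, hq₀, hb₀⟩ := hex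
    obtain ⟨q₁, hq₁, h01⟩ := hpart q₀ hq₀
    have hb₁ : ¬ q₁ % r < Λ := by
      rw [← hvW q₁ (hAL' _ hq₁), h01, hvW q₀ (hAL _ hq₀)]
      exact hb₀
    obtain ⟨C, hC, hCA⟩ := hlocal A hAL hs q₀ hq₀ hb₀
    obtain ⟨C', hC', hCA'⟩ := hlocal A' hAL' hs' q₁ hq₁ hb₁
    have hSmem : ∀ q, q < M * r → ¬ q % r < Λ → v q ∈ S (q / r) := by
      intro q hq h
      rw [hvb q h]
      have := hmod q
      exact hσ _ (hidx q hq) _ (by omega)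
    have hi : q₀ / r = q₁ / r := by
      by_contra hne'
      have h1 := hconn _ (hidx _ (hAL _ hq₀)) _ (hidx _ (hAL' _ hq₁)) hne' C hC C' hC'
        ⟨v q₀, mem_inter.2 ⟨hSmem q₀ (hAL _ hq₀) hb₀, h01 ▸ hSmem q₁ (hAL' _ hq₁) hb₁⟩⟩
      have h2 : A.image v ⊆ (S (q₀ / r) ∩ S (q₁ / r)) ∪ (C ∩ C') := by
        intro y hy
        obtain ⟨q, hq, rfl⟩ := mem_image.1 hy
        obtain ⟨q', hq', h⟩ := hpart q hq
        have h3 := hvW q (hAL _ hq)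
        rw [← h, hvW q' (hAL' _ hq')] at h3
        rcases hCA q hq with ha | ha <;> rcases hCA' q' hq' with hb | hb
        · refine mem_union_left _ (mem_inter.2 ⟨ha.2 ▸ hSmem q (hAL _ hq) ha.1, ?_⟩)
          rw [← h]
          exact hb.2 ▸ hSmem q' (hAL' _ hq') hb.1
        · tauto
        · tauto
        · exact mem_union_right _ (mem_inter.2 ⟨ha.2.1, h ▸ hb.2.1⟩)
      have h3 : (A.image v).card = d := by
        rw [card_image_of_injOn, hA]
        intro x hx y hy hxy
        by_contra hn
        rcases Nat.lt_or_gt_of_ne hn with h | h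
        · exact hne x y h (hs y hy x hx) (hAL y hy) hxy
        · exact hne y x h (hs x hx y hy) (hAL x hx) hxy.symm
      have h4 := (card_le_card h2).trans (card_union_le _ _)
      omega
    have h01' : q₁ = q₀ := hsame _ _ (hAL' _ hq₁) (hAL _ hq₀) hi.symm h01
    subst h01'
    intro q hq q' hq' h
    have h3 := hvW q (hAL _ hq)
    rw [← h, hvW q' (hAL' _ hq')] at h3
    refine hsame _ _ (hAL' _ hq') (hAL _ hq) ?_ h
    have e1 := Nat.div_add_mod q r
    have e2 := Nat.div_add_mod q' r
    have n1 := hs q hq _ hq₀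
    have n2 := hs _ hq₀ q hq
    have n3 := hs' q' hq' _ hq₁
    have n4 := hs' _ hq₁ q' hq'
    have m1 := hmod q
    have m2 := hmod q'
    rcases hCA q hq with ha | ha <;> rcases hCA' q' hq' with hb | hb
    · rw [ha.2, hb.2]
    · tauto
    · tauto
    · rcases ha.2.2 with ha' | ha' <;> rcases hb.2.2 with hb' | hb'
      · rw [ha', hb']
      · exfalso
        rw [ha'] at e1
        rw [hb', mul_add] at e2
        omega
      · exfalso
        rw [ha', mul_add] at e1
        rw [hb'] at e2
        omega
      · rw [ha', hb']
  · push Not at hex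
    have hex' : ∀ q ∈ A', q % r < Λ := by
      intro q hq
      obtain ⟨q', hq', h⟩ := hpart' q hq
      by_contra hb
      rw [← hvW q (hAL' _ hq), ← h, hvW q' (hAL _ hq')] at hb
      exact hb (hex q' hq')
    -- without block positions the set lies in a single path
    have hsingle : ∀ B : Finset ℕ, B.card = d → (∀ x ∈ B, ∀ y ∈ B, x ≤ y + (d + 1)) →
        (∀ x ∈ B, x < M * r) → (∀ x ∈ B, x % r < Λ) → ∃ i < M, (∀ x ∈ B, x / r = i) ∧
          (B.image fun x => x % r + 1).card = d ∧
          (∀ x ∈ B.image fun x => x % r + 1, ∀ y ∈ B.image fun x => x % r + 1,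
            x ≤ y + (d + 1)) ∧ (B.image fun x => x % r + 1).image (T i) = B.image v := by
      intro B hB hBs hBL hBp
      obtain ⟨b, hb⟩ : B.Nonempty := card_pos.1 (by omega)
      have hdiv : ∀ x ∈ B, ∀ y ∈ B, x ≤ y → y / r = x / r ∧ x % r ≤ y % r ∧
          y % r ≤ x % r + (d + 1) := by
        intro x hx y hy hxy
        have := hBp x hx
        have := hBp y hy
        have := hnear x y hxy (hBs y hy x hx)
        omega
      have hdivb : ∀ x ∈ B, x / r = b / r := fun x hx => by
        rcases le_total x b with h | h
        · exact (hdiv x hx b hb h).1.symm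
        · exact (hdiv b hb x hx h).1
      refine ⟨b / r, hidx b (hBL b hb), hdivb, ?_, ?_, ?_⟩
      · rw [card_image_of_injOn, hB]
        intro x hx y hy hxy
        have : x % r + 1 = y % r + 1 := hxy
        rw [← Nat.div_add_mod x r, ← Nat.div_add_mod y r, hdivb x hx, hdivb y hy,
          Nat.succ_injective this]
      · intro x hx y hy
        obtain ⟨x, hxB, rfl⟩ := mem_image.1 hx
        obtain ⟨y, hyB, rfl⟩ := mem_image.1 hy
        rcases le_total x y with h | h
        · have := hdiv x hxB y hyB h
          omega
        · have := hdiv y hyB x hxB h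
          omega
      · rw [image_image]
        refine image_congr fun x hx => ?_
        rw [hvp x (hBp x hx), hdivb x hx]
        rfl
    obtain ⟨i, hi, h1, h2, h3, h4⟩ := hsingle A hA hs hAL hex
    obtain ⟨i', hi', h1', h2', h3', h4'⟩ := hsingle A' hA' hs' hAL' hex'
    have h5 := hshare i hi i' hi' _ _ h2 h2' h3 h3' (by rw [h4, h4', himg])
    intro q hq q' hq' h
    exact hsame _ _ (hAL' _ hq') (hAL _ hq) (by rw [h1 q hq, h1' q' hq', h5]) h

end Concatenation

section EndCount

variable {V : Type*} [DecidableEq V]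

/-- Few paths have an end containing a given set `Q`. Here `I` is the set of the positions of the
end and `b` the position next to it, at which only the vertices of `Z` occur: `Q` together with the
vertex at `b` and with `g - 1` further vertices is a `d`-set which determines the path. -/
lemma card_filter_subset_image_le {d M b : ℕ} {T : ℕ → ℕ → V} {I : Finset ℕ} {Z U : Finset V}
    (hb : b ∉ I) (hI : I.card = d + 1)
    (hshort : ∀ x ∈ insert b I, ∀ y ∈ insert b I, x ≤ y + (d + 1))
    (hinj : ∀ i < M, ∀ x ∈ insert b I, ∀ y ∈ insert b I, T i x = T i y → x = y)
    (hZ : ∀ i < M, T i b ∈ Z) (hU : ∀ i < M, ∀ x ∈ I, T i x ∈ U)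
    (hshare : ∀ i < M, ∀ j < M, ∀ A A' : Finset ℕ, A.card = d → A'.card = d →
      (∀ x ∈ A, ∀ y ∈ A, x ≤ y + (d + 1)) → (∀ x ∈ A', ∀ y ∈ A', x ≤ y + (d + 1)) →
      A.image (T i) = A'.image (T j) → i = j)
    {g : ℕ} (hg : 1 ≤ g) (hgd : g ≤ d) {Q : Finset V} (hQ : Q.card = d - g) :
    ((range M).filter fun i => Q ⊆ I.image (T i)).card ≤ Z.card * U.card ^ (g - 1) := by
  have key : ∀ i, i < M → Q ⊆ I.image (T i) → ∃ R ∈ powersetCard (g - 1) U, ∃ A : Finset ℕ,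
      A.card = d ∧ (∀ x ∈ A, ∀ y ∈ A, x ≤ y + (d + 1)) ∧
      A.image (T i) = insert (T i b) (Q ∪ R) := by
    intro i hi hQi
    have hcardI : (I.image (T i)).card = d + 1 := by
      rw [card_image_of_injOn fun x hx y hy h => hinj i hi x (mem_insert_of_mem hx) y
        (mem_insert_of_mem hy) h, hI]
    obtain ⟨R, hR, hRcard⟩ := exists_subset_card_eq (s := I.image (T i) \ Q) (n := g - 1) (by
      rw [card_sdiff_of_subset hQi, hcardI, hQ]
      omega)
    have hRI : R ⊆ I.image (T i) := hR.trans sdiff_subset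
    have hdisj : Disjoint Q R := disjoint_of_subset_right hR disjoint_sdiff
    have hQR : Q ∪ R ⊆ I.image (T i) := union_subset hQi hRI
    have himg : (I.filter fun a => T i a ∈ Q ∪ R).image (T i) = Q ∪ R := by
      ext y
      rw [mem_image]
      refine ⟨fun ⟨a, ha, h⟩ => h ▸ (mem_filter.1 ha).2, fun hy => ?_⟩
      obtain ⟨a, ha, rfl⟩ := mem_image.1 (hQR hy)
      exact ⟨a, mem_filter.2 ⟨ha, hy⟩, rfl⟩
    refine ⟨R, mem_powersetCard.2 ⟨fun x hx => ?_, hRcard⟩,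
      insert b (I.filter fun a => T i a ∈ Q ∪ R), ?_, ?_, ?_⟩
    · obtain ⟨a, ha, rfl⟩ := mem_image.1 (hRI hx)
      exact hU i hi a ha
    · rw [card_insert_of_notMem fun h => hb (mem_filter.1 h).1,
        ← card_image_of_injOn (f := T i) (s := I.filter fun a => T i a ∈ Q ∪ R)
          fun x hx y hy h => hinj i hi x (mem_insert_of_mem (mem_filter.1 hx).1) y
            (mem_insert_of_mem (mem_filter.1 hy).1) h, himg,
        card_union_of_disjoint hdisj, hQ, hRcard]
      omega
    · intro x hx y hy
      exact hshort x (insert_subset_insert _ (filter_subset _ _) hx) y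
        (insert_subset_insert _ (filter_subset _ _) hy)
    · rw [image_insert, himg]
  choose! R hR A hA hAs hAimg using key
  calc _ ≤ (Z ×ˢ powersetCard (g - 1) U).card := by
        refine card_le_card_of_injOn (fun i => (T i b, R i)) ?_ ?_
        · intro i hi
          rw [mem_coe, mem_filter, mem_range] at hi
          exact mem_product.2 ⟨hZ i hi.1, hR i hi.1 hi.2⟩
        · intro i hi j hj h
          rw [mem_coe, mem_filter, mem_range] at hi hj
          simp only [Prod.mk.injEq] at h
          refine hshare i hi.1 j hj.1 _ _ (hA i hi.1 hi.2) (hA j hj.1 hj.2) (hAs i hi.1 hi.2)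
            (hAs j hj.1 hj.2) ?_
          rw [hAimg i hi.1 hi.2, hAimg j hj.1 hj.2, h.1, h.2]
    _ ≤ _ := by
        rw [card_product, card_powersetCard]
        exact Nat.mul_le_mul_left _ (Nat.choose_le_pow _ _)

/-- Closed trails without common `d`-sets in windows can be cut open and joined, by means of a
sufficiently large set `W` of further vertices, to a single tube. -/
lemma exists_isTube_of_trails {d p M : ℕ} (hd : 1 ≤ d) (hp : 2 * d + 4 ≤ p) {T : ℕ → ℕ → V}
    {Z U W : Finset V}
    (hinj : ∀ i < M, ∀ a < p, ∀ b < p, T i a = T i b → a = b)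
    (hper : ∀ i < M, T i p = T i 0)
    (hshare : ∀ i < M, ∀ j < M, ∀ A A' : Finset ℕ, A.card = d → A'.card = d →
      (∀ x ∈ A, ∀ y ∈ A, x ≤ y + (d + 1)) → (∀ x ∈ A', ∀ y ∈ A', x ≤ y + (d + 1)) →
      A.image (T i) = A'.image (T j) → i = j)
    (hZ : ∀ i < M, T i 0 ∈ Z) (hU : ∀ i < M, ∀ a, T i a ∈ U) (hUW : Disjoint U W)
    (hW : 2 * d + 2 ≤ W.card)
    (hK : ∀ g, 1 ≤ g → g ≤ d →
      d * (2 ^ (d + 3) * (Z.card * U.card ^ (g - 1))) * ((2 * d + 2).choose g) ^ 2 <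
        W.card.choose g) :
    ∃ v : ℕ → V, IsTube d (M * (p - 1 + (2 * d + 2))) v := by
  rcases Nat.eq_zero_or_pos M with rfl | hM
  · by_cases hV : Nonempty V
    · exact ⟨fun _ => Classical.arbitrary V, by simp, fun A A' h1 h2 h3 => by
        obtain ⟨x, hx⟩ : A.Nonempty := card_pos.1 (by omega)
        have := h3 x hx
        omega⟩
    · obtain ⟨x, -⟩ : W.Nonempty := card_pos.1 (by omega)
      exact absurd ⟨x⟩ hV
  have hlast : ∀ g, 1 ≤ g → g ≤ d → ∀ Q : Finset V, Q.card = d - g →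
      ((range M).filter fun i => Q ⊆ (Ico (p - (d + 1)) p).image (T i)).card ≤
        Z.card * U.card ^ (g - 1) := by
    intro g hg hgd Q hQ
    refine card_filter_subset_image_le (b := p) (by simp) (by rw [Nat.card_Ico]; omega) ?_ ?_ ?_
      (fun i hi x _ => hU i hi x) hshare hg hgd hQ
    · intro x hx y hy
      rw [mem_insert, mem_Ico] at hx hy
      omega
    · intro i hi x hx y hy h
      rw [mem_insert, mem_Ico] at hx hy
      rcases hx with rfl | hx <;> rcases hy with rfl | hy
      · rfl
      · rw [hper i hi] at h
        have := hinj i hi _ (by omega) _ (by omega) h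
        omega
      · rw [hper i hi] at h
        have := hinj i hi _ (by omega) _ (by omega) h
        omega
      · exact hinj i hi _ (by omega) _ (by omega) h
    · intro i hi
      rw [hper i hi]
      exact hZ i hi
  have hfirst : ∀ g, 1 ≤ g → g ≤ d → ∀ Q : Finset V, Q.card = d - g →
      ((range M).filter fun i => Q ⊆ (Icc 1 (d + 1)).image (T i)).card ≤
        Z.card * U.card ^ (g - 1) := by
    intro g hg hgd Q hQ
    refine card_filter_subset_image_le (b := 0) (by simp) (by rw [Nat.card_Icc]; omega) ?_ ?_ hZ
      (fun i hi x _ => hU i hi x) hshare hg hgd hQ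
    · intro x hx y hy
      rw [mem_insert, mem_Icc] at hx hy
      omega
    · intro i hi x hx y hy h
      rw [mem_insert, mem_Icc] at hx hy
      exact hinj i hi _ (by omega) _ (by omega) h
  have hnext : ∀ i < M, (i + 1) % M < M := fun i _ => Nat.mod_lt _ hM
  -- the `i`-th block joins the end of the `i`-th trail to the beginning of the next one
  obtain ⟨S, hS, hconn⟩ := exists_connectors hd (by omega : d ≤ 2 * d + 2) hW
    (M := M)
    (fun i => (Ico (p - (d + 1)) p).image (T i))
    (fun i => (Icc 1 (d + 1)).image (T ((i + 1) % M)))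
    (fun i _ => card_image_le.trans (by rw [Nat.card_Ico]; omega))
    (fun i _ => card_image_le.trans (by rw [Nat.card_Icc]; omega))
    (fun g => Z.card * U.card ^ (g - 1)) hlast
    (fun g hg hgd Q hQ => by
      refine le_trans ?_ (hfirst g hg hgd Q hQ)
      refine card_le_card_of_injOn (fun i => (i + 1) % M) ?_ ?_
      · intro i hi
        rw [mem_coe, mem_filter, mem_range] at hi ⊢
        exact ⟨hnext i hi.1, hi.2⟩
      · intro i hi j hj h
        rw [mem_coe, mem_filter, mem_range] at hi hj
        have h1 : i ≡ j [MOD M] := Nat.ModEq.add_right_cancel' 1 h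
        exact h1.eq_of_lt_of_lt hi.1 hj.1) hK
  -- an enumeration of the blocks
  obtain ⟨w₀, -⟩ : W.Nonempty := card_pos.1 (by omega)
  let σ : ℕ → ℕ → V := fun i a =>
    if h : i < M ∧ a < 2 * d + 2 then
      ((S i).equivFinOfCardEq (hS i h.1).2).symm ⟨a, h.2⟩ else w₀
  have hσ : ∀ i (hi : i < M) a (ha : a < 2 * d + 2),
      σ i a = ((S i).equivFinOfCardEq (hS i hi).2).symm ⟨a, ha⟩ := fun i hi a ha =>
    dif_pos ⟨hi, ha⟩
  refine ⟨_, isTube_concatPaths (Λ := p - 1) (σ := σ) (W := W) (S := S) hd (by omega)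
    (fun i hi a ha b hb => hinj i hi a (by omega) b (by omega))
    (fun i hi a => disjoint_left.1 hUW (hU i hi a)) hshare (fun i hi => (hS i hi).1) ?_ ?_
    ?_ ?_ hconn⟩
  · intro i hi a ha
    rw [hσ i hi a ha]
    exact (((S i).equivFinOfCardEq (hS i hi).2).symm ⟨a, ha⟩).2
  · intro i hi a ha b hb h
    rw [hσ i hi a ha, hσ i hi b hb] at h
    have := ((S i).equivFinOfCardEq (hS i hi).2).symm.injective (Subtype.ext h)
    exact congrArg Fin.val this
  · intro i _ a h1 h2
    exact mem_image_of_mem _ (mem_Ico.2 ⟨by omega, by omega⟩)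
  · intro i hi a h1 h2
    rw [Nat.mod_eq_of_lt hi]
    exact mem_image_of_mem _ (mem_Icc.2 ⟨h1, h2⟩)

end EndCount

/-! ### Pseudomanifolds for given parameters -/

section FiniteConstruction

lemma IsTube.comp {V V' : Type*} [DecidableEq V] [DecidableEq V'] {d L : ℕ} {v : ℕ → V}
    (hv : IsTube d L v) {f : V → V'} (hf : Function.Injective f) : IsTube d L (f ∘ v) := by
  refine ⟨fun i j hij hj hjL h => hv.ne i j hij hj hjL (hf h), ?_⟩
  intro A A' hA hA' hAL hAL' hs hs' h
  rw [← image_image, ← image_image] at h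
  exact hv.ridge A A' hA hA' hAL hAL' hs hs' (image_injective hf h)

lemma card_label (d t m : ℕ) [NeZero d] [NeZero m] :
    Fintype.card (Label d t m) = d ^ t.choose d * m := by
  rw [Fintype.card_prod, Fintype.card_fun, ZMod.card, ZMod.card, Fintype.card_finset_len,
    Fintype.card_fin]

/-- The tube in `Fin n` obtained from trails with labels in `Label d t m` and from the remaining
vertices as connectors. -/
lemma exists_isTube_fin {d t m n : ℕ} (hd : 2 ≤ d) (hm0 : 0 < m) (hm : d ∣ m) (ht : d + 2 ≤ t)
    {k : ℕ} (hk : k = (d + 2).choose 2) {X : ℝ} (hX : 1 < X)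
    (hXle : X * (d : ℝ) ^ (k - 1) ≤ d ^ t.choose d * m)
    (hn : 2 * d + 2 + t * d ^ t.choose d * m ≤ n)
    (hK : ∀ g, 1 ≤ g → g ≤ d →
      d * (2 ^ (d + 3) * (t * d ^ t.choose d * (t * d ^ t.choose d * m) ^ (g - 1))) *
        ((2 * d + 2).choose g) ^ 2 < (n - t * d ^ t.choose d * m).choose g) :
    ∃ (M : ℕ) (v : ℕ → Fin n), IsTube d (M * ((d + 2) * m - 1 + (2 * d + 2))) v ∧
      ((t.choose d : ℝ) * ((d : ℝ) ^ t.choose d * m) ^ d / (d * m)) *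
        (1 - ((Real.log X / (2 * (k : ℝ) ^ 3)) ^ (-(1 / ((k : ℝ) - 1))) +
          4 * Real.log X / √X)) ≤ k * M := by
  have : NeZero d := ⟨by omega⟩
  have : NeZero m := ⟨hm0.ne'⟩
  have hcard := card_label d t m
  have hdm : d ≤ m := Nat.le_of_dvd hm0 hm
  obtain ⟨M, T, hinj, hper, hshare, hzero, hM⟩ := exists_labelTrails hd hm ht hk hX
    (by rw [hcard]; exact_mod_cast hXle)
  rw [hcard] at hM
  push_cast at hM
  set w := n - t * d ^ t.choose d * m with hw
  -- the vertices are those of the trails and `w` vertices reserved for the connectors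
  let V := (Fin t × Label d t m) ⊕ Fin w
  have hV : Fintype.card V = n := by
    rw [Fintype.card_sum, Fintype.card_prod, hcard, Fintype.card_fin, Fintype.card_fin, ← mul_assoc]
    omega
  let Z : Finset V := (univ : Finset (Fin t × (TypeSet d t → ZMod d))).image
    fun y => Sum.inl (y.1, y.2, 0)
  let U : Finset V := univ.image Sum.inl
  let W : Finset V := univ.image Sum.inr
  have hZcard : Z.card ≤ t * d ^ t.choose d := by
    refine card_image_le.trans ?_
    rw [card_univ, Fintype.card_prod, Fintype.card_fun, ZMod.card, Fintype.card_finset_len,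
      Fintype.card_fin]
  have hUcard : U.card = t * d ^ t.choose d * m := by
    rw [card_image_of_injective _ Sum.inl_injective, card_univ, Fintype.card_prod, hcard,
      Fintype.card_fin, mul_assoc]
  have hWcard : W.card = w := by
    rw [card_image_of_injective _ Sum.inr_injective, card_univ, Fintype.card_fin]
  obtain ⟨v, hv⟩ := exists_isTube_of_trails (d := d) (p := (d + 2) * m) (M := M)
    (T := fun i a => (Sum.inl (T i a) : V)) (Z := Z) (U := U) (W := W) (by omega)
    (by
      have : (d + 2) * 2 ≤ (d + 2) * m := Nat.mul_le_mul_left _ (by omega)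
      omega)
    (fun i hi a ha b hb h => hinj i hi a ha b hb (Sum.inl_injective h))
    (fun i hi => congrArg Sum.inl (hper i hi))
    (by
      intro i hi j hj A A' hA hA' hs hs' h
      refine hshare i hi j hj A A' hA hA' hs hs'
        (image_injective (Sum.inl_injective (β := Fin w)) ?_)
      rw [image_image, image_image]
      exact h)
    (by
      intro i hi
      refine mem_image.2 ⟨((T i 0).1, (T i 0).2.1), mem_univ _, ?_⟩
      rw [← hzero i hi])
    (fun i _ a => mem_image_of_mem _ (mem_univ _))
    (by
      rw [disjoint_left]
      intro x hx hx'
      obtain ⟨y, -, rfl⟩ := mem_image.1 hx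
      obtain ⟨z, -, h⟩ := mem_image.1 hx'
      exact Sum.inr_ne_inl h)
    (by omega)
    (by
      intro g hg hgd
      refine lt_of_le_of_lt ?_ (hWcard ▸ hK g hg hgd)
      rw [hUcard]
      gcongr)
  let φ : V ≃ Fin n := Fintype.equivFinOfCardEq hV
  exact ⟨M, _, hv.comp φ.injective, hM⟩

/-- The diameter of a tube made of `M` trails, where `M` is close to the number of the `d`-sets with
distinct types divided by `k * d * m`. -/
lemma exists_diam_ge {d t m n M : ℕ} (hd : 2 ≤ d) (hm0 : 0 < m) {k : ℕ}
    (hk : k = (d + 2).choose 2) {θ : ℝ} {v : ℕ → Fin n}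
    (hv : IsTube d (M * ((d + 2) * m - 1 + (2 * d + 2))) v) (hM0 : 0 < M) (u : ℝ)
    (hM : ((t.choose d : ℝ) * (u * m) ^ d / (d * m)) * (1 - θ) ≤ k * M) :
    ∃ D ∈ pmDiameters n d,
      2 / ((d : ℝ) + 1) ^ 2 * ((t.choose d : ℝ) * (u * m) ^ d) * (1 - θ) - d ≤ D := by
  have hL : d + 4 ≤ M * ((d + 2) * m - 1 + (2 * d + 2)) := by
    have h1 : d + 2 ≤ (d + 2) * m := Nat.le_mul_of_pos_right _ hm0
    have h2 : (d + 2) * m - 1 + (2 * d + 2) ≤ M * ((d + 2) * m - 1 + (2 * d + 2)) :=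
      Nat.le_mul_of_pos_left _ hM0
    omega
  refine ⟨_, ⟨tubeComplex d _ v, hv.isPseudomanifold hd hL, hv.stronglyConnected hd hL, rfl⟩, ?_⟩
  have h1 := hv.le_diam hd hL
  set D := (dualGraph (tubeComplex d (M * ((d + 2) * m - 1 + (2 * d + 2))) v) d).diam with hD
  have h2 : M * ((d + 2) * m) ≤ M * ((d + 2) * m - 1 + (2 * d + 2)) :=
    Nat.mul_le_mul_left _ (by omega)
  have h3 : d * (M * ((d + 2) * m)) ≤ (d + 1) * D + d * (d + 1) := by
    calc d * (M * ((d + 2) * m)) ≤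
          d * ((M * ((d + 2) * m - 1 + (2 * d + 2)) - (d + 1)) + (d + 1)) :=
          Nat.mul_le_mul_left _ (by omega)
      _ ≤ _ := by rw [mul_add]; omega
  have h4 : (d : ℝ) * (M * ((d + 2) * m)) ≤ (d + 1) * D + d * (d + 1) := by exact_mod_cast h3
  have hk' : (k : ℝ) = (d + 2) * (d + 1) / 2 := by
    rw [hk, Nat.cast_choose_two]
    push_cast
    ring
  have hd0 : (0 : ℝ) < d := by exact_mod_cast (by omega : 0 < d)
  have hm0' : (0 : ℝ) < m := by exact_mod_cast hm0
  rw [div_mul_eq_mul_div, div_le_iff₀ (by positivity), hk'] at hM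
  rw [div_mul_eq_mul_div, div_mul_eq_mul_div, sub_le_iff_le_add, div_le_iff₀ (by positivity)]
  nlinarith

end FiniteConstruction

/-! ### Asymptotics of the errors -/

section Asymptotics

open Filter Topology

lemma tendsto_rpow_mul_rpow_neg {ε α : ℝ} (h : ε < α) :
    Tendsto (fun s : ℝ => s ^ ε * s ^ (-α)) atTop (𝓝 0) := by
  refine (tendsto_rpow_neg_atTop (sub_pos.2 h)).congr' ?_
  filter_upwards [eventually_gt_atTop 0] with s hs
  rw [← Real.rpow_add hs]
  congr 1
  ring

/-- The number of types: about `(log n) ^ (1 / (d + 1))`, as a function of `s = log n`. There are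
then only `d ^ t.choose d = n ^ o(1)` possibilities for the stages of a label. -/
noncomputable def numTypes (d : ℕ) (s : ℝ) : ℕ := ⌊s ^ (1 / ((d : ℝ) + 1))⌋₊

lemma tendsto_numTypes (d : ℕ) : Tendsto (numTypes d) atTop atTop :=
  tendsto_nat_floor_atTop.comp (tendsto_rpow_atTop (by positivity))

lemma numTypes_pow_le (d : ℕ) {s : ℝ} (hs : 0 ≤ s) : (numTypes d s : ℝ) ^ (d + 1) ≤ s := by
  calc (numTypes d s : ℝ) ^ (d + 1) ≤ (s ^ (1 / ((d : ℝ) + 1))) ^ (d + 1) :=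
        pow_le_pow_left₀ (Nat.cast_nonneg _) (Nat.floor_le (by positivity)) _
    _ = s := by
        rw [← Real.rpow_natCast, ← Real.rpow_mul hs]
        push_cast
        rw [one_div_mul_cancel (by positivity), Real.rpow_one]

lemma eventually_pow_le_exp (c : ℝ) (j : ℕ) {b : ℝ} (hb : 0 < b) :
    ∀ᶠ s : ℝ in atTop, c * s ^ j < Real.exp (b * s) := by
  have h := (tendsto_rpow_mul_exp_neg_mul_atTop_nhds_zero j b hb).const_mul c
  rw [mul_zero] at h
  filter_upwards [h.eventually_lt_const one_pos] with s hs
  rw [Real.rpow_natCast, neg_mul, Real.exp_neg, ← mul_assoc, ← div_eq_mul_inv,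
    div_lt_one (Real.exp_pos _)] at hs
  exact hs

lemma eventually_numTypes_mul_le {d : ℕ} (hd : 1 ≤ d) : ∀ᶠ s : ℝ in atTop,
    (numTypes d s : ℝ) * (d : ℝ) ^ (numTypes d s).choose d ≤ Real.exp (s / 2) := by
  filter_upwards [(tendsto_natCast_atTop_atTop.comp (tendsto_numTypes d)).eventually_ge_atTop
    (4 * Real.log d), (tendsto_numTypes d).eventually_ge_atTop 1, eventually_ge_atTop (1 : ℝ),
    eventually_pow_le_exp 1 1 (by norm_num : (0 : ℝ) < 1 / 4)] with s h1 h2 h3 h4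
  simp only [Function.comp_apply] at h1
  set t := numTypes d s
  have hpow := numTypes_pow_le d (s := s) (by linarith)
  have ht : (1 : ℝ) ≤ t := by exact_mod_cast h2
  have hlog : 0 ≤ Real.log d := Real.log_natCast_nonneg d
  have hd0 : (0 : ℝ) < d := by exact_mod_cast hd
  have hts : (t : ℝ) ≤ s := (le_self_pow₀ ht (by omega)).trans hpow
  have h5 : (d : ℝ) ^ t.choose d ≤ Real.exp (1 / 4 * s) := by
    rw [← Real.rpow_natCast, Real.rpow_def_of_pos hd0, Real.exp_le_exp]
    have h6 : ((t.choose d : ℕ) : ℝ) ≤ (t : ℝ) ^ d := by exact_mod_cast Nat.choose_le_pow _ _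
    calc Real.log d * (t.choose d : ℕ) ≤ (t / 4) * (t : ℝ) ^ d := by
          refine mul_le_mul (by linarith) h6 (Nat.cast_nonneg _) (by positivity)
      _ = 1 / 4 * (t : ℝ) ^ (d + 1) := by ring
      _ ≤ _ := by linarith
  calc (t : ℝ) * (d : ℝ) ^ t.choose d ≤ Real.exp (1 / 4 * s) * Real.exp (1 / 4 * s) :=
        mul_le_mul (by linarith) h5 (by positivity) (Real.exp_pos _).le
    _ = Real.exp (s / 2) := by
        rw [← Real.exp_add]
        congr 1
        ring

/-- All relative losses of the construction together, as a function of `s = log n`. The first two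
terms stem from the matching; the others from `d`-sets with repeated types, from the reserve, from
rounding the modulus of the heights, and from the bounded loss in the diameter. The first term
dominates. -/
lemma eventually_error_le {d k : ℕ} (hd : 2 ≤ d) (hk : k = (d + 2).choose 2) {ε : ℝ}
    (hε : ε < 2 / ((d : ℝ) ^ 3 + (d : ℝ) ^ 2 - 2)) :
    ∀ᶠ s : ℝ in atTop,
      (s / 2 / (2 * (k : ℝ) ^ 3)) ^ (-(1 / ((k : ℝ) - 1))) + 4 * (s / 2) / Real.exp (s / 4) +
        (d : ℝ) ^ 2 / numTypes d s + d / s + (d : ℝ) ^ 2 * Real.exp (-(s / 2)) +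
          d * Real.exp (-s) ≤ s ^ (-ε) := by
  have hd2 : (2 : ℝ) ≤ d := by exact_mod_cast hd
  have hk' : (k : ℝ) = (d + 2) * (d + 1) / 2 := by
    rw [hk, Nat.cast_choose_two]
    push_cast
    ring
  have hkpos : (0 : ℝ) < k := by rw [hk']; positivity
  have hα : ε < 1 / ((k : ℝ) - 1) := by
    refine hε.trans_le ?_
    rw [hk', show ((d : ℝ) + 2) * (d + 1) / 2 - 1 = ((d : ℝ) ^ 2 + 3 * d) / 2 by ring, one_div_div]
    refine div_le_div_of_nonneg_left (by norm_num) (by positivity) ?_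
    nlinarith [mul_nonneg (sub_nonneg.2 hd2) (sub_nonneg.2 hd2),
      mul_nonneg (mul_nonneg (sub_nonneg.2 hd2) (sub_nonneg.2 hd2)) (sub_nonneg.2 hd2)]
  have hden : (0 : ℝ) < (d : ℝ) ^ 3 + (d : ℝ) ^ 2 - 2 := by nlinarith [sq_nonneg (d : ℝ)]
  have hβ : ε < 1 / ((d : ℝ) + 1) := by
    refine hε.trans_le ?_
    rw [div_le_div_iff₀ hden (by positivity)]
    nlinarith [mul_nonneg (sub_nonneg.2 hd2) (sub_nonneg.2 hd2),
      mul_nonneg (mul_nonneg (sub_nonneg.2 hd2) (sub_nonneg.2 hd2)) (sub_nonneg.2 hd2)]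
  have hε1 : ε < 1 := hβ.trans_le (by rw [div_le_one (by positivity)]; linarith)
  have h1 : Tendsto (fun s : ℝ => (2 * (2 * (k : ℝ) ^ 3)) ^ (1 / ((k : ℝ) - 1)) *
      (s ^ ε * s ^ (-(1 / ((k : ℝ) - 1))))) atTop (𝓝 0) := by
    simpa using (tendsto_rpow_mul_rpow_neg hα).const_mul
      ((2 * (2 * (k : ℝ) ^ 3)) ^ (1 / ((k : ℝ) - 1)))
  have h2 : Tendsto (fun s : ℝ => 2 * (s ^ (ε + 1) * Real.exp (-(1 / 4) * s))) atTop (𝓝 0) := by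
    simpa using (tendsto_rpow_mul_exp_neg_mul_atTop_nhds_zero (ε + 1) (1 / 4)
      (by norm_num)).const_mul 2
  have h3 : Tendsto (fun s : ℝ => (d : ℝ) ^ 2 * 2 * (s ^ ε * s ^ (-(1 / ((d : ℝ) + 1)))))
      atTop (𝓝 0) := by
    simpa using (tendsto_rpow_mul_rpow_neg hβ).const_mul ((d : ℝ) ^ 2 * 2)
  have h4 : Tendsto (fun s : ℝ => (d : ℝ) * (s ^ ε * s ^ (-(1 : ℝ)))) atTop (𝓝 0) := by
    simpa using (tendsto_rpow_mul_rpow_neg hε1).const_mul (d : ℝ)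
  have h5 : Tendsto (fun s : ℝ => (d : ℝ) ^ 2 * (s ^ ε * Real.exp (-(1 / 2) * s))) atTop
      (𝓝 0) := by
    simpa using (tendsto_rpow_mul_exp_neg_mul_atTop_nhds_zero ε (1 / 2)
      (by norm_num)).const_mul ((d : ℝ) ^ 2)
  have h6 : Tendsto (fun s : ℝ => (d : ℝ) * (s ^ ε * Real.exp (-1 * s))) atTop (𝓝 0) := by
    simpa using (tendsto_rpow_mul_exp_neg_mul_atTop_nhds_zero ε 1 one_pos).const_mul (d : ℝ)
  have hsum := ((((h1.add h2).add h3).add h4).add h5).add h6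
  simp only [add_zero] at hsum
  filter_upwards [hsum.eventually_le_const one_pos, eventually_gt_atTop 0,
    (tendsto_rpow_atTop (by positivity : 0 < 1 / ((d : ℝ) + 1))).eventually_ge_atTop 2]
    with s hs hs0 hs2
  have hpos : 0 < s ^ ε := Real.rpow_pos_of_pos hs0 _
  rw [Real.rpow_neg hs0.le, ← one_div, le_div_iff₀ hpos]
  refine le_trans ?_ hs
  have e1 : (s / 2 / (2 * (k : ℝ) ^ 3)) ^ (-(1 / ((k : ℝ) - 1))) =
      (2 * (2 * (k : ℝ) ^ 3)) ^ (1 / ((k : ℝ) - 1)) * s ^ (-(1 / ((k : ℝ) - 1))) := by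
    rw [div_div, Real.div_rpow hs0.le (by positivity),
      Real.rpow_neg (x := 2 * (2 * (k : ℝ) ^ 3)) (by positivity), div_inv_eq_mul, mul_comm]
  have e2 : 4 * (s / 2) / Real.exp (s / 4) = 2 * (s * Real.exp (-(1 / 4) * s)) := by
    rw [show -(1 / 4) * s = -(s / 4) by ring, Real.exp_neg]
    ring
  have e2' : s ^ (ε + 1) = s ^ ε * s := by rw [Real.rpow_add hs0, Real.rpow_one]
  have e3 : (d : ℝ) ^ 2 / numTypes d s ≤ (d : ℝ) ^ 2 * 2 * s ^ (-(1 / ((d : ℝ) + 1))) := by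
    have h7 : s ^ (1 / ((d : ℝ) + 1)) / 2 ≤ numTypes d s := by
      have := Nat.sub_one_lt_floor (s ^ (1 / ((d : ℝ) + 1)))
      unfold numTypes
      linarith
    rw [Real.rpow_neg hs0.le, ← div_eq_mul_inv, mul_div_assoc, div_eq_mul_inv]
    refine mul_le_mul_of_nonneg_left ?_ (by positivity)
    rw [← inv_div]
    exact inv_anti₀ (by positivity) h7
  have e4 : (d : ℝ) / s = d * s ^ (-(1 : ℝ)) := by
    rw [Real.rpow_neg hs0.le, Real.rpow_one, div_eq_mul_inv]
  rw [e1, e2, e4, e2', show -(s / 2) = -(1 / 2) * s by ring, show -s = -1 * s by ring]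
  nlinarith [mul_le_mul_of_nonneg_left e3 hpos.le]

end Asymptotics

/-! ### The lower bound -/

section LowerBound

lemma le_choose_of_le {d t : ℕ} (ht : d ≤ t) (ht0 : 0 < t) :
    (t : ℝ) ^ d / d.factorial * (1 - (d : ℝ) ^ 2 / t) ≤ t.choose d := by
  have ht0' : (0 : ℝ) < t := by exact_mod_cast ht0
  have htd : (d : ℝ) ≤ t := by exact_mod_cast ht
  have h1 : (t : ℝ) ^ d * (1 - (d : ℝ) ^ 2 / t) ≤ ((t : ℝ) - d) ^ d := by
    have h2 : (1 : ℝ) + d * (-(d / t)) ≤ (1 + -(d / t)) ^ d :=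
      one_add_mul_le_pow (by
        have : (d : ℝ) / t ≤ 1 := (div_le_one ht0').2 htd
        linarith) d
    calc (t : ℝ) ^ d * (1 - (d : ℝ) ^ 2 / t) = t ^ d * (1 + d * (-(d / t))) := by ring
      _ ≤ t ^ d * (1 + -(d / t)) ^ d := mul_le_mul_of_nonneg_left h2 (by positivity)
      _ = ((t : ℝ) - d) ^ d := by
        rw [← mul_pow]
        congr 1
        field_simp
        ring
  have h3 := Nat.pow_le_choose (α := ℝ) d t
  refine le_trans ?_ h3
  rw [div_mul_eq_mul_div]
  refine div_le_div_of_nonneg_right (h1.trans (pow_le_pow_left₀ (by linarith) ?_ d)) (by positivity)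
  rw [Nat.cast_sub (by omega)]
  push_cast
  linarith

/-- The number of `d`-sets of vertices with distinct types, up to the relative error arising from
the number `t` of types and from the number `t * x` of vertices used. -/
lemma le_choose_mul_pow {d t : ℕ} (ht : d ≤ t) (ht0 : 0 < t) {N x y : ℝ} (hN : 0 ≤ N) (hy0 : 0 ≤ y)
    (hy1 : y ≤ 1) (ha : (d : ℝ) ^ 2 / t ≤ 1) (h : N * (1 - y) ≤ t * x) :
    N ^ d / d.factorial * (1 - (d : ℝ) ^ 2 / t - d * y) ≤ (t.choose d : ℝ) * x ^ d := by
  have ht0' : (0 : ℝ) < t := by exact_mod_cast ht0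
  have hx : 0 ≤ x :=
    nonneg_of_mul_nonneg_right ((mul_nonneg hN (by linarith : 0 ≤ 1 - y)).trans h) ht0'
  have h1 := le_choose_of_le ht ht0
  set a := (d : ℝ) ^ 2 / t with ha'
  have ha0 : 0 ≤ a := by positivity
  have h2 : N ^ d * (1 - d * y) ≤ (t * x) ^ d := by
    have h3 : (1 : ℝ) + d * (-y) ≤ (1 + -y) ^ d := one_add_mul_le_pow (by linarith) d
    calc N ^ d * (1 - d * y) = N ^ d * (1 + d * (-y)) := by ring
      _ ≤ N ^ d * (1 + -y) ^ d := mul_le_mul_of_nonneg_left h3 (by positivity)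
      _ = (N * (1 - y)) ^ d := by rw [← mul_pow]; ring
      _ ≤ _ := pow_le_pow_left₀ (mul_nonneg hN (by linarith)) h d
  have h4 : 0 ≤ 1 - a := by linarith
  calc N ^ d / d.factorial * (1 - a - d * y) ≤ N ^ d / d.factorial * ((1 - a) * (1 - d * y)) := by
        refine mul_le_mul_of_nonneg_left ?_ (by positivity)
        nlinarith [mul_nonneg ha0 (mul_nonneg (Nat.cast_nonneg (α := ℝ) d) hy0)]
    _ = N ^ d * (1 - d * y) * ((1 - a) / d.factorial) := by ring
    _ ≤ (t * x) ^ d * ((1 - a) / d.factorial) :=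
        mul_le_mul_of_nonneg_right h2 (div_nonneg h4 (by positivity))
    _ = (t : ℝ) ^ d / d.factorial * (1 - a) * x ^ d := by ring
    _ ≤ _ := mul_le_mul_of_nonneg_right h1 (by positivity)

/-- The condition needed for choosing the connectors, for `w` vertices reserved for them. -/
lemma connector_condition {d n Q m w : ℕ} {s : ℝ} (hd : 1 ≤ d) (hs : 1 ≤ s)
    (hn : (n : ℝ) = Real.exp s) (hQ : (Q : ℝ) ≤ Real.exp (s / 2)) (hQm : Q * m ≤ n) (hw : n / s ≤ w)
    (hC : ((d * (2 ^ (d + 3)) * (2 ^ (2 * d + 2)) ^ 2 * d.factorial : ℕ) : ℝ) * (2 * s) ^ d <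
      Real.exp (s / 2)) :
    2 * d + 2 ≤ w ∧ ∀ g, 1 ≤ g → g ≤ d →
      d * (2 ^ (d + 3) * (Q * (Q * m) ^ (g - 1))) * ((2 * d + 2).choose g) ^ 2 < w.choose g := by
  set B : ℕ := d * 2 ^ (d + 3) * (2 ^ (2 * d + 2)) ^ 2 with hB
  have hs0 : 0 < s := by linarith
  have hnexp : (n : ℝ) = Real.exp (s / 2) * Real.exp (s / 2) := by
    rw [hn, ← Real.exp_add]
    congr 1
    ring
  have hfac : (1 : ℝ) ≤ d.factorial := by exact_mod_cast d.factorial_pos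
  have hBlarge : 2 * d + 2 ≤ B := by
    have h1 : 2 * d + 2 < 2 ^ (2 * d + 2) := Nat.lt_two_pow_self
    have h2 : 2 ^ (2 * d + 2) ≤ (2 ^ (2 * d + 2)) ^ 2 := Nat.le_self_pow (by norm_num) _
    have h3 : (2 ^ (2 * d + 2)) ^ 2 ≤ B := Nat.le_mul_of_pos_left _ (by positivity)
    omega
  have h2s : (2 : ℝ) * s ≤ (2 * s) ^ d := le_self_pow₀ (by linarith) (by omega)
  push_cast at hC
  have hC' : (B : ℝ) * d.factorial * (2 * s) ^ d < Real.exp (s / 2) := by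
    rw [hB]
    exact_mod_cast hC
  have hB1 : (1 : ℝ) ≤ B := by exact_mod_cast (by omega : 1 ≤ B)
  have hsB : (B : ℝ) * s ≤ Real.exp (s / 2) := by
    refine le_trans ?_ hC'.le
    calc (B : ℝ) * s ≤ B * 1 * (2 * s) ^ d := by
          rw [mul_one]
          exact mul_le_mul_of_nonneg_left (by linarith) (by linarith)
      _ ≤ _ := by gcongr
  have hE1 : 1 ≤ Real.exp (s / 2) := Real.one_le_exp (by linarith)
  have hwB : (B : ℝ) ≤ w := by
    refine le_trans ?_ hw
    rw [le_div_iff₀ hs0, hnexp]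
    nlinarith
  have hw2 : 2 * d + 2 ≤ w := hBlarge.trans (by exact_mod_cast hwB)
  refine ⟨hw2, fun g hg hgd => ?_⟩
  have hchoose : (2 * d + 2).choose g ≤ 2 ^ (2 * d + 2) := Nat.choose_le_two_pow _ _
  have hlow : (n / (2 * s)) ^ g / d.factorial ≤ (w.choose g : ℝ) := by
    refine le_trans ?_ (Nat.pow_le_choose (α := ℝ) g w)
    refine div_le_div₀ (by positivity) (pow_le_pow_left₀ (by positivity) ?_ g) (by positivity)
      (by exact_mod_cast Nat.factorial_le hgd)
    rw [Nat.cast_sub (by omega)]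
    push_cast
    have h1 : (n : ℝ) / (2 * s) = n / s / 2 := by rw [mul_comm, div_div]
    have h2 : (g : ℝ) ≤ d := by exact_mod_cast hgd
    have h3 : (2 * d + 2 : ℝ) ≤ w := by exact_mod_cast hw2
    rw [h1]
    linarith
  have hup : ((d * (2 ^ (d + 3) * (Q * (Q * m) ^ (g - 1))) * ((2 * d + 2).choose g) ^ 2 : ℕ) : ℝ) ≤
      B * (Q * (n : ℝ) ^ (g - 1)) := by
    have h1 : d * (2 ^ (d + 3) * (Q * (Q * m) ^ (g - 1))) * ((2 * d + 2).choose g) ^ 2 ≤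
        d * (2 ^ (d + 3) * (Q * n ^ (g - 1))) * (2 ^ (2 * d + 2)) ^ 2 := by gcongr
    have h2 : d * (2 ^ (d + 3) * (Q * n ^ (g - 1))) * (2 ^ (2 * d + 2)) ^ 2 =
        B * (Q * n ^ (g - 1)) := by
      rw [hB]
      ring
    rw [h2] at h1
    exact_mod_cast h1
  have hn0 : (0 : ℝ) < n := by rw [hn]; exact Real.exp_pos _
  rw [← Nat.cast_lt (α := ℝ)]
  refine hup.trans_lt (lt_of_lt_of_le ?_ hlow)
  rw [div_pow, div_div, lt_div_iff₀ (by positivity)]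
  have h2sg : (2 * s) ^ g ≤ (2 * s) ^ d := pow_le_pow_right₀ (by linarith) hgd
  calc (B : ℝ) * (Q * (n : ℝ) ^ (g - 1)) * ((2 * s) ^ g * d.factorial)
      = (B * d.factorial * (2 * s) ^ g) * Q * (n : ℝ) ^ (g - 1) := by ring
    _ ≤ (B * d.factorial * (2 * s) ^ d) * Real.exp (s / 2) * (n : ℝ) ^ (g - 1) := by gcongr
    _ < Real.exp (s / 2) * Real.exp (s / 2) * (n : ℝ) ^ (g - 1) := by gcongr
    _ = (n : ℝ) ^ g := by
      rw [← hnexp, ← pow_succ']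
      congr 1
      omega

/-- The relative errors `θ` of the matching, `a` and `b` of the number of available `d`-sets, and
`η` of the additive constant in the diameter add up to at most `δ`. -/
lemma lower_bound_of_error_le {d : ℕ} (hd : 2 ≤ d) {N A a b θ η δ D : ℝ} (hN : 1 ≤ N) (ha : 0 ≤ a)
    (hb : 0 ≤ b) (hθ : 0 ≤ θ) (hη : 0 ≤ η) (hNη : N * η = d) (herr : θ + a + b + η ≤ δ) (hδ : δ < 1)
    (hA : N ^ d / d.factorial * (1 - a - b) ≤ A)
    (hD : 2 / ((d : ℝ) + 1) ^ 2 * A * (1 - θ) - d ≤ D) :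
    (2 / (((d : ℝ) + 1) * (Nat.factorial (d + 1) : ℝ)) - δ) * N ^ d ≤ D := by
  refine le_trans ?_ hD
  have hfac : (Nat.factorial (d + 1) : ℝ) = (d + 1) * d.factorial := by
    rw [Nat.factorial_succ]
    push_cast
    ring
  have hfac1 : (1 : ℝ) ≤ d.factorial := by exact_mod_cast d.factorial_pos
  have hd2 : (2 : ℝ) ≤ d := by exact_mod_cast hd
  set c := 2 / (((d : ℝ) + 1) * (Nat.factorial (d + 1) : ℝ)) with hc
  have hc' : c = 2 / ((d : ℝ) + 1) ^ 2 / d.factorial := by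
    rw [hc, hfac, div_div]
    congr 1
    ring
  have hc1 : c ≤ 1 := by
    rw [hc', div_div, div_le_one (by positivity)]
    nlinarith
  have hc0 : 0 ≤ c := by positivity
  have hNd0 : 0 < N ^ d := by positivity
  have hnd : (d : ℝ) ≤ N ^ d * η := by
    rw [← hNη]
    exact mul_le_mul_of_nonneg_right (le_self_pow₀ hN (by omega)) hη
  have hθ1 : 0 ≤ 1 - θ := by linarith
  have hmain : c * N ^ d * ((1 - a - b) * (1 - θ)) ≤ 2 / ((d : ℝ) + 1) ^ 2 * A * (1 - θ) := by
    calc c * N ^ d * ((1 - a - b) * (1 - θ))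
        = 2 / ((d : ℝ) + 1) ^ 2 * (N ^ d / d.factorial * (1 - a - b)) * (1 - θ) := by
          rw [hc']
          ring
      _ ≤ _ := by gcongr
  have h5 : 1 - (θ + a + b) ≤ (1 - a - b) * (1 - θ) := by
    nlinarith [mul_nonneg hθ (add_nonneg ha hb)]
  have h6 : c * N ^ d * (1 - (θ + a + b)) ≤ c * N ^ d * ((1 - a - b) * (1 - θ)) := by gcongr
  have h7 : c * N ^ d * (θ + a + b) ≤ N ^ d * (θ + a + b) :=
    mul_le_mul_of_nonneg_right (mul_le_of_le_one_left hNd0.le hc1) (by positivity)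
  have h8 := mul_le_mul_of_nonneg_left herr hNd0.le
  linarith

/-- The modulus `m` of the heights, for `Q` pairs of a type and a stage function: a multiple of `d`
such that the number `Q * m` of vertices is slightly less than `n - n / s`. -/
lemma exists_modulus {d n Q : ℕ} (hd : 0 < d) {s : ℝ} (hs : 1 < s) (hn : (n : ℝ) = Real.exp s)
    (hQ0 : 0 < Q) (hQ : (Q : ℝ) ≤ Real.exp (s / 2))
    (hy : 1 / s + d * Real.exp (-(s / 2)) ≤ 1 / 2) :
    ∃ m, d ∣ m ∧ 0 < m ∧ (Q : ℝ) * m ≤ n - n / s ∧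
      (n : ℝ) * (1 - (1 / s + d * Real.exp (-(s / 2)))) ≤ Q * m := by
  have hn0 : (0 : ℝ) < n := by rw [hn]; exact Real.exp_pos _
  have hd0 : (0 : ℝ) < d := by exact_mod_cast hd
  have hQ0' : (0 : ℝ) < Q := by exact_mod_cast hQ0
  set q : ℕ := ⌊((n : ℝ) - n / s) / (Q * d)⌋₊ with hq
  have hns : 0 ≤ (n : ℝ) - n / s := sub_nonneg.2 (div_le_self hn0.le hs.le)
  have hq1 : (Q : ℝ) * (d * q) ≤ n - n / s := by
    have := Nat.floor_le (div_nonneg hns (by positivity : (0 : ℝ) ≤ Q * d))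
    rw [le_div_iff₀ (by positivity)] at this
    linarith
  have hq2 : (n : ℝ) - n / s - Q * d ≤ Q * (d * q) := by
    have := Nat.lt_floor_add_one (((n : ℝ) - n / s) / (Q * d))
    rw [div_lt_iff₀ (by positivity)] at this
    linarith
  have hq3 : (n : ℝ) * (1 - (1 / s + d * Real.exp (-(s / 2)))) ≤ Q * (d * q) := by
    refine le_trans ?_ hq2
    have h1 : (n : ℝ) * Real.exp (-(s / 2)) = Real.exp (s / 2) := by
      rw [hn, ← Real.exp_add]
      congr 1
      ring
    have h2 : (d : ℝ) * Q ≤ d * Real.exp (s / 2) := mul_le_mul_of_nonneg_left hQ hd0.le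
    calc (n : ℝ) * (1 - (1 / s + d * Real.exp (-(s / 2)))) =
          n - n / s - d * (n * Real.exp (-(s / 2))) := by ring
      _ ≤ _ := by
        rw [h1]
        linarith
  refine ⟨d * q, dvd_mul_right _ _, ?_, by exact_mod_cast hq1, by exact_mod_cast hq3⟩
  rcases Nat.eq_zero_or_pos (d * q) with h | h
  · exfalso
    have h1 : ((d : ℝ) * q) = 0 := by exact_mod_cast h
    rw [h1, mul_zero] at hq3
    have h2 := mul_pos hn0 (by linarith : 0 < 1 - (1 / s + d * Real.exp (-(s / 2))))
    linarith
  · exact h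

/-- The construction for a single `n = exp s` with `t` types. The hypotheses hold for large `s` if
`t = numTypes d s`. -/
lemma exists_mem_pmDiameters_ge {d k n t : ℕ} (hd : 2 ≤ d) (hk : k = (d + 2).choose 2) {s ε : ℝ}
    (hε : 0 < ε) (hs : 1 < s) (hn : (n : ℝ) = Real.exp s) (ht : d + 2 ≤ t)
    (hQ : (t : ℝ) * (d : ℝ) ^ t.choose d ≤ Real.exp (s / 2))
    (hX : 2 * (t : ℝ) * (d : ℝ) ^ (k - 1) ≤ Real.exp (s / 2))
    (hC : ((d * (2 ^ (d + 3)) * (2 ^ (2 * d + 2)) ^ 2 * d.factorial : ℕ) : ℝ) * (2 * s) ^ d <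
      Real.exp (s / 2))
    (herr : (s / 2 / (2 * (k : ℝ) ^ 3)) ^ (-(1 / ((k : ℝ) - 1))) + 4 * (s / 2) / Real.exp (s / 4) +
        (d : ℝ) ^ 2 / t + d / s + (d : ℝ) ^ 2 * Real.exp (-(s / 2)) +
          d * Real.exp (-s) ≤ s ^ (-ε)) :
    ∃ D ∈ pmDiameters n d, (2 / (((d : ℝ) + 1) * (Nat.factorial (d + 1) : ℝ)) - s ^ (-ε)) *
      (n : ℝ) ^ d ≤ D := by
  have hs0 : 0 < s := by linarith
  have hn0 : (0 : ℝ) < n := by rw [hn]; exact Real.exp_pos _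
  have hd0 : (0 : ℝ) < d := by exact_mod_cast (by omega : 0 < d)
  have hd2 : (2 : ℝ) ≤ d := by exact_mod_cast hd
  have ht0 : (0 : ℝ) < t := by exact_mod_cast (by omega : 0 < t)
  have hnexp : (n : ℝ) = Real.exp (s / 2) * Real.exp (s / 2) := by
    rw [hn, ← Real.exp_add]
    congr 1
    ring
  set θ := (s / 2 / (2 * (k : ℝ) ^ 3)) ^ (-(1 / ((k : ℝ) - 1))) +
    4 * (s / 2) / Real.exp (s / 4) with hθ
  have hθ0 : 0 ≤ θ := by positivity
  have hδ1 : s ^ (-ε) < 1 := Real.rpow_lt_one_of_one_lt_of_neg hs (by linarith)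
  set a := (d : ℝ) ^ 2 / t with ha
  have ha0 : 0 ≤ a := by positivity
  set Q : ℕ := t * d ^ t.choose d with hQdef
  have hQ' : (Q : ℝ) ≤ Real.exp (s / 2) := by
    rw [hQdef]
    push_cast
    exact hQ
  have hQ0 : 0 < Q := Nat.mul_pos (by omega) (Nat.pow_pos (by omega))
  have hQ0' : (0 : ℝ) < Q := by exact_mod_cast hQ0
  set y := 1 / s + d * Real.exp (-(s / 2)) with hy
  have hy0 : 0 ≤ y := by positivity
  have hdy : d * y = d / s + (d : ℝ) ^ 2 * Real.exp (-(s / 2)) := by rw [hy]; ring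
  have hdy0 : 0 ≤ d * y := by positivity
  have hexps : 0 < (d : ℝ) * Real.exp (-s) := by positivity
  have herr' : θ + a + d * y + d * Real.exp (-s) ≤ s ^ (-ε) := by
    rw [hdy]
    linarith
  have ha1 : a ≤ 1 := by linarith
  have hy1 : y ≤ 1 / 2 := by nlinarith
  obtain ⟨m, hm, hm0, hq1, hq3⟩ := exists_modulus (by omega) hs hn hQ0 hQ' hy1
  have hQm : Q * m ≤ n := by
    have h1 : (Q : ℝ) * m ≤ n := hq1.trans (sub_le_self _ (by positivity))
    exact_mod_cast h1
  have hw : (n : ℝ) / s ≤ ((n - Q * m : ℕ) : ℝ) := by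
    rw [Nat.cast_sub hQm]
    push_cast
    linarith
  obtain ⟨hw2, hK⟩ := connector_condition (m := m) (by omega) hs.le hn hQ' hQm hw hC
  obtain ⟨M, v, hv, hM⟩ := exists_isTube_fin (X := Real.exp (s / 2)) hd hm0 hm ht hk
    (Real.one_lt_exp_iff.2 (by linarith)) (by
      have h1 : Real.exp (s / 2) * (d : ℝ) ^ (k - 1) * t ≤ (d : ℝ) ^ t.choose d * m * t := by
        have h2 : (d : ℝ) ^ t.choose d * m * t = Q * m := by
          rw [hQdef]
          push_cast
          ring
        rw [h2]
        refine le_trans ?_ hq3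
        have h3 := mul_le_mul_of_nonneg_left hX (Real.exp_pos (s / 2)).le
        rw [← hnexp] at h3
        have h4 : (n : ℝ) * (1 / 2) ≤ n * (1 - y) :=
          mul_le_mul_of_nonneg_left (by linarith) hn0.le
        linarith
      exact le_of_mul_le_mul_right h1 ht0) (n := n)
      ((Nat.le_sub_iff_add_le hQm).1 hw2) hK
  have hsqrt : √(Real.exp (s / 2)) = Real.exp (s / 4) := by
    rw [show s / 2 = s / 4 + s / 4 by ring, Real.exp_add, Real.sqrt_mul_self (Real.exp_pos _).le]
  rw [Real.log_exp, hsqrt, ← hθ] at hM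
  set x : ℝ := (d : ℝ) ^ t.choose d * m with hx
  have hA : (n : ℝ) ^ d / d.factorial * (1 - a - d * y) ≤ (t.choose d : ℝ) * x ^ d :=
    le_choose_mul_pow (by omega) (by omega) hn0.le hy0 (by linarith) ha1
      (hq3.trans_eq (by rw [hx, hQdef]; push_cast; ring))
  have hpos : 0 < 1 - a - d * y := by linarith
  have hM0 : 0 < M := by
    rcases Nat.eq_zero_or_pos M with h | h
    · exfalso
      rw [h, Nat.cast_zero, mul_zero] at hM
      have h1 : 0 < (t.choose d : ℝ) * x ^ d :=
        lt_of_lt_of_le (by positivity) hA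
      have hm0' : (0 : ℝ) < m := by exact_mod_cast hm0
      have h2 : 0 < 1 - θ := by linarith
      have h3 := mul_pos (div_pos h1 (mul_pos hd0 hm0')) h2
      linarith
    · exact h
  obtain ⟨D, hD, hDge⟩ := exists_diam_ge hd hm0 hk hv hM0 _ hM
  refine ⟨D, hD,
    lower_bound_of_error_le hd ?_ ha0 (by positivity) hθ0 hexps.le ?_ herr' hδ1 hA hDge⟩
  · rw [hn]
    exact Real.one_le_exp hs0.le
  · rw [mul_left_comm, hn, ← Real.exp_add, add_neg_cancel, Real.exp_zero, mul_one]

open Filter in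
lemma eventually_exists_mem_pmDiameters_ge {d : ℕ} (hd : 2 ≤ d) {ε : ℝ} (hε0 : 0 < ε)
    (hε : ε < 2 / ((d : ℝ) ^ 3 + (d : ℝ) ^ 2 - 2)) :
    ∀ᶠ n : ℕ in atTop, ∃ D ∈ pmDiameters n d,
      (2 / (((d : ℝ) + 1) * (Nat.factorial (d + 1) : ℝ)) - (Real.log n) ^ (-ε)) *
        (n : ℝ) ^ d ≤ D := by
  have hs : ∀ᶠ s : ℝ in atTop, ∀ n : ℕ, (n : ℝ) = Real.exp s → ∃ D ∈ pmDiameters n d,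
      (2 / (((d : ℝ) + 1) * (Nat.factorial (d + 1) : ℝ)) - s ^ (-ε)) * (n : ℝ) ^ d ≤ D := by
    filter_upwards [eventually_error_le hd rfl hε, eventually_numTypes_mul_le (by omega : 1 ≤ d),
      eventually_gt_atTop (1 : ℝ), (tendsto_numTypes d).eventually_ge_atTop (d + 2),
      eventually_pow_le_exp (2 * (d : ℝ) ^ ((d + 2).choose 2 - 1)) 1
        (by norm_num : (0 : ℝ) < 1 / 2),
      eventually_pow_le_exp
        (((d * (2 ^ (d + 3)) * (2 ^ (2 * d + 2)) ^ 2 * d.factorial : ℕ) : ℝ) * 2 ^ d) d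
        (by norm_num : (0 : ℝ) < 1 / 2)] with s h1 h2 h3 h4 h5 h6 n hn
    rw [show 1 / 2 * s = s / 2 by ring] at h5 h6
    refine exists_mem_pmDiameters_ge hd rfl hε0 h3 hn h4 h2 ?_ ?_ h1
    · have ht : (1 : ℝ) ≤ numTypes d s := by exact_mod_cast (by omega : 1 ≤ numTypes d s)
      have hts : (numTypes d s : ℝ) ≤ s :=
        (le_self_pow₀ ht (by omega)).trans (numTypes_pow_le d (by linarith))
      refine le_trans ?_ h5.le
      rw [pow_one, mul_right_comm]
      gcongr
    · rw [mul_pow, ← mul_assoc]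
      exact h6
  filter_upwards [(Real.tendsto_log_atTop.comp tendsto_natCast_atTop_atTop).eventually hs,
    eventually_gt_atTop 0] with n h hn
  exact h n (Real.exp_log (by exact_mod_cast hn)).symm

end LowerBound

end Aux

theorem theorem1p3 (d : ℕ) (hd : 2 ≤ d) (ε : ℝ)
    (hε : ε < 2 / ((d : ℝ) ^ 3 + (d : ℝ) ^ 2 - 2)) :
    ∃ N : ℕ, ∀ n : ℕ, N ≤ n →
      IsGreatest (pmDiameters n d) (Hpm n d) ∧
      (2 / (((d : ℝ) + 1) * (Nat.factorial (d + 1) : ℝ)) - (Real.log (n : ℝ)) ^ (-ε))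
          * (n : ℝ) ^ d ≤ (Hpm n d : ℝ) ∧
      (Hpm n d : ℝ) ≤ 2 * (n : ℝ) ^ d / (((d : ℝ) + 1) * (Nat.factorial (d + 1) : ℝ)) := by
  have hd2 : (2 : ℝ) ≤ d := by exact_mod_cast hd
  have hpos : 0 < 2 / ((d : ℝ) ^ 3 + (d : ℝ) ^ 2 - 2) := by
    have : 0 < (d : ℝ) ^ 3 + (d : ℝ) ^ 2 - 2 := by nlinarith [sq_nonneg (d : ℝ)]
    positivity
  -- the bound is stronger for larger exponents, so the exponent may be assumed positive
  obtain ⟨ε', hε', hε'2⟩ := exists_between (max_lt hε hpos)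
  obtain ⟨hεε', hε'0⟩ := max_lt_iff.1 hε'
  obtain ⟨N, hN⟩ := Filter.eventually_atTop.1
    (eventually_exists_mem_pmDiameters_ge hd hε'0 hε'2)
  refine ⟨max (max N 3) ((d + 1) ^ 2 * d.factorial), fun n hn => ?_⟩
  have hnN : N ≤ n := by omega
  have hn3 : 3 ≤ n := by omega
  have hnd : (d + 1) ^ 2 * d.factorial ≤ n := (le_max_right _ _).trans hn
  obtain ⟨D, hD, hDge⟩ := hN n hnN
  have hub : ∀ k ∈ pmDiameters n d,
      (k : ℝ) ≤ 2 * (n : ℝ) ^ d / (((d : ℝ) + 1) * (Nat.factorial (d + 1) : ℝ)) := by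
    rintro k ⟨X, hX, hc, rfl⟩
    exact hX.diam_le_of_large hc hd hnd
  have hbdd : BddAbove (pmDiameters n d) :=
    ⟨⌊2 * (n : ℝ) ^ d / (((d : ℝ) + 1) * (Nat.factorial (d + 1) : ℝ))⌋₊,
      fun k hk => Nat.le_floor (hub k hk)⟩
  have hmem : Hpm n d ∈ pmDiameters n d := Nat.sSup_mem ⟨D, hD⟩ hbdd
  refine ⟨⟨hmem, fun k hk => le_csSup hbdd hk⟩, ?_, hub _ hmem⟩
  have hDH : (D : ℝ) ≤ Hpm n d := by exact_mod_cast le_csSup hbdd hD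
  refine le_trans ?_ (hDge.trans hDH)
  have hlog : 1 ≤ Real.log n := by
    rw [Real.le_log_iff_exp_le (by positivity)]
    have h3 : (3 : ℝ) ≤ n := by exact_mod_cast hn3
    linarith [Real.exp_one_lt_d9]
  refine mul_le_mul_of_nonneg_right ?_ (by positivity)
  exact sub_le_sub_left (Real.rpow_le_rpow_of_exponent_le hlog (by linarith)) _
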